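/- Let $X\in\mathbb R^{n}$, $Y\in\mathbb R^{m}$ be zero-mean jointly Gaussian with $\Sigma_X$ and $\Sigma_{Y|X}=\Sigma_Y-\Sigma_{YX}\Sigma_X^{-1}\Sigma_{YX}^T$ positive definite; put $\Theta=\Sigma_{YX}\Sigma_X^{-1}$. Let $\beta,\lambda>0$, $\gamma\ge 0$. For channels $p(T_1|X)$, $p(T_2|X)$, with $T_1\in\mathbb R^{k_1}$, $T_2\in\mathbb R^{k_2}$, $Y$ conditionally independent given $X$, consider the Lagrangian (distributed private federated learning, DPFL) $$\mathcal F=-I(Y;T_1,T_2)+\beta I(T_1;X)+\lambda I(T_2;X)+\gamma I(T_1;T_2)$$ and its alternating self-consistent iteration, in which $p^{(t)}(T_1)$, $p^{(t)}(T_2|T_1)$, $p^{(t)}(Y|T_1,T_2)$, etc. are computed from $p^{(t)}(T_1|X)$, $p^{(t)}(T_2|X)$ and, for almost every $x$, $$p^{(t+1)}(t_1|x)=\frac{p^{(t)}(t_1)}{Z_1^{(t)}(x)}\exp\Big\{\tfrac{\gamma}{\beta}D[p^{(t)}(T_2|x)\|p^{(t)}(T_2|t_1)]-\tfrac1\beta\mathbb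 E^{(t)}_{T_2|x}D[p(Y|x)\|p^{(t)}(Y|t_1,T_2)]\Big\},$$ $$p^{(t+1)}(t_2|x)=\frac{p^{(t)}(t_2)}{Z_2^{(t)}(x)}\exp\Big\{\tfrac{\gamma}{\lambda}D[p^{(t+1)}(T_1|x)\|p^{(t)}(T_1|t_2)]-\tfrac1\lambda\mathbb E^{(t+1)}_{T_1|x}D[p(Y|x)\|p^{(t)}(Y|T_1,t_2)]\Big\}.$$ Here $D$ is the Kullback–Leibler divergence and $Z_1,Z_2$ are normalizers, required to be finite. A Gaussian representation is $T_1=AX+\zeta_1$, $T_2=BX+\zeta_2$ with zero-mean Gaussian noises, independent of each other and of $(X,Y)$, with positive definite covariances $\Sigma_{\zeta_1},\Sigma_{\zeta_2}$. For it put $\Sigma_{T_1}=A\Sigma_XA^T+\Sigma_{\zeta_1}$, $\Sigma_{X|T_1}=\Sigma_X-\Sigma_XA^T\Sigma_{T_1}^{-1}A\Sigma_X$, $\Sigma_{T_2|T_1}=B\Sigma_{X|T_1}B^T+\Sigma_{\zeta_2}$, $\Xi_1=B\Sigma_XA^T\Sigma_{T_1}^{-1}$, $$\Psi_1=\Theta\big(\Sigma_XA^T\Sigma_{T_1|T_2}^{-1}-\Sigma_XB^T\Sigma_{T_2|T_1}^{-1}B\Sigma_XA^T\Sigma_{T_1}^{-1}\big),$$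 and define $\Sigma_{T_2},\Sigma_{X|T_2},\Sigma_{T_1|T_2},\Xi_2,\Psi_2$ by exchanging the roles of $(A,\zeta_1,T_1)$ and $(B,\zeta_2,T_2)$; put $\Sigma_{Y|T_1,T_2}=\Theta\Sigma_{X|T_1,T_2}\Theta^T+\Sigma_{Y|X}$ with $$\Sigma_{X|T_1,T_2}=\Sigma_X-\Sigma_XA^T\Sigma_{T_1|T_2}^{-1}A\Sigma_X+\Sigma_XA^T\Sigma_{T_1|T_2}^{-1}A\Sigma_XB^T\Sigma_{T_2}^{-1}B\Sigma_X+\Sigma_XB^T\Sigma_{T_2|T_1}^{-1}B\Sigma_XA^T\Sigma_{T_1}^{-1}A\Sigma_X-\Sigma_XB^T\Sigma_{T_2|T_1}^{-1}B\Sigma_X.$$ Then: 1. For every Gaussian representation the four mutual informations in $\mathcal F$ are finite; $\Sigma_{T_1}$, $\Sigma_{T_2}$, $\Sigma_{T_2|T_1}$, $\Sigma_{T_1|T_2}$, $\Sigma_{Y|T_1,T_2}$ are positive definite; $T_i\sim N(0,\Sigma_{T_i})$; and almost surely $p(Y|X)=N(\Theta X,\Sigma_{Y|X})$, $p(T_2|T_1)=N(\Xi_1T_1,\Sigma_{T_2|T_1})$,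 $p(T_1|T_2)=N(\Xi_2T_2,\Sigma_{T_1|T_2})$, $p(Y|T_1,T_2)=N(\Psi_1T_1+\Psi_2T_2,\Sigma_{Y|T_1,T_2})$. 2. Started at a Gaussian representation, the self-consistent iteration is exactly the matrix iteration $$\Sigma_{\zeta_1}^{-1\,(t+1)}=\Sigma_{T_1}^{-1\,(t)}-\tfrac{\gamma}{\beta}\Xi_1^{T(t)}\Sigma_{T_2|T_1}^{-1\,(t)}\Xi_1^{(t)}+\tfrac1\beta\Psi_1^{T(t)}\Sigma_{Y|T_1,T_2}^{-1\,(t)}\Psi_1^{(t)},$$ $$A^{(t+1)}=\Sigma_{\zeta_1}^{(t+1)}\Big[-\tfrac{\gamma}{\beta}\Xi_1^{T(t)}\Sigma_{T_2|T_1}^{-1\,(t)}B^{(t)}+\tfrac1\beta\Psi_1^{T(t)}\Sigma_{Y|T_1,T_2}^{-1\,(t)}(\Theta-\Psi_2^{(t)}B^{(t)})\Big],$$ $$\Sigma_{\zeta_2}^{-1\,(t+1)}=\Sigma_{T_2}^{-1\,(t)}-\tfrac{\gamma}{\lambda}\Xi_2^{T(t)}\Sigma_{T_1|T_2}^{-1\,(t)}\Xi_2^{(t)}+\tfrac1\lambda\Psi_2^{T(t)}\Sigma_{Y|T_1,T_2}^{-1\,(t)}\Psi_2^{(t)},$$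 $$B^{(t+1)}=\Sigma_{\zeta_2}^{(t+1)}\Big[-\tfrac{\gamma}{\lambda}\Xi_2^{T(t)}\Sigma_{T_1|T_2}^{-1\,(t)}A^{(t+1)}+\tfrac1\lambda\Psi_2^{T(t)}\Sigma_{Y|T_1,T_2}^{-1\,(t)}(\Theta-\Psi_1^{(t)}A^{(t+1)})\Big]:$$ for every $N$, a sequence of pairs of channels whose initial pair is (for almost every $x$) the Gaussian representation with parameters $(A^{(0)},\Sigma_{\zeta_1}^{(0)},B^{(0)},\Sigma_{\zeta_2}^{(0)})$ follows the self-consistent iteration for the steps $t<N$ if and only if, for all $t<N$, the two right-hand sides for $\Sigma_{\zeta_1}^{-1\,(t+1)}$ and $\Sigma_{\zeta_2}^{-1\,(t+1)}$ are positive definite and the $(t+1)$-st pair is (for almost every $x$) the Gaussian representation with parameters $(A^{(t+1)},\Sigma_{\zeta_1}^{(t+1)},B^{(t+1)},\Sigma_{\zeta_2}^{(t+1)})$. 3. If a Gaussian representation minimizes $\mathcal F$ among all Gaussian representations (of the same dimensions), then it solves the self-consistent equations (it is its own successor in the iteration), the two right-hand sides for the precision matrices are positive definite, and its parameters are a fixed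 point of the matrix iteration. -/

import Mathlib

open MeasureTheory ProbabilityTheory InformationTheory Matrix Filter
open scoped ENNReal

noncomputable section

namespace DPFL

/-- Real coordinate space with its Euclidean structure. -/
abbrev E (n : ℕ) : Type := EuclideanSpace ℝ (Fin n)

/-- The action of a matrix on a vector of coordinate space. -/
def act {k n : ℕ} (M : Matrix (Fin k) (Fin n) ℝ) (x : E n) : E k :=
  WithLp.toLp 2 (M *ᵥ WithLp.ofLp x)

/-! ### Information measures, for a source `(X, Y)` and two channels `p(T₁|X)`, `p(T₂|X)` -/

section General

variable {Ω α β : Type*} [MeasurableSpace Ω] [MeasurableSpace α] [MeasurableSpace β]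

/-- Mutual information `I(U; V)` (in nats) of two random variables under `μ`: the Kullback-Leibler
divergence of the joint law from the product of the marginal laws. -/
def mutualInfo (U : Ω → α) (V : Ω → β) (μ : Measure Ω) : ℝ≥0∞ :=
  klDiv (μ.map fun ω => (U ω, V ω)) ((μ.map U).prod (μ.map V))

variable {𝒳 𝒴 𝒯₁ 𝒯₂ : Type*} [MeasurableSpace 𝒳] [MeasurableSpace 𝒴]
  [MeasurableSpace 𝒯₁] [MeasurableSpace 𝒯₂]

/-- The joint law of `((X, Y), (T₁, T₂))`, when `(X, Y)` has law `ν`, `p(T₁|X) = κ₁`,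
`p(T₂|X) = κ₂`, and `T₁`, `T₂`, `Y` are conditionally independent given `X`. -/
def jointLaw (ν : Measure (𝒳 × 𝒴)) (κ₁ : Kernel 𝒳 𝒯₁) (κ₂ : Kernel 𝒳 𝒯₂) :
    Measure ((𝒳 × 𝒴) × (𝒯₁ × 𝒯₂)) :=
  ν ⊗ₘ ((κ₁ ×ₖ κ₂).comap Prod.fst measurable_fst)

/-- The coordinate random variable `X`. -/
def rvX (w : (𝒳 × 𝒴) × (𝒯₁ × 𝒯₂)) : 𝒳 := w.1.1
/-- The coordinate random variable `Y`. -/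
def rvY (w : (𝒳 × 𝒴) × (𝒯₁ × 𝒯₂)) : 𝒴 := w.1.2
/-- The coordinate random variable `T₁`. -/
def rvT₁ (w : (𝒳 × 𝒴) × (𝒯₁ × 𝒯₂)) : 𝒯₁ := w.2.1
/-- The coordinate random variable `T₂`. -/
def rvT₂ (w : (𝒳 × 𝒴) × (𝒯₁ × 𝒯₂)) : 𝒯₂ := w.2.2
/-- The pair `(T₁, T₂)`. -/
def rvT (w : (𝒳 × 𝒴) × (𝒯₁ × 𝒯₂)) : 𝒯₁ × 𝒯₂ := w.2

/-- The Lagrangian functional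
`-I(Y; T₁, T₂) + β I(T₁; X) + lam I(T₂; X) + γ I(T₁; T₂)`. It is meant for channels for which the
four informations are finite. -/
def lagrangian (ν : Measure (𝒳 × 𝒴)) (β lam γ : ℝ) (κ₁ : Kernel 𝒳 𝒯₁) (κ₂ : Kernel 𝒳 𝒯₂) : ℝ :=
  - (mutualInfo rvY rvT (jointLaw ν κ₁ κ₂)).toReal
    + β * (mutualInfo rvT₁ rvX (jointLaw ν κ₁ κ₂)).toReal
    + lam * (mutualInfo rvT₂ rvX (jointLaw ν κ₁ κ₂)).toReal
    + γ * (mutualInfo rvT₁ rvT₂ (jointLaw ν κ₁ κ₂)).toReal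

variable [StandardBorelSpace 𝒴] [Nonempty 𝒴] [StandardBorelSpace 𝒯₁] [Nonempty 𝒯₁]
  [StandardBorelSpace 𝒯₂] [Nonempty 𝒯₂]

/-- The exponent
`(γ/β) D(p(T₂|X=x) ‖ p(T₂|T₁=t₁)) - (1/β) E_{T₂|X=x} D(p(Y|X=x) ‖ p(Y|T₁=t₁,T₂))`,
where the conditional laws `p(T₂|T₁)`, `p(Y|X)`, `p(Y|T₁,T₂)` are those of `μ`, and
`p(T₂|X=x)` is `κ₂ x`. -/
def exponent₁ (β γ : ℝ) (μ : Measure ((𝒳 × 𝒴) × (𝒯₁ × 𝒯₂))) [IsFiniteMeasure μ]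
    (κ₂ : Kernel 𝒳 𝒯₂) (x : 𝒳) (t₁ : 𝒯₁) : ℝ :=
  γ / β * (klDiv (κ₂ x) (condDistrib rvT₂ rvT₁ μ t₁)).toReal
    - 1 / β * ∫ t₂, (klDiv (condDistrib rvY rvX μ x) (condDistrib rvY rvT μ (t₁, t₂))).toReal ∂κ₂ x

/-- The exponent
`(γ/lam) D(p(T₁|X=x) ‖ p(T₁|T₂=t₂)) - (1/lam) E_{T₁|X=x} D(p(Y|X=x) ‖ p(Y|T₁,T₂=t₂))`,
where the conditional laws `p(T₁|T₂)`, `p(Y|X)`, `p(Y|T₁,T₂)` are those of `μ`, and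
`p(T₁|X=x)` is `κ₁ x`. -/
def exponent₂ (lam γ : ℝ) (μ : Measure ((𝒳 × 𝒴) × (𝒯₁ × 𝒯₂))) [IsFiniteMeasure μ]
    (κ₁ : Kernel 𝒳 𝒯₁) (x : 𝒳) (t₂ : 𝒯₂) : ℝ :=
  γ / lam * (klDiv (κ₁ x) (condDistrib rvT₁ rvT₂ μ t₂)).toReal
    - 1 / lam * ∫ t₁, (klDiv (condDistrib rvY rvX μ x) (condDistrib rvY rvT μ (t₁, t₂))).toReal ∂κ₁ x

instance (ν : Measure (𝒳 × 𝒴)) [IsProbabilityMeasure ν] (κ₁ : Kernel 𝒳 𝒯₁) (κ₂ : Kernel 𝒳 𝒯₂)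
    [IsMarkovKernel κ₁] [IsMarkovKernel κ₂] : IsProbabilityMeasure (jointLaw ν κ₁ κ₂) := by
  unfold jointLaw; infer_instance

/-- One step of the alternating self-consistent equations: `(κ₁', κ₂')` is the successor of
`(κ₁, κ₂)` if, for almost every `x`,
`p'(t₁|x) = p(t₁) exp(exponent₁) / Z₁(x)`, computed from `κ₁`, `κ₂`, and
`p'(t₂|x) = p(t₂) exp(exponent₂) / Z₂(x)`, computed from `κ₁`, `κ₂` for `p(T₂)`, `p(T₁|T₂)` and
`p(Y|T₁,T₂)`, but from the new `κ₁'` for `p(T₁|X)`. (`Measure.tilted` is the normalized exponential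
tilting; it is the zero measure, hence no `κ' x`, when the partition function is infinite.) -/
def IsSuccessor (ν : Measure (𝒳 × 𝒴)) [IsProbabilityMeasure ν] (β lam γ : ℝ)
    (κ₁ : Kernel 𝒳 𝒯₁) [IsMarkovKernel κ₁] (κ₂ : Kernel 𝒳 𝒯₂) [IsMarkovKernel κ₂]
    (κ₁' : Kernel 𝒳 𝒯₁) [IsMarkovKernel κ₁'] (κ₂' : Kernel 𝒳 𝒯₂) [IsMarkovKernel κ₂'] : Prop :=
  (∀ᵐ x ∂(ν.map Prod.fst), κ₁' x =
    ((jointLaw ν κ₁ κ₂).map rvT₁).tilted (exponent₁ β γ (jointLaw ν κ₁ κ₂) κ₂ x)) ∧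
  (∀ᵐ x ∂(ν.map Prod.fst), κ₂' x =
    ((jointLaw ν κ₁ κ₂).map rvT₂).tilted (exponent₂ lam γ (jointLaw ν κ₁ κ₂) κ₁' x))

/-- The self-consistent equations: `(κ₁, κ₂)` is its own successor. -/
def SelfConsistent (ν : Measure (𝒳 × 𝒴)) [IsProbabilityMeasure ν] (β lam γ : ℝ)
    (κ₁ : Kernel 𝒳 𝒯₁) [IsMarkovKernel κ₁] (κ₂ : Kernel 𝒳 𝒯₂) [IsMarkovKernel κ₂] : Prop :=
  IsSuccessor ν β lam γ κ₁ κ₂ κ₁ κ₂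

end General

/-! ### Gaussian source and Gaussian representations -/

/-- The law of `M x + ζ`, `ζ ∼ N(0, S)`, as a channel with input `x`. -/
def gaussianChannel {n k : ℕ} (M : Matrix (Fin k) (Fin n) ℝ) (S : Matrix (Fin k) (Fin k) ℝ) :
    Kernel (E n) (E k) :=
  (Kernel.id ×ₖ Kernel.const (E n) (multivariateGaussian (0 : E k) S)).map
    fun z => act M z.1 + z.2

theorem measurable_gaussianChannel_aux {n k : ℕ} (M : Matrix (Fin k) (Fin n) ℝ) :
    Measurable fun z : E n × E k => act M z.1 + z.2 := by
  apply Continuous.measurable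
  unfold act
  fun_prop

instance {n k : ℕ} (M : Matrix (Fin k) (Fin n) ℝ) (S : Matrix (Fin k) (Fin k) ℝ) :
    IsMarkovKernel (gaussianChannel M S) := by
  unfold gaussianChannel
  exact Kernel.IsMarkovKernel.map _ (measurable_gaussianChannel_aux M)

/-- The cross-covariance matrix of two random vectors. -/
def crossCov {Ω : Type*} [MeasurableSpace Ω] {a b : ℕ} (U : Ω → E a) (V : Ω → E b)
    (P : Measure Ω) : Matrix (Fin a) (Fin b) ℝ :=
  Matrix.of fun i j => cov[fun ω => U ω i, fun ω => V ω j; P]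

/-- Covariance data `Σ_X`, `Σ_YX`, `Σ_Y` of a source `(X, Y)`. -/
structure SourceCov (n m : ℕ) where
  SX : Matrix (Fin n) (Fin n) ℝ
  SYX : Matrix (Fin m) (Fin n) ℝ
  SY : Matrix (Fin m) (Fin m) ℝ

namespace SourceCov

variable {n m : ℕ} (C : SourceCov n m)

/-- `Θ = Σ_YX Σ_X⁻¹`. -/
def Θ : Matrix (Fin m) (Fin n) ℝ := C.SYX * C.SX⁻¹

/-- `Σ_{Y|X} = Σ_Y - Σ_YX Σ_X⁻¹ Σ_XY`. -/
def SYgX : Matrix (Fin m) (Fin m) ℝ := C.SY - C.SYX * C.SX⁻¹ * C.SYXᵀ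

end SourceCov

/-- The covariance data of a pair of random vectors. -/
def sourceCov {Ω : Type*} [MeasurableSpace Ω] {n m : ℕ} (P : Measure Ω)
    (X : Ω → E n) (Y : Ω → E m) : SourceCov n m :=
  ⟨crossCov X X P, crossCov Y X P, crossCov Y Y P⟩

/-- Parameters of a pair of representations `T₁ = A X + ζ₁`, `T₂ = B X + ζ₂`, with noise covariances
`S₁`, `S₂`. -/
structure Params (n k₁ k₂ : ℕ) where
  A : Matrix (Fin k₁) (Fin n) ℝ
  S₁ : Matrix (Fin k₁) (Fin k₁) ℝ
  B : Matrix (Fin k₂) (Fin n) ℝ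
  S₂ : Matrix (Fin k₂) (Fin k₂) ℝ

namespace Params

variable {n m k₁ k₂ : ℕ} (C : SourceCov n m) (p : Params n k₁ k₂) (β lam γ : ℝ)

/-- Both noise covariances are positive definite. -/
def Nondegenerate : Prop := p.S₁.PosDef ∧ p.S₂.PosDef

/-- `p(T₁|X)` for `T₁ = A X + ζ₁`. -/
def channel₁ : Kernel (E n) (E k₁) := gaussianChannel p.A p.S₁
/-- `p(T₂|X)` for `T₂ = B X + ζ₂`. -/
def channel₂ : Kernel (E n) (E k₂) := gaussianChannel p.B p.S₂

instance : IsMarkovKernel p.channel₁ := by unfold channel₁; infer_instance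
instance : IsMarkovKernel p.channel₂ := by unfold channel₂; infer_instance

/-- `Σ_{T₁}`. -/
def ST₁ : Matrix (Fin k₁) (Fin k₁) ℝ := p.A * C.SX * p.Aᵀ + p.S₁
/-- `Σ_{T₂}`. -/
def ST₂ : Matrix (Fin k₂) (Fin k₂) ℝ := p.B * C.SX * p.Bᵀ + p.S₂

/-- `Σ_{X|T₁}`. -/
def SXgT₁ : Matrix (Fin n) (Fin n) ℝ :=
  C.SX - C.SX * p.Aᵀ * (p.A * C.SX * p.Aᵀ + p.S₁)⁻¹ * p.A * C.SX
/-- `Σ_{X|T₂}`. -/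
def SXgT₂ : Matrix (Fin n) (Fin n) ℝ :=
  C.SX - C.SX * p.Bᵀ * (p.B * C.SX * p.Bᵀ + p.S₂)⁻¹ * p.B * C.SX

/-- `Σ_{T₂|T₁}`. -/
def ST₂gT₁ : Matrix (Fin k₂) (Fin k₂) ℝ := p.B * p.SXgT₁ C * p.Bᵀ + p.S₂
/-- `Σ_{T₁|T₂}`. -/
def ST₁gT₂ : Matrix (Fin k₁) (Fin k₁) ℝ := p.A * p.SXgT₂ C * p.Aᵀ + p.S₁

/-- `Ξ₁ = B Σ_X Aᵀ Σ_{T₁}⁻¹`. -/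
def Ξ₁ : Matrix (Fin k₂) (Fin k₁) ℝ := p.B * C.SX * p.Aᵀ * (p.ST₁ C)⁻¹
/-- `Ξ₂ = A Σ_X Bᵀ Σ_{T₂}⁻¹`. -/
def Ξ₂ : Matrix (Fin k₁) (Fin k₂) ℝ := p.A * C.SX * p.Bᵀ * (p.ST₂ C)⁻¹

/-- `Ψ₁ = Θ (Σ_X Aᵀ Σ_{T₁|T₂}⁻¹ - Σ_X Bᵀ Σ_{T₂|T₁}⁻¹ B Σ_X Aᵀ Σ_{T₁}⁻¹)`. -/
def Ψ₁ : Matrix (Fin m) (Fin k₁) ℝ :=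
  C.Θ * (C.SX * p.Aᵀ * (p.ST₁gT₂ C)⁻¹
    - C.SX * p.Bᵀ * (p.ST₂gT₁ C)⁻¹ * p.B * C.SX * p.Aᵀ * (p.ST₁ C)⁻¹)
/-- `Ψ₂ = Θ (Σ_X Bᵀ Σ_{T₂|T₁}⁻¹ - Σ_X Aᵀ Σ_{T₁|T₂}⁻¹ A Σ_X Bᵀ Σ_{T₂}⁻¹)`. -/
def Ψ₂ : Matrix (Fin m) (Fin k₂) ℝ :=
  C.Θ * (C.SX * p.Bᵀ * (p.ST₂gT₁ C)⁻¹
    - C.SX * p.Aᵀ * (p.ST₁gT₂ C)⁻¹ * p.A * C.SX * p.Bᵀ * (p.ST₂ C)⁻¹)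

/-- `Σ_{X|T₁,T₂}`. -/
def SXgT : Matrix (Fin n) (Fin n) ℝ :=
  C.SX - C.SX * p.Aᵀ * (p.ST₁gT₂ C)⁻¹ * p.A * C.SX
    + C.SX * p.Aᵀ * (p.ST₁gT₂ C)⁻¹ * p.A * C.SX * p.Bᵀ * (p.ST₂ C)⁻¹ * p.B * C.SX
    + C.SX * p.Bᵀ * (p.ST₂gT₁ C)⁻¹ * p.B * C.SX * p.Aᵀ * (p.ST₁ C)⁻¹ * p.A * C.SX
    - C.SX * p.Bᵀ * (p.ST₂gT₁ C)⁻¹ * p.B * C.SX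

/-- `Σ_{Y|T₁,T₂} = Θ Σ_{X|T₁,T₂} Θᵀ + Σ_{Y|X}`. -/
def SYgT : Matrix (Fin m) (Fin m) ℝ := C.Θ * p.SXgT C * C.Θᵀ + C.SYgX

/-- The new precision (inverse covariance) matrix of `ζ₁`. -/
def newPrec₁ : Matrix (Fin k₁) (Fin k₁) ℝ :=
  (p.ST₁ C)⁻¹ - (γ / β) • ((p.Ξ₁ C)ᵀ * (p.ST₂gT₁ C)⁻¹ * p.Ξ₁ C)
    + (1 / β) • ((p.Ψ₁ C)ᵀ * (p.SYgT C)⁻¹ * p.Ψ₁ C)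

/-- The new coupling matrix `A`. -/
def newA : Matrix (Fin k₁) (Fin n) ℝ :=
  (p.newPrec₁ C β γ)⁻¹ * (-((γ / β) • ((p.Ξ₁ C)ᵀ * (p.ST₂gT₁ C)⁻¹ * p.B))
    + (1 / β) • ((p.Ψ₁ C)ᵀ * (p.SYgT C)⁻¹ * (C.Θ - p.Ψ₂ C * p.B)))

/-- The new precision (inverse covariance) matrix of `ζ₂`. -/
def newPrec₂ : Matrix (Fin k₂) (Fin k₂) ℝ :=
  (p.ST₂ C)⁻¹ - (γ / lam) • ((p.Ξ₂ C)ᵀ * (p.ST₁gT₂ C)⁻¹ * p.Ξ₂ C)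
    + (1 / lam) • ((p.Ψ₂ C)ᵀ * (p.SYgT C)⁻¹ * p.Ψ₂ C)

/-- The new coupling matrix `B`; it uses the new `A`. -/
def newB : Matrix (Fin k₂) (Fin n) ℝ :=
  (p.newPrec₂ C lam γ)⁻¹ * (-((γ / lam) • ((p.Ξ₂ C)ᵀ * (p.ST₁gT₂ C)⁻¹ * p.newA C β γ))
    + (1 / lam) • ((p.Ψ₂ C)ᵀ * (p.SYgT C)⁻¹ * (C.Θ - p.Ψ₁ C * p.newA C β γ)))

/-- One step `t → t + 1` of the matrix iteration. -/
def next : Params n k₁ k₂ where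
  A := p.newA C β γ
  S₁ := (p.newPrec₁ C β γ)⁻¹
  B := p.newB C β lam γ
  S₂ := (p.newPrec₂ C lam γ)⁻¹

/-- The step is feasible: the two new precision matrices are positive definite, hence are the
inverses of covariance matrices of nondegenerate noises. -/
def Feasible : Prop := (p.newPrec₁ C β γ).PosDef ∧ (p.newPrec₂ C lam γ).PosDef

/-- The `t`-th iterate of the matrix iteration started at `p`. -/
def iterate (t : ℕ) : Params n k₁ k₂ := (fun q => q.next C β lam γ)^[t] p

end Params

end DPFL

end

open DPFL

/-! The laws. A Gaussian source with additive Gaussian noise makes `((X, Y), (T₁, T₂))` jointly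
Gaussian, being a linear image of independent Gaussian vectors (`isGaussianModel_jointLaw`). In a
centered Gaussian law, a residual `U - M V` uncorrelated with `V` is independent of `V`
(`regression_clm`, `regression_prod_clm`). The law of `U` given `V = v` is then Gaussian with mean
`M v` and the covariance of the residual. The matrices `Ξᵢ` and `Ψᵢ` solve the corresponding normal
equations (`Ξ₁_mul_ST₁`, `Ψ₁_normal`, `Ψ₂_normal`). All four informations are halves of differences
of log-determinants (`mutualInfo_eq_log_det`).

The iteration. The divergence between Gaussians is quadratic in the difference of means, so the
exponents are quadratic polynomials in `t` (`gaussian_exponent_eq`). Tilting `N(0, S)` by a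
polynomial with quadratic part `-½ tᵀ Q t` gives a Gaussian of precision `S⁻¹ + Q` if this matrix is
positive definite. Otherwise the partition function diverges (`not_integrable_exp_of_not_posDef`)
and there is no successor. This yields the one-step equivalence `isSuccessor_iff`; the update of
`T₂` is the update of `T₁` for the exchanged pair (`Params.swap`). Induction on the number of steps
gives the statement on sequences.

Minimizers. Only the coupling matrix is varied, `A + ε D` with the noise covariance held fixed.
Instead of differentiating, the increment of the objective is bounded above by `ε φ(ε)` with `φ`
continuous. The bound uses the tangent inequality for the concave function `log det` (`log_det_le`)
and the optimality of the regression coefficients. Minimality forces `φ(0) = 0` for every `D`, which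
says `newPrec₁ * A = linCoef₁` (`newPrec₁_mul_A`). No variation of the noise is needed: the normal
equations give the identity `newPrec₁ * Σ_{T₁} = 1 + linCoef₁ * Σ_X * Aᵀ` at every representation.
Combined with the stationarity in `A`, it leaves `newPrec₁ * Σ_{ζ₁} = 1` (`newPrec₁_eq_inv`). So the
new precision is the old one, in particular positive definite, and the parameters are a fixed point;
`isSuccessor_iff` turns this into self-consistency. -/

noncomputable section

namespace DPFL

/-! ### The action of matrices on coordinate space -/

section Act

variable {a b c : ℕ}

theorem act_apply (M : Matrix (Fin a) (Fin b) ℝ) (x : E b) (i : Fin a) :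
    act M x i = ∑ j, M i j * x j := rfl

theorem act_add_vec (M : Matrix (Fin a) (Fin b) ℝ) (x y : E b) :
    act M (x + y) = act M x + act M y := by
  ext i; simp [act, Matrix.mulVec_add]

theorem act_sub_vec (M : Matrix (Fin a) (Fin b) ℝ) (x y : E b) :
    act M (x - y) = act M x - act M y := by
  ext i; simp [act, Matrix.mulVec_sub]

theorem act_smul_vec (M : Matrix (Fin a) (Fin b) ℝ) (r : ℝ) (x : E b) :
    act M (r • x) = r • act M x := by
  ext i; simp [act, Matrix.mulVec_smul]

theorem act_zero_vec (M : Matrix (Fin a) (Fin b) ℝ) : act M 0 = 0 := by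
  ext i; simp [act]

theorem act_add (M N : Matrix (Fin a) (Fin b) ℝ) (x : E b) :
    act (M + N) x = act M x + act N x := by
  ext i; simp [act, Matrix.add_mulVec]

theorem act_sub (M N : Matrix (Fin a) (Fin b) ℝ) (x : E b) :
    act (M - N) x = act M x - act N x := by
  ext i; simp [act, Matrix.sub_mulVec]

theorem act_neg (M : Matrix (Fin a) (Fin b) ℝ) (x : E b) : act (-M) x = -act M x := by
  ext i; simp [act, Matrix.neg_mulVec]

theorem act_smul (r : ℝ) (M : Matrix (Fin a) (Fin b) ℝ) (x : E b) :
    act (r • M) x = r • act M x := by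
  ext i; simp [act, Matrix.smul_mulVec]

theorem act_mul (M : Matrix (Fin a) (Fin b) ℝ) (N : Matrix (Fin b) (Fin c) ℝ) (x : E c) :
    act (M * N) x = act M (act N x) := by
  ext i; simp [act]

theorem act_one (x : E a) : act (1 : Matrix (Fin a) (Fin a) ℝ) x = x := by
  ext i; simp [act]

theorem act_zero (x : E b) : act (0 : Matrix (Fin a) (Fin b) ℝ) x = 0 := by
  ext i; simp [act]

/-- The action of a matrix as a continuous linear map. -/
def actL (M : Matrix (Fin a) (Fin b) ℝ) : E b →L[ℝ] E a :=
  LinearMap.toContinuousLinearMap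
    { toFun := act M, map_add' := act_add_vec M, map_smul' := act_smul_vec M }

@[fun_prop] theorem continuous_act (M : Matrix (Fin a) (Fin b) ℝ) : Continuous (act M) :=
  (actL M).continuous

@[fun_prop] theorem measurable_act (M : Matrix (Fin a) (Fin b) ℝ) : Measurable (act M) :=
  (continuous_act M).measurable

theorem inner_eq_sum (x y : E a) : inner ℝ x y = ∑ i, x i * y i := by
  simp [PiLp.inner_apply, mul_comm]

theorem inner_act (M : Matrix (Fin a) (Fin b) ℝ) (x : E a) (y : E b) :
    inner ℝ x (act M y) = inner ℝ (act Mᵀ x) y := by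
  simp only [inner_eq_sum, act_apply, Finset.mul_sum, Finset.sum_mul, transpose_apply]
  rw [Finset.sum_comm]
  refine Finset.sum_congr rfl fun i _ => Finset.sum_congr rfl fun j _ => ?_
  ring

theorem inner_act_eq_sum (M : Matrix (Fin a) (Fin b) ℝ) (x : E a) (y : E b) :
    inner ℝ x (act M y) = ∑ i, ∑ j, M i j * (x i * y j) := by
  simp only [inner_eq_sum, act_apply, Finset.mul_sum]
  refine Finset.sum_congr rfl fun i _ => Finset.sum_congr rfl fun j _ => ?_
  ring

theorem inner_act_eq_dotProduct (M : Matrix (Fin a) (Fin b) ℝ) (x : E a) (y : E b) :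
    inner ℝ x (act M y) = WithLp.ofLp x ⬝ᵥ M *ᵥ WithLp.ofLp y := by
  simp [inner_eq_sum, act, dotProduct]

theorem posDef_iff_inner_act {M : Matrix (Fin a) (Fin a) ℝ} :
    M.PosDef ↔ M.IsHermitian ∧ ∀ x : E a, x ≠ 0 → 0 < inner ℝ x (act M x) := by
  rw [Matrix.posDef_iff_dotProduct_mulVec]
  refine and_congr_right fun _ => ⟨fun h x hx => ?_, fun h x hx => ?_⟩
  · rw [inner_act_eq_dotProduct]
    exact h (fun h0 => hx (by ext i; simp [h0]))
  · have := h (WithLp.toLp 2 x) (fun h0 => hx (by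
      have := congrArg WithLp.ofLp h0; simpa using this))
    rwa [inner_act_eq_dotProduct] at this

theorem transpose_eq_of_isHermitian {M : Matrix (Fin a) (Fin a) ℝ} (h : M.IsHermitian) :
    Mᵀ = M := by
  rw [← Matrix.conjTranspose_eq_transpose_of_trivial]; exact h

theorem isHermitian_of_transpose_eq {M : Matrix (Fin a) (Fin a) ℝ} (h : Mᵀ = M) :
    M.IsHermitian := by
  rw [Matrix.IsHermitian, Matrix.conjTranspose_eq_transpose_of_trivial]; exact h

theorem _root_.Matrix.PosDef.transpose_eq {M : Matrix (Fin a) (Fin a) ℝ} (h : M.PosDef) : Mᵀ = M :=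
  transpose_eq_of_isHermitian h.1

theorem _root_.Matrix.PosDef.mul_inv {M : Matrix (Fin a) (Fin a) ℝ} (h : M.PosDef) : M * M⁻¹ = 1 :=
  Matrix.mul_nonsing_inv _ ((Matrix.isUnit_iff_isUnit_det _).1 h.isUnit)

theorem _root_.Matrix.PosDef.inv_mul {M : Matrix (Fin a) (Fin a) ℝ} (h : M.PosDef) : M⁻¹ * M = 1 :=
  Matrix.nonsing_inv_mul _ ((Matrix.isUnit_iff_isUnit_det _).1 h.isUnit)

theorem _root_.Matrix.PosDef.inv_transpose {M : Matrix (Fin a) (Fin a) ℝ} (h : M.PosDef) :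
    M⁻¹ᵀ = M⁻¹ :=
  h.inv.transpose_eq

end Act

/-! ### Densities of Gaussian measures -/

section Density

variable {k : ℕ}

theorem integrable_exp_neg_half_sq_norm (k : ℕ) :
    Integrable (fun x : E k => Real.exp (-(1 / 2) * ‖x‖ ^ 2)) := by
  have := (GaussianFourier.integrable_cexp_neg_mul_sq_norm_add (V := E k) (b := 1 / 2)
    (by norm_num) 0 0).re
  refine this.congr (ae_of_all _ fun x => ?_)
  simp only [zero_mul, add_zero]
  rw [show (-(1 / 2 : ℂ) * (‖x‖ : ℂ) ^ 2) = ((-(1 / 2) * ‖x‖ ^ 2 : ℝ) : ℂ) by push_cast; ring,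
    ← Complex.ofReal_exp]
  exact Complex.ofReal_re _

/-- The characteristic functions agree by the Fourier transform of a Gaussian. The normalizing
constant occurs in numerator and denominator, so its value is never needed. -/
theorem stdGaussian_eq_tilted (k : ℕ) :
    stdGaussian (E k) = (volume : Measure (E k)).tilted fun x => -(1 / 2) * ‖x‖ ^ 2 := by
  have hi := integrable_exp_neg_half_sq_norm k
  have := isProbabilityMeasure_tilted (μ := (volume : Measure (E k))) hi
  apply Measure.ext_of_charFun
  ext t
  rw [charFun_stdGaussian, charFun_apply, integral_tilted]
  have hZ : (∫ x : E k, Real.exp (-(1 / 2) * ‖x‖ ^ 2)) ≠ 0 := (integral_exp_pos hi).ne'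
  have h1 := GaussianFourier.integral_cexp_neg_mul_sq_norm_add (V := E k) (b := 1 / 2)
    (by norm_num) Complex.I t
  have h0 := GaussianFourier.integral_cexp_neg_mul_sq_norm (V := E k) (b := 1 / 2) (by norm_num)
  have hZc : ((∫ x : E k, Real.exp (-(1 / 2) * ‖x‖ ^ 2) : ℝ) : ℂ)
      = ∫ v : E k, Complex.exp (-(1 / 2) * (‖v‖ : ℂ) ^ 2) := by
    rw [← integral_complex_ofReal]
    refine integral_congr_ae (ae_of_all _ fun x => ?_)
    push_cast; rfl
  have hZc' : ((∫ x : E k, Real.exp (-(1 / 2) * ‖x‖ ^ 2) : ℝ) : ℂ) ≠ 0 := by exact_mod_cast hZ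
  have : ∀ x : E k, (Real.exp (-(1 / 2) * ‖x‖ ^ 2) / ∫ x : E k, Real.exp (-(1 / 2) * ‖x‖ ^ 2)) •
      Complex.exp ((inner ℝ x t : ℝ) * Complex.I) =
      ((∫ x : E k, Real.exp (-(1 / 2) * ‖x‖ ^ 2) : ℝ) : ℂ)⁻¹ *
        Complex.exp (-(1 / 2) * (‖x‖ : ℂ) ^ 2 + Complex.I * (inner ℝ t x : ℝ)) := by
    intro x
    rw [Complex.exp_add, Complex.real_smul, real_inner_comm]
    push_cast
    rw [mul_comm Complex.I]
    ring
  simp_rw [this]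
  rw [integral_const_mul, h1, ← h0, ← hZc, inv_mul_cancel_left₀ hZc']
  congr 1
  rw [Complex.I_sq]; ring

/-- Lebesgue measure, normalized so that `exp (-‖x‖²/2)` is the density of the standard Gaussian
measure. -/
def gaussRef (k : ℕ) : Measure (E k) :=
  ENNReal.ofReal (∫ x : E k, Real.exp (-(1 / 2) * ‖x‖ ^ 2))⁻¹ • volume

theorem gaussRef_ac : gaussRef k ≪ volume := Measure.smul_absolutelyContinuous

theorem ac_gaussRef : (volume : Measure (E k)) ≪ gaussRef k := by
  refine Measure.absolutelyContinuous_smul ?_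
  have := integral_exp_pos (integrable_exp_neg_half_sq_norm k)
  simpa using this

theorem stdGaussian_eq_withDensity (k : ℕ) :
    stdGaussian (E k) = (gaussRef k).withDensity
      fun x => ENNReal.ofReal (Real.exp (-(1 / 2) * ‖x‖ ^ 2)) := by
  rw [stdGaussian_eq_tilted, Measure.tilted, gaussRef, withDensity_smul_measure,
    ← withDensity_smul _ (by fun_prop)]
  congr 1
  ext x
  have := integral_exp_pos (integrable_exp_neg_half_sq_norm k)
  rw [Pi.smul_apply, smul_eq_mul, ← ENNReal.ofReal_mul (by positivity)]
  congr 1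
  ring

/-- The logarithm of the density of `N(0, S)` with respect to `gaussRef`. -/
def logDensity (S : Matrix (Fin k) (Fin k) ℝ) (x : E k) : ℝ :=
  -(1 / 2) * inner ℝ x (act S⁻¹ x) - 1 / 2 * Real.log S.det

@[fun_prop] theorem continuous_logDensity (S : Matrix (Fin k) (Fin k) ℝ) :
    Continuous (logDensity S) := by
  unfold logDensity; fun_prop

@[fun_prop] theorem measurable_logDensity (S : Matrix (Fin k) (Fin k) ℝ) :
    Measurable (logDensity S) := (continuous_logDensity S).measurable

-- Change of variables along `x ↦ m + √S x`, which carries the standard Gaussian to `N(m, S)`. The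
-- Jacobian `|det √S| = exp(½ log det S)` produces the log-determinant in `logDensity`.
open scoped MatrixOrder in
theorem multivariateGaussian_eq_withDensity (m : E k) {S : Matrix (Fin k) (Fin k) ℝ}
    (hS : S.PosDef) :
    multivariateGaussian m S = (gaussRef k).withDensity
      fun x => ENNReal.ofReal (Real.exp (logDensity S (x - m))) := by
  set L := CFC.sqrt S with hL
  have hLL : L * L = S := CFC.sqrt_mul_sqrt_self S hS.posSemidef.nonneg
  have hLT : Lᵀ = L := transpose_eq_of_isHermitian (CFC.sqrt_nonneg S).posSemidef.1
  have hdet : L.det * L.det = S.det := by rw [← Matrix.det_mul, hLL]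
  have hL0 : L.det ≠ 0 := fun h => hS.det_pos.ne' (by rw [← hdet, h, zero_mul])
  have hLu : IsUnit L.det := isUnit_iff_ne_zero.2 hL0
  have hLi : L * L⁻¹ = 1 := Matrix.mul_nonsing_inv _ hLu
  have hiL : L⁻¹ * L = 1 := Matrix.nonsing_inv_mul _ hLu
  have hSi : S⁻¹ = L⁻¹ * L⁻¹ := by rw [← hLL, Matrix.mul_inv_rev]
  have hact : ∀ x, toEuclideanCLM (𝕜 := ℝ) L x = act L x := fun x => rfl
  have hmap : (gaussRef k).map (fun x => m + act L x)
      = ENNReal.ofReal |L.det|⁻¹ • gaussRef k := by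
    have : (fun x => m + act L x) = (fun x => m + x) ∘ act L := rfl
    rw [this, ← Measure.map_map (by fun_prop) (by fun_prop), gaussRef, Measure.map_smul,
      Measure.map_smul]
    have hd : LinearMap.det (actL L : E k →ₗ[ℝ] E k) = L.det := by
      rw [← LinearMap.det_toLin (EuclideanSpace.basisFun (Fin k) ℝ).toBasis L]
      congr 1
    have h1 := Measure.map_linearMap_addHaar_eq_smul_addHaar (volume : Measure (E k))
      (f := (actL L : E k →ₗ[ℝ] E k)) (by rw [hd]; exact hL0)
    rw [hd] at h1
    have h2 : (volume : Measure (E k)).map (act L) = ENNReal.ofReal |L.det⁻¹| • volume := h1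
    rw [h2, Measure.map_smul, map_add_left_eq_self, abs_inv, smul_comm]
  let e : E k ≃ᵐ E k :=
    { toFun := fun x => m + act L x
      invFun := fun x => act L⁻¹ (x - m)
      left_inv := fun x => by simp [← act_mul, hiL, act_one]
      right_inv := fun x => by simp [← act_mul, hLi, act_one]
      measurable_toFun := by change Measurable fun x => m + act L x; fun_prop
      measurable_invFun := by change Measurable fun x => act L⁻¹ (x - m); fun_prop }
  ext s hs
  have hm : Measurable fun x => m + act L x := e.measurable
  rw [multivariateGaussian, Measure.map_apply (by fun_prop) hs, withDensity_apply _ hs,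
    stdGaussian_eq_withDensity, withDensity_apply _ (by exact hm hs)]
  have h3 : gaussRef k = ENNReal.ofReal |L.det| • (gaussRef k).map (fun x => m + act L x) := by
    rw [hmap, smul_smul, ← ENNReal.ofReal_mul (abs_nonneg _),
      mul_inv_cancel₀ (abs_ne_zero.2 hL0), ENNReal.ofReal_one, one_smul]
  conv_rhs => rw [h3]
  rw [Measure.restrict_smul, lintegral_smul_measure, setLIntegral_map hs (by fun_prop) hm,
    smul_eq_mul, ← lintegral_const_mul _ (by fun_prop)]
  refine setLIntegral_congr_fun (hm hs) fun x _ => ?_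
  rw [← ENNReal.ofReal_mul (abs_nonneg _)]
  congr 1
  rw [add_sub_cancel_left, logDensity, hSi, act_mul, inner_act, transpose_nonsing_inv, hLT,
    ← act_mul, hiL, act_one, real_inner_self_eq_norm_sq, Real.exp_sub, ← hdet, Real.log_mul hL0 hL0]
  rw [show 1 / 2 * (Real.log L.det + Real.log L.det) = Real.log |L.det| by
    rw [Real.log_abs]; ring, Real.exp_log (abs_pos.2 hL0)]
  field_simp

end Density

/-! ### Kullback-Leibler divergences -/

section KL

variable {k : ℕ}

/-- The log-likelihood ratio is `g` almost everywhere. Both the divergences of Gaussians and the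
mutual informations are computed from this. -/
theorem klDiv_of_eq_withDensity_exp {α : Type*} [MeasurableSpace α] {μ ν : Measure α}
    [IsProbabilityMeasure μ] [IsProbabilityMeasure ν] {g : α → ℝ} (hg : Measurable g)
    (hμ : μ = ν.withDensity fun x => ENNReal.ofReal (Real.exp (g x))) (hi : Integrable g μ) :
    klDiv μ ν ≠ ∞ ∧ (klDiv μ ν).toReal = ∫ x, g x ∂μ := by
  have hac : μ ≪ ν := by rw [hμ]; exact withDensity_absolutelyContinuous _ _
  have hllr : llr μ ν =ᵐ[μ] g := by
    refine hac.ae_le ?_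
    have : μ.rnDeriv ν =ᵐ[ν] fun x => ENNReal.ofReal (Real.exp (g x)) := by
      rw [hμ]; exact Measure.rnDeriv_withDensity ν (by fun_prop)
    filter_upwards [this] with x hx
    rw [llr, hx, ENNReal.toReal_ofReal (Real.exp_pos _).le, Real.log_exp]
  refine ⟨klDiv_ne_top hac (hi.congr hllr.symm), ?_⟩
  rw [toReal_klDiv_of_measure_eq hac (by simp), integral_congr_ae hllr]

theorem volume_ac_multivariateGaussian (m : E k) {S : Matrix (Fin k) (Fin k) ℝ} (hS : S.PosDef) :
    (volume : Measure (E k)) ≪ multivariateGaussian m S := by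
  rw [multivariateGaussian_eq_withDensity m hS]
  exact ac_gaussRef.trans (withDensity_absolutelyContinuous' (by fun_prop)
    (ae_of_all _ fun x => by simp [Real.exp_pos]))

theorem multivariateGaussian_ac_volume (m : E k) {S : Matrix (Fin k) (Fin k) ℝ} (hS : S.PosDef) :
    multivariateGaussian m S ≪ volume := by
  rw [multivariateGaussian_eq_withDensity m hS]
  exact (withDensity_absolutelyContinuous _ _).trans gaussRef_ac

theorem multivariateGaussian_eq_withDensity_multivariateGaussian (m m' : E k)
    {S S' : Matrix (Fin k) (Fin k) ℝ} (hS : S.PosDef) (hS' : S'.PosDef) :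
    multivariateGaussian m S = (multivariateGaussian m' S').withDensity
      fun x => ENNReal.ofReal (Real.exp (logDensity S (x - m) - logDensity S' (x - m'))) := by
  rw [multivariateGaussian_eq_withDensity m hS, multivariateGaussian_eq_withDensity m' hS',
    ← withDensity_mul _ (by fun_prop) (by fun_prop)]
  congr 1
  ext x
  rw [Pi.mul_apply, ← ENNReal.ofReal_mul (Real.exp_pos _).le, ← Real.exp_add]
  congr 2
  ring

theorem integrable_inner_act {Ω : Type*} [MeasurableSpace Ω] {P : Measure Ω} {a b : ℕ}
    (M : Matrix (Fin a) (Fin b) ℝ) {U : Ω → E a} {V : Ω → E b} (hU : MemLp U 2 P)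
    (hV : MemLp V 2 P) : Integrable (fun ω => inner ℝ (U ω) (act M (V ω))) P := by
  simp only [inner_act_eq_sum]
  refine integrable_finsetSum _ fun i _ => integrable_finsetSum _ fun j _ =>
    Integrable.const_mul ?_ _
  exact MemLp.integrable_mul (hU.eval_piLp i) (hV.eval_piLp j)

theorem memLp_id_multivariateGaussian (m : E k) (S : Matrix (Fin k) (Fin k) ℝ) :
    MemLp (fun x : E k => x) 2 (multivariateGaussian m S) :=
  IsGaussian.memLp_two_id

theorem integrable_inner_act_multivariateGaussian (m c : E k) {S : Matrix (Fin k) (Fin k) ℝ}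
    (M : Matrix (Fin k) (Fin k) ℝ) :
    Integrable (fun x => inner ℝ (x - c) (act M (x - c))) (multivariateGaussian m S) :=
  integrable_inner_act M ((memLp_id_multivariateGaussian m S).sub (memLp_const c))
    ((memLp_id_multivariateGaussian m S).sub (memLp_const c))

theorem integral_eval_multivariateGaussian (m : E k) (S : Matrix (Fin k) (Fin k) ℝ) (i : Fin k) :
    ∫ x, x i ∂(multivariateGaussian m S) = m i := by
  have h := ContinuousLinearMap.integral_comp_comm (EuclideanSpace.proj (𝕜 := ℝ) i)
    (φ := fun x : E k => x) (μ := multivariateGaussian m S) IsGaussian.integrable_fun_id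
  rw [integral_id_multivariateGaussian] at h
  exact h

theorem integral_inner_act_multivariateGaussian (m c : E k) {S : Matrix (Fin k) (Fin k) ℝ}
    (hS : S.PosSemidef) (M : Matrix (Fin k) (Fin k) ℝ) :
    ∫ x, inner ℝ (x - c) (act M (x - c)) ∂(multivariateGaussian m S)
      = (M * S).trace + inner ℝ (m - c) (act M (m - c)) := by
  set P := multivariateGaussian m S
  have hL : ∀ i, MemLp (fun x : E k => x i) 2 P := fun i =>
    (memLp_id_multivariateGaussian m S).eval_piLp i
  have hL' : ∀ i, MemLp (fun x : E k => x i - c i) 2 P := fun i => (hL i).sub (memLp_const _)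
  have h1 : ∀ i j, ∫ x : E k, (x i - c i) * (x j - c j) ∂P
      = S i j + (m i - c i) * (m j - c j) := by
    intro i j
    have h := covariance_eq_sub (hL' i) (hL' j)
    rw [covariance_sub_const_left ((hL i).integrable (by norm_num)),
      covariance_sub_const_right ((hL j).integrable (by norm_num)),
      covariance_eval_multivariateGaussian hS,
      integral_sub ((hL i).integrable (by norm_num)) (integrable_const _),
      integral_sub ((hL j).integrable (by norm_num)) (integrable_const _),
      integral_eval_multivariateGaussian, integral_eval_multivariateGaussian] at h
    simp only [integral_const, probReal_univ, one_smul, Pi.mul_apply] at h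
    linarith
  have hI : ∀ i j, Integrable (fun x : E k => M i j * ((x i - c i) * (x j - c j))) P :=
    fun i j => ((hL' i).integrable_mul (hL' j)).const_mul _
  simp only [inner_act_eq_sum, PiLp.sub_apply]
  rw [integral_finsetSum _ fun i _ => integrable_finsetSum _ fun j _ => hI i j]
  simp only [trace, diag_apply, mul_apply, ← Finset.sum_add_distrib]
  refine Finset.sum_congr rfl fun i _ => ?_
  rw [integral_finsetSum _ fun j _ => hI i j]
  refine Finset.sum_congr rfl fun j _ => ?_
  rw [integral_const_mul, h1, ← hS.1.apply i j, star_trivial]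
  ring

theorem integrable_logDensity_sub {m m' c : E k} {S₀ S S' : Matrix (Fin k) (Fin k) ℝ} :
    Integrable (fun x => logDensity S (x - m) - logDensity S' (x - m'))
      (multivariateGaussian c S₀) := by
  unfold logDensity
  exact (((integrable_inner_act_multivariateGaussian c m S⁻¹).const_mul _).sub
    (integrable_const _)).sub
    (((integrable_inner_act_multivariateGaussian c m' S'⁻¹).const_mul _).sub (integrable_const _))

theorem integral_logDensity_sub {m m' c : E k} {S₀ S S' : Matrix (Fin k) (Fin k) ℝ}
    (hS₀ : S₀.PosSemidef) :
    ∫ x, (logDensity S (x - m) - logDensity S' (x - m')) ∂(multivariateGaussian c S₀)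
      = -(1 / 2) * ((S⁻¹ * S₀).trace + inner ℝ (c - m) (act S⁻¹ (c - m))) - 1 / 2 * Real.log S.det
      - (-(1 / 2) * ((S'⁻¹ * S₀).trace + inner ℝ (c - m') (act S'⁻¹ (c - m')))
        - 1 / 2 * Real.log S'.det) := by
  have h := fun (m : E k) (S : Matrix (Fin k) (Fin k) ℝ) =>
    (integrable_inner_act_multivariateGaussian (S := S₀) c m S⁻¹).const_mul (-(1 / 2))
  have h' : ∀ (m : E k) (S : Matrix (Fin k) (Fin k) ℝ),
      Integrable (fun x => logDensity S (x - m)) (multivariateGaussian c S₀) := fun m S =>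
    (h m S).sub (integrable_const _)
  have h'' : ∀ (m : E k) (S : Matrix (Fin k) (Fin k) ℝ),
      ∫ x, logDensity S (x - m) ∂(multivariateGaussian c S₀)
        = -(1 / 2) * ((S⁻¹ * S₀).trace + inner ℝ (c - m) (act S⁻¹ (c - m)))
          - 1 / 2 * Real.log S.det := fun m S => by
    unfold logDensity
    rw [integral_sub (h m S) (integrable_const _), integral_const_mul,
      integral_inner_act_multivariateGaussian _ _ hS₀]
    simp
  rw [integral_sub (h' m S) (h' m' S'), h'', h'']

/-- The Kullback-Leibler divergence between two nondegenerate Gaussian measures. -/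
theorem klDiv_multivariateGaussian (m m' : E k) {S S' : Matrix (Fin k) (Fin k) ℝ}
    (hS : S.PosDef) (hS' : S'.PosDef) :
    (klDiv (multivariateGaussian m S) (multivariateGaussian m' S')).toReal
      = 1 / 2 * inner ℝ (m - m') (act S'⁻¹ (m - m'))
        + 1 / 2 * ((S'⁻¹ * S).trace - k + Real.log S'.det - Real.log S.det) := by
  rw [(klDiv_of_eq_withDensity_exp (by fun_prop)
    (multivariateGaussian_eq_withDensity_multivariateGaussian m m' hS hS')
    integrable_logDensity_sub).2, integral_logDensity_sub hS.posSemidef, hS.inv_mul, trace_one]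
  simp
  ring

/-- Concavity of `log det`, in the form of a tangent bound. -/
theorem log_det_le {S K : Matrix (Fin k) (Fin k) ℝ} (hS : S.PosDef) (hK : K.PosDef) :
    Real.log K.det ≤ Real.log S.det + ((S⁻¹ * K).trace - k) := by
  -- For equal means the divergence is exactly half the gap in the claimed inequality, and
  -- divergences are nonnegative.
  have h := klDiv_multivariateGaussian 0 0 hK hS
  have h0 : 0 ≤ (klDiv (multivariateGaussian 0 K) (multivariateGaussian 0 S)).toReal :=
    ENNReal.toReal_nonneg
  rw [h] at h0
  simp at h0
  linarith

end KL

/-! ### Exponential tilting of Gaussian measures by quadratic functions -/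

section Tilt

variable {k : ℕ}

theorem multivariateGaussian_eq_tilted (m : E k) {S : Matrix (Fin k) (Fin k) ℝ} (hS : S.PosDef) :
    Integrable (fun x : E k => Real.exp (-(1 / 2) * inner ℝ (x - m) (act S⁻¹ (x - m)))) ∧
    multivariateGaussian m S
      = (volume : Measure (E k)).tilted fun x => -(1 / 2) * inner ℝ (x - m) (act S⁻¹ (x - m)) := by
  set q : E k → ℝ := fun x => -(1 / 2) * inner ℝ (x - m) (act S⁻¹ (x - m)) with hq
  have hqm : Measurable q := by
    have : Continuous q := by rw [hq]; fun_prop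
    exact this.measurable
  set Z := ENNReal.ofReal (∫ x : E k, Real.exp (-(1 / 2) * ‖x‖ ^ 2))⁻¹ with hZ
  have hZ0 : Z ≠ 0 := by
    have := integral_exp_pos (integrable_exp_neg_half_sq_norm k)
    simpa [hZ] using this
  set r := Real.exp (-(1 / 2 * Real.log S.det)) with hr
  have hr0 : 0 < r := Real.exp_pos _
  have hden : multivariateGaussian m S = (Z * ENNReal.ofReal r) •
      (volume : Measure (E k)).withDensity fun x => ENNReal.ofReal (Real.exp (q x)) := by
    rw [multivariateGaussian_eq_withDensity m hS, gaussRef, withDensity_smul_measure, mul_smul]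
    congr 1
    rw [← withDensity_smul _ (by fun_prop)]
    congr 1
    ext x
    rw [Pi.smul_apply, smul_eq_mul, ← ENNReal.ofReal_mul hr0.le, hr, ← Real.exp_add, logDensity, hq]
    congr 2
    ring
  -- Total mass one gives both the finiteness of the partition function and the identification of
  -- the prefactor with its reciprocal.
  have huniv : (Z * ENNReal.ofReal r) * ∫⁻ x, ENNReal.ofReal (Real.exp (q x)) = 1 := by
    have := measure_univ (μ := multivariateGaussian m S)
    rwa [hden, Measure.smul_apply, withDensity_apply _ MeasurableSet.univ, Measure.restrict_univ,
      smul_eq_mul] at this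
  have hZr : Z * ENNReal.ofReal r ≠ 0 := mul_ne_zero hZ0 (by simpa using hr0)
  have hfin : ∫⁻ x, ENNReal.ofReal (Real.exp (q x)) ≠ ∞ := by
    intro h
    rw [h, ENNReal.mul_top hZr] at huniv
    simp at huniv
  have hint : Integrable (fun x => Real.exp (q x)) := by
    refine ⟨by fun_prop, ?_⟩
    rw [hasFiniteIntegral_iff_ofReal (ae_of_all _ fun x => (Real.exp_pos _).le)]
    exact hfin.lt_top
  refine ⟨hint, ?_⟩
  rw [hden, Measure.tilted, ← withDensity_smul _ (by fun_prop)]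
  congr 1
  ext x
  have hI := integral_exp_pos hint
  rw [← ofReal_integral_eq_lintegral_ofReal hint (ae_of_all _ fun x => (Real.exp_pos _).le)]
    at huniv
  rw [Pi.smul_apply, smul_eq_mul, ENNReal.eq_inv_of_mul_eq_one_left huniv, div_eq_inv_mul,
    ENNReal.ofReal_mul (inv_nonneg.2 hI.le), ENNReal.ofReal_inv_of_pos hI]

theorem tilted_add_const {α : Type*} [MeasurableSpace α] (μ : Measure α) (f : α → ℝ) (c : ℝ) :
    μ.tilted (fun x => f x + c) = μ.tilted f := by
  simp only [Measure.tilted, Real.exp_add]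
  congr 1
  ext x
  rw [integral_mul_const, mul_div_mul_right _ _ (Real.exp_ne_zero c)]

/-- The exponential of a quadratic function that is not strictly concave is not integrable. -/
theorem not_integrable_exp_of_not_posDef {M : Matrix (Fin k) (Fin k) ℝ} (hM : M.IsHermitian)
    (hn : ¬ M.PosDef) (b : E k) :
    ¬ Integrable fun x : E k => Real.exp (-(1 / 2) * inner ℝ x (act M x) + inner ℝ x b) := by
  intro hi
  rw [posDef_iff_inner_act, not_and] at hn
  have := hn hM
  push Not at this
  obtain ⟨v, hv0, hv⟩ := this
  set f : E k → ℝ := fun x => Real.exp (-(1 / 2) * inner ℝ x (act M x) + inner ℝ x b) with hf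
  have hfc : Continuous f := by rw [hf]; fun_prop
  -- Along `v` the logarithm of `f` is convex, because `⟨v, M v⟩ ≤ 0`. Hence `f x ^ 2` is at most
  -- the product of the two shifted values, and the inequality of arithmetic and geometric means
  -- applies. Averaged over the unit ball, this says that two opposite translates of the ball
  -- together carry at least twice its mass, at any distance; an integrable `f` cannot have that.
  have key : ∀ (s : ℝ) (x : E k), 2 * f x ≤ f (x + s • v) + f (x - s • v) := by
    intro s x
    have h1 : f x * f x ≤ f (x + s • v) * f (x - s • v) := by
      simp only [hf, ← Real.exp_add]
      refine Real.exp_le_exp.2 ?_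
      simp only [act_add_vec, act_sub_vec, act_smul_vec, inner_add_left, inner_add_right,
        inner_sub_left, inner_sub_right, real_inner_smul_left, real_inner_smul_right]
      nlinarith [mul_nonneg (sq_nonneg s) (neg_nonneg.2 hv)]
    have hp := Real.exp_pos (-(1 / 2) * inner ℝ x (act M x) + inner ℝ x b)
    have hp1 : 0 < f (x + s • v) := Real.exp_pos _
    have hp2 : 0 < f (x - s • v) := Real.exp_pos _
    have hp' : 0 < f x := hp
    nlinarith [sq_nonneg (f (x + s • v) - f (x - s • v))]
  set B := Metric.closedBall (0 : E k) 1 with hB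
  have hc : 0 < ∫ x in B, f x := by
    refine (setIntegral_pos_iff_support_of_nonneg_ae (ae_of_all _ fun x => (Real.exp_pos _).le)
      hi.integrableOn).2 ?_
    have : Function.support f ∩ B = B := Set.inter_eq_right.2 fun x _ => (Real.exp_pos _).ne'
    rw [this]
    exact Metric.measure_closedBall_pos _ _ one_pos
  have hshift : ∀ w : E k, ∫ x in B, f (x + w) = ∫ x in Metric.closedBall w 1, f x := by
    intro w
    have hmp : MeasurePreserving (fun x : E k => x + w) volume volume :=
      measurePreserving_add_right _ w
    rw [← hmp.setIntegral_preimage_emb (MeasurableEquiv.addRight w).measurableEmbedding f]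
    congr 2
    ext x
    simp [hB, Metric.mem_closedBall, dist_eq_norm]
  have hlim : Tendsto (fun R : ℕ => ∫ x in {x : E k | (R : ℝ) ≤ ‖x‖}, f x) atTop (nhds 0) := by
    have h := tendsto_setIntegral_of_antitone (μ := (volume : Measure (E k))) (f := f)
      (s := fun R : ℕ => {x : E k | (R : ℝ) ≤ ‖x‖})
      (fun R => measurableSet_le measurable_const measurable_norm)
      (fun R R' h x hx => show (R : ℝ) ≤ ‖x‖ from
        (Nat.cast_le.2 h).trans (show (R' : ℝ) ≤ ‖x‖ from hx)) ⟨0, hi.integrableOn⟩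
    have : ⋂ R : ℕ, {x : E k | (R : ℝ) ≤ ‖x‖} = ∅ := by
      ext x
      simp only [Set.mem_iInter, Set.mem_ofPred_eq, Set.mem_empty_iff_false, iff_false, not_forall,
        not_le]
      exact exists_nat_gt _
    rwa [this, setIntegral_empty] at h
  -- Outside radius `R` less mass remains than on the unit ball. A shift of length `R + 1` moves the
  -- unit ball entirely outside this radius.
  obtain ⟨R, hR⟩ := (hlim.eventually (gt_mem_nhds hc)).exists
  set s : ℝ := (R + 1) / ‖v‖ with hs
  have hsv : ‖s • v‖ = R + 1 := by
    rw [norm_smul, hs, Real.norm_of_nonneg (by positivity),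
      div_mul_cancel₀ _ (norm_ne_zero_iff.2 hv0)]
  have hle : ∀ w : E k, ‖w‖ = R + 1 → ∫ x in B, f (x + w) < ∫ x in B, f x := by
    intro w hw
    rw [hshift]
    refine lt_of_le_of_lt (setIntegral_mono_set hi.integrableOn
      (ae_of_all _ fun x => (Real.exp_pos _).le) (LE.le.eventuallyLE fun x hx => ?_)) hR
    rw [mem_closedBall_iff_norm] at hx
    have := norm_sub_norm_le w x
    rw [norm_sub_rev] at hx
    change (R : ℝ) ≤ ‖x‖
    linarith
  have hint : ∀ w : E k, IntegrableOn (fun x => f (x + w)) B := fun w =>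
    (hi.comp_add_right w).integrableOn
  have h1 := hle (s • v) hsv
  have h2 := hle (-(s • v)) (by rw [norm_neg, hsv])
  have h3 : ∫ x in B, 2 * f x ≤ ∫ x in B, (f (x + s • v) + f (x + -(s • v))) :=
    integral_mono (hi.integrableOn.const_mul 2) ((hint _).add (hint _)) fun x => by
      simpa [sub_eq_add_neg] using key s x
  rw [integral_const_mul, integral_add (hint _) (hint _)] at h3
  linarith

theorem tilted_multivariateGaussian_eq {S Q : Matrix (Fin k) (Fin k) ℝ} (hS : S.PosDef)
    (b : E k) (c : ℝ) :
    (multivariateGaussian 0 S).tilted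
        (fun t => -(1 / 2) * inner ℝ t (act Q t) + inner ℝ t b + c)
      = (volume : Measure (E k)).tilted
        fun t => -(1 / 2) * inner ℝ t (act (S⁻¹ + Q) t) + inner ℝ t b := by
  obtain ⟨hi, h⟩ := multivariateGaussian_eq_tilted 0 hS
  rw [h, tilted_tilted hi, ← tilted_add_const volume
    (fun t => -(1 / 2) * inner ℝ t (act (S⁻¹ + Q) t) + inner ℝ t b) c]
  congr 1
  ext t
  simp only [Pi.add_apply, sub_zero, act_add, inner_add_right]
  ring

theorem tilted_multivariateGaussian {S Q : Matrix (Fin k) (Fin k) ℝ} (hS : S.PosDef)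
    (hP : (S⁻¹ + Q).PosDef) (b : E k) (c : ℝ) :
    (multivariateGaussian 0 S).tilted
        (fun t => -(1 / 2) * inner ℝ t (act Q t) + inner ℝ t b + c)
      = multivariateGaussian (act (S⁻¹ + Q)⁻¹ b) (S⁻¹ + Q)⁻¹ := by
  rw [tilted_multivariateGaussian_eq hS, (multivariateGaussian_eq_tilted _ hP.inv).2]
  set P := S⁻¹ + Q
  rw [Matrix.nonsing_inv_nonsing_inv _ ((Matrix.isUnit_iff_isUnit_det _).1 hP.isUnit)]
  -- The added constant completes the square around the mean `P⁻¹ b`.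
  rw [← tilted_add_const volume (fun t => -(1 / 2) * inner ℝ t (act P t) + inner ℝ t b)
    (-(1 / 2) * inner ℝ (act P⁻¹ b) b)]
  congr 1
  ext t
  have h1 : act P (act P⁻¹ b) = b := by rw [← act_mul, hP.mul_inv, act_one]
  have h2 : inner ℝ (act P⁻¹ b) (act P t) = inner ℝ t b := by
    rw [inner_act, hP.transpose_eq, h1, real_inner_comm]
  simp only [act_sub_vec, inner_sub_left, inner_sub_right, h1, h2]
  ring

theorem tilted_multivariateGaussian_of_not_posDef {S Q : Matrix (Fin k) (Fin k) ℝ} (hS : S.PosDef)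
    (hQ : Qᵀ = Q) (hP : ¬ (S⁻¹ + Q).PosDef) (b : E k) (c : ℝ) :
    (multivariateGaussian 0 S).tilted
        (fun t => -(1 / 2) * inner ℝ t (act Q t) + inner ℝ t b + c) = 0 := by
  rw [tilted_multivariateGaussian_eq hS]
  exact tilted_of_not_integrable (not_integrable_exp_of_not_posDef
    (isHermitian_of_transpose_eq (by rw [transpose_add, hQ, hS.inv_transpose])) hP b)

end Tilt

/-! ### Cross-covariance matrices -/

section CrossCov

variable {Ω : Type*} [MeasurableSpace Ω] {P : Measure Ω} {a b c : ℕ}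

theorem crossCov_apply (U : Ω → E a) (V : Ω → E b) (P : Measure Ω) (i : Fin a) (j : Fin b) :
    crossCov U V P i j = cov[fun ω => U ω i, fun ω => V ω j; P] := rfl

theorem crossCov_transpose (U : Ω → E a) (V : Ω → E b) : (crossCov U V P)ᵀ = crossCov V U P := by
  ext i j
  rw [transpose_apply, crossCov_apply, crossCov_apply, covariance_comm]

variable [IsProbabilityMeasure P] {U U' : Ω → E a} {V : Ω → E b}

theorem crossCov_act_left (M : Matrix (Fin c) (Fin a) ℝ) (hU : MemLp U 2 P) (hV : MemLp V 2 P) :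
    crossCov (fun ω => act M (U ω)) V P = M * crossCov U V P := by
  ext i j
  simp only [crossCov_apply, act_apply, mul_apply]
  rw [covariance_fun_sum_left (fun l => (hU.eval_piLp l).const_mul _) (hV.eval_piLp j)]
  simp only [covariance_const_mul_left]

theorem crossCov_add_left (hU : MemLp U 2 P) (hU' : MemLp U' 2 P) (hV : MemLp V 2 P) :
    crossCov (fun ω => U ω + U' ω) V P = crossCov U V P + crossCov U' V P := by
  ext i j
  exact covariance_add_left (hU.eval_piLp i) (hU'.eval_piLp i) (hV.eval_piLp j)

theorem crossCov_sub_left (hU : MemLp U 2 P) (hU' : MemLp U' 2 P) (hV : MemLp V 2 P) :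
    crossCov (fun ω => U ω - U' ω) V P = crossCov U V P - crossCov U' V P := by
  ext i j
  exact covariance_sub_left (hU.eval_piLp i) (hU'.eval_piLp i) (hV.eval_piLp j)

theorem crossCov_act_right (M : Matrix (Fin c) (Fin a) ℝ) (hU : MemLp U 2 P) (hV : MemLp V 2 P) :
    crossCov V (fun ω => act M (U ω)) P = crossCov V U P * Mᵀ := by
  rw [← crossCov_transpose, crossCov_act_left M hU hV, transpose_mul, crossCov_transpose]

theorem crossCov_add_right (hU : MemLp U 2 P) (hU' : MemLp U' 2 P) (hV : MemLp V 2 P) :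
    crossCov V (fun ω => U ω + U' ω) P = crossCov V U P + crossCov V U' P := by
  rw [← crossCov_transpose, crossCov_add_left hU hU' hV, transpose_add, crossCov_transpose,
    crossCov_transpose]

theorem crossCov_sub_right (hU : MemLp U 2 P) (hU' : MemLp U' 2 P) (hV : MemLp V 2 P) :
    crossCov V (fun ω => U ω - U' ω) P = crossCov V U P - crossCov V U' P := by
  rw [← crossCov_transpose, crossCov_sub_left hU hU' hV, transpose_sub, crossCov_transpose,
    crossCov_transpose]

omit [IsProbabilityMeasure P] in
theorem memLp_act (M : Matrix (Fin c) (Fin a) ℝ) (hU : MemLp U 2 P) :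
    MemLp (fun ω => act M (U ω)) 2 P :=
  (actL M).comp_memLp' hU

theorem covariance_inner_inner (hU : MemLp U 2 P) (hV : MemLp V 2 P) (x : E a) (y : E b) :
    cov[fun ω => inner ℝ x (U ω), fun ω => inner ℝ y (V ω); P]
      = inner ℝ x (act (crossCov U V P) y) := by
  simp only [inner_eq_sum, act_apply]
  rw [covariance_fun_sum_fun_sum (fun l => (hU.eval_piLp l).const_mul _)
    (fun l => (hV.eval_piLp l).const_mul _)]
  simp only [Finset.mul_sum]
  refine Finset.sum_congr rfl fun i _ => Finset.sum_congr rfl fun j _ => ?_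
  rw [covariance_const_mul_left, covariance_const_mul_right, crossCov_apply]
  ring

theorem crossCov_map {Ω' : Type*} [MeasurableSpace Ω'] {Q : Measure Ω'} {g : Ω' → Ω}
    (hg : AEMeasurable g Q) {U : Ω → E a} {V : Ω → E b} (hU : Measurable U) (hV : Measurable V) :
    crossCov U V (Q.map g) = crossCov (fun ω => U (g ω)) (fun ω => V (g ω)) Q := by
  ext i j
  rw [crossCov_apply, crossCov_apply, covariance_map_fun (by fun_prop) (by fun_prop) hg]

omit [IsProbabilityMeasure P] in
theorem crossCov_eq_zero_of_indepFun (hU : MemLp U 2 P) (hV : MemLp V 2 P) (h : IndepFun U V P) :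
    crossCov U V P = 0 := by
  ext i j
  have h' : IndepFun (fun ω => U ω i) (fun ω => V ω j) P :=
    h.comp (φ := fun x : E a => x i) (ψ := fun x : E b => x j) (by fun_prop) (by fun_prop)
  exact h'.covariance_eq_zero (hU.eval_piLp i) (hV.eval_piLp j)

theorem crossCov_multivariateGaussian (m : E a) {S : Matrix (Fin a) (Fin a) ℝ} (hS : S.PosDef) :
    crossCov (fun x => x) (fun x => x) (multivariateGaussian m S) = S := by
  ext i j
  exact covariance_eval_multivariateGaussian hS.posSemidef i j

/-- A centered Gaussian vector has law `N(0, S)`, where `S` is its covariance matrix. -/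
theorem map_eq_multivariateGaussian (hU : HasGaussianLaw U P) (h0 : ∫ ω, U ω ∂P = 0)
    (hS : (crossCov U U P).PosSemidef) :
    P.map U = multivariateGaussian 0 (crossCov U U P) := by
  have := hU.isGaussian_map
  apply IsGaussian.ext
  · rw [integral_map hU.aemeasurable (by fun_prop), integral_id_multivariateGaussian']
    exact h0
  · ext x y
    rw [covarianceBilin_apply_eq_cov IsGaussian.memLp_two_id,
      covarianceBilin_multivariateGaussian hS,
      covariance_map_fun (by fun_prop) (by fun_prop) hU.aemeasurable,
      covariance_inner_inner hU.memLp_two hU.memLp_two, inner_act_eq_dotProduct]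

/-- For jointly Gaussian vectors independence only has to be tested on covariances of linear
functionals. -/
theorem indepFun_of_crossCov_eq_zero (h : HasGaussianLaw (fun ω => (V ω, U ω)) P)
    (h0 : crossCov U V P = 0) : IndepFun V U P := by
  refine h.indepFun_of_covariance_inner fun x y => ?_
  rw [covariance_inner_inner h.fst.memLp_two h.snd.memLp_two, ← crossCov_transpose, h0,
    transpose_zero, act_zero, inner_zero_right]

/-- Needed for conditioning on the pair `(T₁, T₂)`. The product of two Euclidean spaces is not
itself of the form `E k`, so functionals on it are split into an inner product with each factor. -/
theorem indepFun_prod_of_crossCov_eq_zero {V' : Ω → E c}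
    (h : HasGaussianLaw (fun ω => ((V ω, V' ω), U ω)) P)
    (h0 : crossCov U V P = 0) (h0' : crossCov U V' P = 0) :
    IndepFun (fun ω => (V ω, V' ω)) U P := by
  have hU := h.snd.memLp_two
  have hV := h.fst.fst.memLp_two
  have hV' := h.fst.snd.memLp_two
  refine h.indepFun_of_covariance_strongDual fun L₁ L₂ => ?_
  obtain ⟨y, rfl⟩ := (InnerProductSpace.toDual ℝ (E a)).surjective L₂
  obtain ⟨x, hx⟩ := (InnerProductSpace.toDual ℝ (E b)).surjective
    (L₁ ∘L ContinuousLinearMap.inl ℝ _ _)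
  obtain ⟨x', hx'⟩ := (InnerProductSpace.toDual ℝ (E c)).surjective
    (L₁ ∘L ContinuousLinearMap.inr ℝ _ _)
  have hL : (L₁ ∘ fun ω => (V ω, V' ω))
      = (fun ω => inner ℝ x (V ω)) + fun ω => inner ℝ x' (V' ω) := by
    ext ω
    have h1 := DFunLike.congr_fun hx (V ω)
    have h2 := DFunLike.congr_fun hx' (V' ω)
    simp only [InnerProductSpace.toDual_apply_apply, ContinuousLinearMap.comp_apply,
      ContinuousLinearMap.inl_apply, ContinuousLinearMap.inr_apply] at h1 h2
    rw [Pi.add_apply, h1, h2, ← map_add]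
    simp
  have hi : ∀ {l : ℕ} {T : Ω → E l} (_ : MemLp T 2 P) (z : E l),
      MemLp (fun ω => inner ℝ z (T ω)) 2 P := fun hT z => hT.const_inner z
  have hR : (⇑((InnerProductSpace.toDual ℝ (E a)) y) ∘ U) = fun ω => inner ℝ y (U ω) := by
    ext ω; simp
  rw [hL, hR, covariance_add_left (hi hV x) (hi hV' x') (hi hU y),
    covariance_inner_inner hV hU, covariance_inner_inner hV' hU, ← crossCov_transpose, h0,
    ← crossCov_transpose U V', h0']
  simp [act_zero]

end CrossCov

/-! ### Linear regression: `U = f(V) + W` with Gaussian noise `W` independent of `V` -/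

section Regression

variable {Ω 𝒱 : Type*} [MeasurableSpace Ω] [MeasurableSpace 𝒱] {a : ℕ}

/-- The law of `f v + ζ`, `ζ ∼ N(0, S)`, as a channel with input `v`. -/
def gaussianKernel (f : 𝒱 → E a) (S : Matrix (Fin a) (Fin a) ℝ) : Kernel 𝒱 (E a) :=
  (Kernel.id ×ₖ Kernel.const 𝒱 (multivariateGaussian (0 : E a) S)).map fun z => f z.1 + z.2

theorem map_const_add_multivariateGaussian (c : E a) (S : Matrix (Fin a) (Fin a) ℝ) :
    (multivariateGaussian 0 S).map (fun x => c + x) = multivariateGaussian c S := by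
  unfold multivariateGaussian
  rw [Measure.map_map (by fun_prop) (by fun_prop)]
  congr 1
  ext x
  simp

theorem gaussianKernel_apply {f : 𝒱 → E a} (hf : Measurable f) (S : Matrix (Fin a) (Fin a) ℝ)
    (v : 𝒱) : gaussianKernel f S v = multivariateGaussian (f v) S := by
  have hm : Measurable fun z : 𝒱 × E a => f z.1 + z.2 := by fun_prop
  rw [gaussianKernel, Kernel.map_apply _ hm, Kernel.prod_apply, Kernel.id_apply,
    Kernel.const_apply, Measure.dirac_prod, Measure.map_map hm (by fun_prop),
    ← map_const_add_multivariateGaussian (f v)]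
  rfl

theorem isMarkovKernel_gaussianKernel {f : 𝒱 → E a} (hf : Measurable f)
    (S : Matrix (Fin a) (Fin a) ℝ) : IsMarkovKernel (gaussianKernel f S) :=
  ⟨fun v => by rw [gaussianKernel_apply hf]; infer_instance⟩

theorem gaussianChannel_apply {n k : ℕ} (M : Matrix (Fin k) (Fin n) ℝ)
    (S : Matrix (Fin k) (Fin k) ℝ) (x : E n) :
    gaussianChannel M S x = multivariateGaussian (act M x) S :=
  gaussianKernel_apply (measurable_act M) S x

variable {P : Measure Ω} [IsProbabilityMeasure P] {U : Ω → E a} {V : Ω → 𝒱} {f : 𝒱 → E a}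
  {S : Matrix (Fin a) (Fin a) ℝ}

/-- The joint law of `V` and the residual is a product measure; the shear `(v, w) ↦ (v, f v + w)`
turns it into a disintegration over `V`. -/
theorem map_prod_eq_compProd (hU : Measurable U) (hV : Measurable V) (hf : Measurable f)
    (hi : IndepFun V (fun ω => U ω - f (V ω)) P)
    (hW : P.map (fun ω => U ω - f (V ω)) = multivariateGaussian 0 S) :
    P.map (fun ω => (V ω, U ω)) = P.map V ⊗ₘ gaussianKernel f S := by
  have hWm : Measurable fun ω => U ω - f (V ω) := by fun_prop
  have := isMarkovKernel_gaussianKernel hf S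
  have := Measure.isProbabilityMeasure_map (μ := P) hV.aemeasurable
  rw [indepFun_iff_map_prod_eq_prod_map_map hV.aemeasurable hWm.aemeasurable, hW] at hi
  have h1 : P.map (fun ω => (V ω, U ω))
      = (P.map fun ω => (V ω, U ω - f (V ω))).map fun z => (z.1, f z.1 + z.2) := by
    rw [Measure.map_map (by fun_prop) (by fun_prop)]
    congr 1
    ext ω <;> simp
  rw [h1, hi]
  refine Measure.ext_of_lintegral _ fun h hh => ?_
  rw [lintegral_map hh (by fun_prop), Measure.lintegral_compProd hh,
    lintegral_prod _ (by fun_prop)]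
  refine lintegral_congr fun v => ?_
  rw [gaussianKernel_apply hf, ← map_const_add_multivariateGaussian (f v),
    lintegral_map (by fun_prop) (by fun_prop)]

theorem condDistrib_ae_eq_multivariateGaussian (hU : Measurable U) (hV : Measurable V)
    (hf : Measurable f) (hi : IndepFun V (fun ω => U ω - f (V ω)) P)
    (hW : P.map (fun ω => U ω - f (V ω)) = multivariateGaussian 0 S) :
    condDistrib U V P =ᵐ[P.map V] fun v => multivariateGaussian (f v) S := by
  have := isMarkovKernel_gaussianKernel hf S
  have h := condDistrib_ae_eq_of_measure_eq_compProd V hU.aemeasurable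
    (map_prod_eq_compProd hU hV hf hi hW)
  filter_upwards [h] with v hv
  rw [hv, gaussianKernel_apply hf]

/-- Relative to the product of the marginals, the joint law has the density `exp (logDensity S (u -
f v) - logDensity ST u)`. Each of the two quadratic forms has expectation `a`, the dimension, so
they cancel and only the log-determinants survive. -/
theorem mutualInfo_eq_log_det (hU : Measurable U) (hV : Measurable V) (hf : Measurable f)
    (hi : IndepFun V (fun ω => U ω - f (V ω)) P) (hS : S.PosDef)
    (hW : P.map (fun ω => U ω - f (V ω)) = multivariateGaussian 0 S)
    {ST : Matrix (Fin a) (Fin a) ℝ} (hST : ST.PosDef)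
    (hU' : P.map U = multivariateGaussian 0 ST) :
    mutualInfo U V P ≠ ∞ ∧
      (mutualInfo U V P).toReal = 1 / 2 * (Real.log ST.det - Real.log S.det) := by
  have hWm : Measurable fun ω => U ω - f (V ω) := by fun_prop
  have := isMarkovKernel_gaussianKernel hf S
  have := Measure.isProbabilityMeasure_map (μ := P) hV.aemeasurable
  have := Measure.isProbabilityMeasure_map (μ := P) hU.aemeasurable
  have := Measure.isProbabilityMeasure_map (μ := P) (hU.prodMk hV).aemeasurable
  set g : E a × 𝒱 → ℝ := fun z => logDensity S (z.1 - f z.2) - logDensity ST (z.1 - 0) with hg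
  have hgm : Measurable g := by rw [hg]; fun_prop
  have hden : P.map (fun ω => (U ω, V ω)) = ((P.map U).prod (P.map V)).withDensity
      fun z => ENNReal.ofReal (Real.exp (g z)) := by
    have h1 : P.map (fun ω => (U ω, V ω)) = (P.map fun ω => (V ω, U ω)).map Prod.swap := by
      rw [Measure.map_map (by fun_prop) (by fun_prop)]; rfl
    rw [h1, map_prod_eq_compProd hU hV hf hi hW]
    refine Measure.ext_of_lintegral _ fun h hh => ?_
    rw [lintegral_map hh (by fun_prop), Measure.lintegral_compProd (by fun_prop),
      lintegral_withDensity_eq_lintegral_mul _ (by fun_prop) hh,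
      lintegral_prod_symm _ (by fun_prop)]
    refine lintegral_congr fun v => ?_
    rw [gaussianKernel_apply hf,
      multivariateGaussian_eq_withDensity_multivariateGaussian (f v) 0 hS hST,
      lintegral_withDensity_eq_lintegral_mul _ (by fun_prop) (by fun_prop), hU']
    rfl
  have hLW : MemLp (fun ω => U ω - f (V ω)) 2 P := by
    have : IsGaussian (P.map fun ω => U ω - f (V ω)) := by rw [hW]; infer_instance
    exact IsGaussian.hasGaussianLaw.memLp_two
  have hLU : MemLp U 2 P := by
    have : IsGaussian (P.map U) := by rw [hU']; infer_instance
    exact IsGaussian.hasGaussianLaw.memLp_two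
  have hI1 := (integrable_inner_act S⁻¹ hLW hLW).const_mul (-(1 / 2))
  have hI2 := (integrable_inner_act ST⁻¹ hLU hLU).const_mul (-(1 / 2))
  have hJ1 : Integrable (fun ω => logDensity S (U ω - f (V ω))) P := hI1.sub (integrable_const _)
  have hJ2 : Integrable (fun ω => logDensity ST (U ω)) P := hI2.sub (integrable_const _)
  have hgi : Integrable (fun ω => g (U ω, V ω)) P := by
    simp only [hg, sub_zero]
    exact hJ1.sub hJ2
  have htr : ∀ {T : Ω → E a} {R : Matrix (Fin a) (Fin a) ℝ}, Measurable T → R.PosDef →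
      P.map T = multivariateGaussian 0 R → ∫ ω, inner ℝ (T ω) (act R⁻¹ (T ω)) ∂P = a := by
    intro T R hT hR h
    have h1 := integral_inner_act_multivariateGaussian 0 0 hR.posSemidef R⁻¹
    rw [← h, integral_map hT.aemeasurable (by fun_prop), hR.inv_mul, trace_one] at h1
    simpa [act_zero_vec] using h1
  obtain ⟨hk1, hk2⟩ := klDiv_of_eq_withDensity_exp hgm hden
    ((integrable_map_measure (by fun_prop) (by fun_prop)).2 hgi)
  refine ⟨hk1, ?_⟩
  rw [mutualInfo, hk2, integral_map (by fun_prop) (by fun_prop)]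
  simp only [hg, sub_zero]
  rw [integral_sub hJ1 hJ2]
  unfold logDensity
  rw [integral_sub hI1 (integrable_const _), integral_sub hI2 (integrable_const _)]
  simp only [integral_const_mul]
  rw [htr hWm hS hW, htr hU hST hU']
  simp
  ring

end Regression

/-! ### Matrix identities for linear estimation -/

namespace SourceCov

variable {n m : ℕ} {C : SourceCov n m}

theorem Θ_mul_SX (hSX : C.SX.PosDef) : C.Θ * C.SX = C.SYX := by
  rw [Θ, Matrix.mul_assoc, hSX.inv_mul, Matrix.mul_one]

theorem SY_eq (hSX : C.SX.PosDef) : C.SY = C.SYgX + C.Θ * C.SX * C.Θᵀ := by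
  rw [Θ_mul_SX hSX, SYgX, Θ, transpose_mul, hSX.inv_transpose, ← Matrix.mul_assoc]
  abel

theorem SY_posDef (hSX : C.SX.PosDef) (hSYgX : C.SYgX.PosDef) : C.SY.PosDef := by
  rw [SY_eq hSX]
  refine hSYgX.add_posSemidef ?_
  rw [← conjTranspose_eq_transpose_of_trivial]
  exact hSX.posSemidef.mul_mul_conjTranspose_same _

end SourceCov

theorem posSemidef_mul_mul_transpose {a b : ℕ} {S : Matrix (Fin a) (Fin a) ℝ} (hS : S.PosSemidef)
    (M : Matrix (Fin b) (Fin a) ℝ) : (M * S * Mᵀ).PosSemidef := by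
  rw [← conjTranspose_eq_transpose_of_trivial]
  exact hS.mul_mul_conjTranspose_same _

namespace Params

variable {n m k₁ k₂ l : ℕ} {C : SourceCov n m} {p : Params n k₁ k₂} {β lam γ : ℝ}

/-- Exchange of the two representations. -/
def swap (p : Params n k₁ k₂) : Params n k₂ k₁ := ⟨p.B, p.S₂, p.A, p.S₁⟩

theorem Nondegenerate.swap (hp : p.Nondegenerate) : p.swap.Nondegenerate := ⟨hp.2, hp.1⟩

theorem ST₁_swap : p.swap.ST₁ C = p.ST₂ C := rfl
theorem ST₂_swap : p.swap.ST₂ C = p.ST₁ C := rfl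
theorem ST₁gT₂_swap : p.swap.ST₁gT₂ C = p.ST₂gT₁ C := rfl
theorem ST₂gT₁_swap : p.swap.ST₂gT₁ C = p.ST₁gT₂ C := rfl
theorem Ψ₁_swap : p.swap.Ψ₁ C = p.Ψ₂ C := rfl
theorem Ψ₂_swap : p.swap.Ψ₂ C = p.Ψ₁ C := rfl
theorem A_swap : p.swap.A = p.B := rfl
theorem B_swap : p.swap.B = p.A := rfl

theorem SXgT_swap : p.swap.SXgT C = p.SXgT C := by
  simp only [SXgT, Params.swap, ST₁gT₂, ST₂gT₁, SXgT₁, SXgT₂, ST₁, ST₂]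
  abel

theorem SYgT_swap : p.swap.SYgT C = p.SYgT C := by
  rw [SYgT, SYgT, SXgT_swap]

theorem newPrec₂_eq_swap : p.newPrec₂ C lam γ = p.swap.newPrec₁ C lam γ := by
  rw [newPrec₁, SYgT_swap]
  rfl

theorem ST₁_posDef (hSX : C.SX.PosDef) (hp : p.Nondegenerate) : (p.ST₁ C).PosDef :=
  Matrix.PosDef.posSemidef_add (posSemidef_mul_mul_transpose hSX.posSemidef _) hp.1

theorem ST₂_posDef (hSX : C.SX.PosDef) (hp : p.Nondegenerate) : (p.ST₂ C).PosDef := by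
  rw [← ST₁_swap]; exact ST₁_posDef hSX hp.swap

/-- The covariance matrix of `N X - M T₁`. -/
def errCov₁ (C : SourceCov n m) (p : Params n k₁ k₂) (N : Matrix (Fin l) (Fin n) ℝ)
    (M : Matrix (Fin l) (Fin k₁) ℝ) : Matrix (Fin l) (Fin l) ℝ :=
  (N - M * p.A) * C.SX * (N - M * p.A)ᵀ + M * p.S₁ * Mᵀ

/-- The covariance matrix of `N X - M₁ T₁ - M₂ T₂`. -/
def errCov (C : SourceCov n m) (p : Params n k₁ k₂) (N : Matrix (Fin l) (Fin n) ℝ)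
    (M₁ : Matrix (Fin l) (Fin k₁) ℝ) (M₂ : Matrix (Fin l) (Fin k₂) ℝ) :
    Matrix (Fin l) (Fin l) ℝ :=
  (N - M₁ * p.A - M₂ * p.B) * C.SX * (N - M₁ * p.A - M₂ * p.B)ᵀ + M₁ * p.S₁ * M₁ᵀ
    + M₂ * p.S₂ * M₂ᵀ

theorem errCov₁_posSemidef (hSX : C.SX.PosDef) (hp : p.Nondegenerate)
    (N : Matrix (Fin l) (Fin n) ℝ) (M : Matrix (Fin l) (Fin k₁) ℝ) :
    (errCov₁ C p N M).PosSemidef :=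
  (posSemidef_mul_mul_transpose hSX.posSemidef _).add
    (posSemidef_mul_mul_transpose hp.1.posSemidef _)

theorem errCov_posSemidef (hSX : C.SX.PosDef) (hp : p.Nondegenerate)
    (N : Matrix (Fin l) (Fin n) ℝ) (M₁ : Matrix (Fin l) (Fin k₁) ℝ)
    (M₂ : Matrix (Fin l) (Fin k₂) ℝ) :
    (errCov C p N M₁ M₂).PosSemidef :=
  ((posSemidef_mul_mul_transpose hSX.posSemidef _).add
    (posSemidef_mul_mul_transpose hp.1.posSemidef _)).add
    (posSemidef_mul_mul_transpose hp.2.posSemidef _)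

/-- Completing the square: the error covariance splits at the solution of the normal equation. -/
theorem errCov₁_eq (hSX : C.SX.PosDef) (hp : p.Nondegenerate)
    {N : Matrix (Fin l) (Fin n) ℝ} {G : Matrix (Fin l) (Fin k₁) ℝ}
    (h : G * p.ST₁ C = N * C.SX * p.Aᵀ) (M : Matrix (Fin l) (Fin k₁) ℝ) :
    errCov₁ C p N M = N * C.SX * Nᵀ - G * p.A * C.SX * Nᵀ + errCov₁ C p 0 (M - G) := by
  have hX := hSX.transpose_eq
  have h1 := hp.1.transpose_eq
  -- The three products turn `G ΣT₁ Mᵀ`, `M ΣT₁ Gᵀ` and `G ΣT₁ Gᵀ`, where `ΣT₁` is `p.ST₁ C`, into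
  -- the cross terms with `N`.
  have e1 := congrArg (· * Mᵀ) h
  have e2 := congrArg (fun Z => M * Zᵀ) h
  have e3 := congrArg (fun Z => G * Zᵀ) h
  simp only [ST₁, Matrix.mul_add, Matrix.add_mul, Matrix.mul_assoc, transpose_mul, transpose_add,
    transpose_transpose, hX, h1] at e1 e2 e3
  simp only [errCov₁, zero_sub, Matrix.mul_sub, Matrix.sub_mul,
    Matrix.mul_assoc, Matrix.neg_mul, Matrix.mul_neg, transpose_neg, transpose_mul, transpose_sub]
  linear_combination (norm := abel) e1 + e2 - e3

/-- Completing the square for two observations: the hypotheses are the normal equations written in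
blocks, and the remainder is the error covariance of the deviation from their solution. -/
theorem errCov_eq (hSX : C.SX.PosDef) (hp : p.Nondegenerate)
    {N : Matrix (Fin l) (Fin n) ℝ} {G₁ : Matrix (Fin l) (Fin k₁) ℝ}
    {G₂ : Matrix (Fin l) (Fin k₂) ℝ}
    (h : G₁ * p.ST₁ C + G₂ * (p.B * C.SX * p.Aᵀ) = N * C.SX * p.Aᵀ)
    (h' : G₁ * (p.A * C.SX * p.Bᵀ) + G₂ * p.ST₂ C = N * C.SX * p.Bᵀ)
    (M₁ : Matrix (Fin l) (Fin k₁) ℝ) (M₂ : Matrix (Fin l) (Fin k₂) ℝ) :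
    errCov C p N M₁ M₂ = N * C.SX * Nᵀ - G₁ * p.A * C.SX * Nᵀ - G₂ * p.B * C.SX * Nᵀ
      + errCov C p 0 (M₁ - G₁) (M₂ - G₂) := by
  have hX := hSX.transpose_eq
  have h1 := hp.1.transpose_eq
  have h2 := hp.2.transpose_eq
  have e1 := congrArg (· * M₁ᵀ) h
  have e2 := congrArg (fun Z => M₁ * Zᵀ) h
  have e3 := congrArg (fun Z => G₁ * Zᵀ) h
  have f1 := congrArg (· * M₂ᵀ) h'
  have f2 := congrArg (fun Z => M₂ * Zᵀ) h'
  have f3 := congrArg (fun Z => G₂ * Zᵀ) h'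
  simp only [ST₁, ST₂, Matrix.mul_add, Matrix.add_mul, Matrix.mul_assoc, transpose_mul,
    transpose_add, transpose_transpose, hX, h1, h2] at e1 e2 e3 f1 f2 f3
  simp only [errCov, zero_sub, Matrix.mul_sub, Matrix.sub_mul,
    Matrix.mul_assoc, Matrix.neg_mul, Matrix.mul_neg, transpose_neg, transpose_mul, transpose_sub]
  linear_combination (norm := abel) e1 + e2 - e3 + f1 + f2 - f3

theorem Ξ₁_mul_ST₁ (hSX : C.SX.PosDef) (hp : p.Nondegenerate) :
    p.Ξ₁ C * p.ST₁ C = p.B * C.SX * p.Aᵀ := by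
  rw [Ξ₁, Matrix.mul_assoc, (ST₁_posDef hSX hp).inv_mul, Matrix.mul_one]

theorem ST₂gT₁_eq : p.ST₂gT₁ C = p.ST₂ C - p.Ξ₁ C * (p.A * C.SX * p.Bᵀ) := by
  simp only [ST₂gT₁, SXgT₁, Ξ₁, ST₂, ST₁, Matrix.mul_sub, Matrix.sub_mul, Matrix.mul_assoc]
  abel

theorem ST₂gT₁_eq_errCov₁ (hSX : C.SX.PosDef) (hp : p.Nondegenerate) :
    p.ST₂gT₁ C = errCov₁ C p p.B (p.Ξ₁ C) + p.S₂ := by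
  rw [errCov₁_eq hSX hp (Ξ₁_mul_ST₁ hSX hp), ST₂gT₁_eq, ST₂]
  simp only [errCov₁, sub_self, Matrix.zero_mul, Matrix.mul_assoc]
  abel

theorem ST₂gT₁_posDef (hSX : C.SX.PosDef) (hp : p.Nondegenerate) : (p.ST₂gT₁ C).PosDef := by
  rw [ST₂gT₁_eq_errCov₁ hSX hp]
  exact Matrix.PosDef.posSemidef_add (errCov₁_posSemidef hSX hp _ _) hp.2

theorem ST₁gT₂_posDef (hSX : C.SX.PosDef) (hp : p.Nondegenerate) : (p.ST₁gT₂ C).PosDef := by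
  rw [← ST₂gT₁_swap]; exact ST₂gT₁_posDef hSX hp.swap

theorem ST₁gT₂_eq : p.ST₁gT₂ C = p.ST₁ C - p.Ξ₂ C * (p.B * C.SX * p.Aᵀ) := by
  rw [← ST₂gT₁_swap, ST₂gT₁_eq]
  rfl

/-- The terms with `(p.ST₂gT₁ C)⁻¹` cancel between the two summands. What remains contains
`(p.ST₁gT₂ C)⁻¹` times the Schur complement that equals `p.ST₁gT₂ C`. -/
theorem Ψ₁_normal (hSX : C.SX.PosDef) (hp : p.Nondegenerate) :
    p.Ψ₁ C * p.ST₁ C + p.Ψ₂ C * (p.B * C.SX * p.Aᵀ) = C.Θ * C.SX * p.Aᵀ := by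
  have ha := (ST₁_posDef hSX hp).inv_mul
  have hK := (ST₁gT₂_posDef hSX hp).inv_mul
  have e := congrArg (fun Z => C.Θ * C.SX * p.Aᵀ * Z) hK
  rw [ST₁gT₂_eq] at e
  -- The previous rewrite also expanded the matrix under the inverse; that occurrence is folded
  -- back.
  nth_rewrite 1 [← ST₁gT₂_eq] at e
  simp only [Ξ₂, Matrix.mul_sub, Matrix.mul_assoc, Matrix.mul_one] at e
  simp only [Ψ₁, Ψ₂, Matrix.mul_sub, Matrix.sub_mul, Matrix.mul_assoc, ha, Matrix.mul_one]
  linear_combination (norm := abel) e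

theorem Ψ₂_normal (hSX : C.SX.PosDef) (hp : p.Nondegenerate) :
    p.Ψ₁ C * (p.A * C.SX * p.Bᵀ) + p.Ψ₂ C * p.ST₂ C = C.Θ * C.SX * p.Bᵀ := by
  rw [add_comm, ← ST₁_swap, ← Ψ₁_swap, ← Ψ₂_swap, ← A_swap (p := p), ← B_swap (p := p)]
  exact Ψ₁_normal hSX hp.swap

theorem SYgT_eq : p.SYgT C = C.Θ * C.SX * C.Θᵀ - p.Ψ₁ C * p.A * C.SX * C.Θᵀ
    - p.Ψ₂ C * p.B * C.SX * C.Θᵀ + C.SYgX := by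
  simp only [SYgT, SXgT, Ψ₁, Ψ₂, Matrix.mul_sub, Matrix.sub_mul, Matrix.mul_add, Matrix.add_mul,
    Matrix.mul_assoc]
  abel

/-- An arbitrary linear estimator of `Y` exceeds the optimal error covariance by a positive
semidefinite matrix. This domination replaces differentiating `Ψ₁` and `Ψ₂` in the variational
argument. -/
theorem SYgT_add_errCov (hSX : C.SX.PosDef) (hp : p.Nondegenerate)
    (M₁ : Matrix (Fin m) (Fin k₁) ℝ) (M₂ : Matrix (Fin m) (Fin k₂) ℝ) :
    errCov C p C.Θ M₁ M₂ + C.SYgX = p.SYgT C + errCov C p 0 (M₁ - p.Ψ₁ C) (M₂ - p.Ψ₂ C) := by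
  rw [errCov_eq hSX hp (Ψ₁_normal hSX hp) (Ψ₂_normal hSX hp), SYgT_eq]
  abel

theorem SYgT_eq_errCov (hSX : C.SX.PosDef) (hp : p.Nondegenerate) :
    p.SYgT C = errCov C p C.Θ (p.Ψ₁ C) (p.Ψ₂ C) + C.SYgX := by
  rw [SYgT_add_errCov hSX hp]
  simp [errCov]

theorem ST₂gT₁_add_errCov₁ (hSX : C.SX.PosDef) (hp : p.Nondegenerate)
    (M : Matrix (Fin k₂) (Fin k₁) ℝ) :
    errCov₁ C p p.B M + p.S₂ = p.ST₂gT₁ C + errCov₁ C p 0 (M - p.Ξ₁ C) := by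
  rw [errCov₁_eq hSX hp (Ξ₁_mul_ST₁ hSX hp), ST₂gT₁_eq, ST₂]
  simp only [Matrix.mul_assoc]
  abel

theorem SYgT_posDef (hSX : C.SX.PosDef) (hSYgX : C.SYgX.PosDef) (hp : p.Nondegenerate) :
    (p.SYgT C).PosDef := by
  rw [SYgT_eq_errCov hSX hp]
  exact Matrix.PosDef.posSemidef_add (errCov_posSemidef hSX hp _ _ _) hSYgX

/-- Both sides are the log-determinant of the joint covariance of `(T₁, T₂)`, factored through its
two Schur complements; this is the symmetry of `I(T₁; T₂)`. -/
theorem log_det_ST_eq (hSX : C.SX.PosDef) (hp : p.Nondegenerate) :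
    Real.log (p.ST₁ C).det + Real.log (p.ST₂gT₁ C).det
      = Real.log (p.ST₂ C).det + Real.log (p.ST₁gT₂ C).det := by
  have ha := ST₁_posDef hSX hp
  have hd := ST₂_posDef hSX hp
  let := ha.isUnit.invertible
  let := hd.isUnit.invertible
  have h1 := det_fromBlocks₁₁ (p.ST₁ C) (p.A * C.SX * p.Bᵀ) (p.B * C.SX * p.Aᵀ) (p.ST₂ C)
  have h2 := det_fromBlocks₂₂ (p.ST₁ C) (p.A * C.SX * p.Bᵀ) (p.B * C.SX * p.Aᵀ) (p.ST₂ C)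
  rw [invOf_eq_nonsing_inv] at h1 h2
  rw [← Real.log_mul ha.det_pos.ne' (ST₂gT₁_posDef hSX hp).det_pos.ne',
    ← Real.log_mul hd.det_pos.ne' (ST₁gT₂_posDef hSX hp).det_pos.ne', ST₂gT₁_eq, ST₁gT₂_eq,
    Ξ₁, Ξ₂, ← h1, ← h2]

/-- The coefficient of `t₁ᵀ · x` in the exponent of the first self-consistent equation, when `T₂`
has conditional mean `B' x`. -/
def linCoef₁ (C : SourceCov n m) (p : Params n k₁ k₂) (β γ : ℝ) (B' : Matrix (Fin k₂) (Fin n) ℝ) :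
    Matrix (Fin k₁) (Fin n) ℝ :=
  -((γ / β) • ((p.Ξ₁ C)ᵀ * (p.ST₂gT₁ C)⁻¹ * B'))
    + (1 / β) • ((p.Ψ₁ C)ᵀ * (p.SYgT C)⁻¹ * (C.Θ - p.Ψ₂ C * B'))

theorem newA_eq : p.newA C β γ = (p.newPrec₁ C β γ)⁻¹ * p.linCoef₁ C β γ p.B := rfl

/-- The update of `B` is that of `A` for the exchanged pair, except that the updated coupling is
inserted; hence the free argument `B'` of `linCoef₁`. -/
theorem newB_eq : p.newB C β lam γ
    = (p.newPrec₂ C lam γ)⁻¹ * p.swap.linCoef₁ C lam γ (p.newA C β γ) := by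
  rw [linCoef₁, SYgT_swap]
  rfl

/-- The normal equations replace `Ξ₁ ΣT₁` by `B Σ_X Aᵀ` and `Ψ₁ ΣT₁` by `(Θ - Ψ₂ B) Σ_X Aᵀ`. The
identity holds at every nondegenerate representation and makes a variation of the noise covariance
superfluous. -/
theorem newPrec₁_mul_ST₁ (hSX : C.SX.PosDef) (hp : p.Nondegenerate) :
    p.newPrec₁ C β γ * p.ST₁ C = 1 + p.linCoef₁ C β γ p.B * C.SX * p.Aᵀ := by
  have h1 := congrArg (fun Z => (1 / β) • ((p.Ψ₁ C)ᵀ * (p.SYgT C)⁻¹ * Z)) (Ψ₁_normal hSX hp)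
  simp only [Matrix.mul_add, smul_add, Matrix.mul_assoc] at h1
  simp only [newPrec₁, linCoef₁, Matrix.add_mul, Matrix.sub_mul, Matrix.smul_mul,
    (ST₁_posDef hSX hp).inv_mul, Matrix.mul_assoc, Ξ₁_mul_ST₁ hSX hp, Matrix.mul_sub, smul_sub,
    Matrix.neg_mul]
  linear_combination (norm := abel) h1

end Params

/-! ### Regression in a centered Gaussian measure -/

section GaussianRegression

variable {F : Type*} [NormedAddCommGroup F] [NormedSpace ℝ F] [MeasurableSpace F] [BorelSpace F]
  [SecondCountableTopology F] [CompleteSpace F] {a b c : ℕ}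

omit [SecondCountableTopology F] [CompleteSpace F] in
theorem hasGaussianLaw_clm (μ : Measure F) [IsGaussian μ] {G : Type*} [NormedAddCommGroup G]
    [NormedSpace ℝ G] [MeasurableSpace G] [BorelSpace G] (L : F →L[ℝ] G) :
    HasGaussianLaw (fun w => L w) μ :=
  IsGaussian.hasGaussianLaw_id.map_fun L

omit [SecondCountableTopology F] [CompleteSpace F] in
theorem memLp_two_clm (μ : Measure F) [IsGaussian μ] (L : F →L[ℝ] E a) :
    MemLp (fun w => L w) 2 μ :=
  (hasGaussianLaw_clm μ L).memLp_two

theorem integral_clm_eq_zero {μ : Measure F} [IsGaussian μ] (h0 : ∫ w, w ∂μ = 0)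
    (L : F →L[ℝ] E a) : ∫ w, L w ∂μ = 0 := by
  rw [L.integral_comp_comm IsGaussian.integrable_fun_id, h0, map_zero]

theorem map_clm_eq_multivariateGaussian {μ : Measure F} [IsGaussian μ] (h0 : ∫ w, w ∂μ = 0)
    (U : F →L[ℝ] E a) {S : Matrix (Fin a) (Fin a) ℝ}
    (hU : crossCov (fun w => U w) (fun w => U w) μ = S)
    (hS : S.PosDef) : μ.map (fun w => U w) = multivariateGaussian 0 S := by
  rw [map_eq_multivariateGaussian (hasGaussianLaw_clm μ U) (integral_clm_eq_zero h0 U)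
    (by rw [hU]; exact hS.posSemidef), hU]

/-- In a centered Gaussian measure, the residual of the best linear estimate of `U` from `V` is
independent of `V`. -/
theorem regression_clm {μ : Measure F} [IsGaussian μ] (h0 : ∫ w, w ∂μ = 0)
    (U : F →L[ℝ] E a) (V : F →L[ℝ] E b) (M : Matrix (Fin a) (Fin b) ℝ)
    {SU : Matrix (Fin a) (Fin a) ℝ} {SUV : Matrix (Fin a) (Fin b) ℝ} {SV : Matrix (Fin b) (Fin b) ℝ}
    (hU : crossCov (fun w => U w) (fun w => U w) μ = SU)
    (hUV : crossCov (fun w => U w) (fun w => V w) μ = SUV)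
    (hV : crossCov (fun w => V w) (fun w => V w) μ = SV) (hM : SUV = M * SV)
    (hS : (SU - M * SUVᵀ).PosDef) :
    IndepFun (fun w => V w) (fun w => U w - act M (V w)) μ ∧
    μ.map (fun w => U w - act M (V w)) = multivariateGaussian 0 (SU - M * SUVᵀ) := by
  have lU := memLp_two_clm μ U
  have lV := memLp_two_clm μ V
  have lMV := memLp_act M lV
  have lR : MemLp (fun w => U w - act M (V w)) 2 μ := lU.sub lMV
  have hRV : crossCov (fun w => U w - act M (V w)) (fun w => V w) μ = 0 := by
    rw [crossCov_sub_left lU lMV lV, crossCov_act_left M lV lV, hUV, hV, hM, sub_self]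
  refine ⟨indepFun_of_crossCov_eq_zero
    (hasGaussianLaw_clm μ (V.prod (U - (actL M).comp V))) hRV, ?_⟩
  refine map_clm_eq_multivariateGaussian h0 (U - (actL M).comp V) ?_ hS
  -- Since the residual is uncorrelated with `V`, its covariance equals its cross-covariance with
  -- `U`.
  change crossCov (fun w => U w - act M (V w)) (fun w => U w - act M (V w)) μ = _
  rw [crossCov_sub_right lU lMV lR, crossCov_act_right M lV lR, hRV, Matrix.zero_mul, sub_zero,
    crossCov_sub_left lU lMV lU, crossCov_act_left M lV lU, hU,
    ← crossCov_transpose, hUV]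

/-- Regression on two vectors; `hM` and `hM'` are the normal equations in block form. -/
theorem regression_prod_clm {μ : Measure F} [IsGaussian μ] (h0 : ∫ w, w ∂μ = 0)
    (U : F →L[ℝ] E a) (V : F →L[ℝ] E b) (V' : F →L[ℝ] E c) (M : Matrix (Fin a) (Fin b) ℝ)
    (M' : Matrix (Fin a) (Fin c) ℝ)
    {SU : Matrix (Fin a) (Fin a) ℝ} {SUV : Matrix (Fin a) (Fin b) ℝ}
    {SUV' : Matrix (Fin a) (Fin c) ℝ} {SV : Matrix (Fin b) (Fin b) ℝ}
    {SV' : Matrix (Fin c) (Fin c) ℝ} {SVV' : Matrix (Fin b) (Fin c) ℝ}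
    (hU : crossCov (fun w => U w) (fun w => U w) μ = SU)
    (hUV : crossCov (fun w => U w) (fun w => V w) μ = SUV)
    (hUV' : crossCov (fun w => U w) (fun w => V' w) μ = SUV')
    (hV : crossCov (fun w => V w) (fun w => V w) μ = SV)
    (hV' : crossCov (fun w => V' w) (fun w => V' w) μ = SV')
    (hVV' : crossCov (fun w => V w) (fun w => V' w) μ = SVV')
    (hM : SUV = M * SV + M' * SVV'ᵀ) (hM' : SUV' = M * SVV' + M' * SV')
    (hS : (SU - M * SUVᵀ - M' * SUV'ᵀ).PosDef) :
    IndepFun (fun w => (V w, V' w)) (fun w => U w - (act M (V w) + act M' (V' w))) μ ∧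
    μ.map (fun w => U w - (act M (V w) + act M' (V' w)))
      = multivariateGaussian 0 (SU - M * SUVᵀ - M' * SUV'ᵀ) := by
  have lU := memLp_two_clm μ U
  have lV := memLp_two_clm μ V
  have lV' := memLp_two_clm μ V'
  have lMV := memLp_act M lV
  have lMV' := memLp_act M' lV'
  have lP : MemLp (fun w => act M (V w) + act M' (V' w)) 2 μ := lMV.add lMV'
  have lR : MemLp (fun w => U w - (act M (V w) + act M' (V' w))) 2 μ := lU.sub lP
  have hV'V : crossCov (fun w => V' w) (fun w => V w) μ = SVV'ᵀ := by
    rw [← crossCov_transpose, hVV']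
  have hRV : crossCov (fun w => U w - (act M (V w) + act M' (V' w))) (fun w => V w) μ = 0 := by
    rw [crossCov_sub_left lU lP lV, crossCov_add_left lMV lMV' lV, crossCov_act_left M lV lV,
      crossCov_act_left M' lV' lV, hUV, hV, hV'V, hM, sub_self]
  have hRV' : crossCov (fun w => U w - (act M (V w) + act M' (V' w))) (fun w => V' w) μ = 0 := by
    rw [crossCov_sub_left lU lP lV', crossCov_add_left lMV lMV' lV', crossCov_act_left M lV lV',
      crossCov_act_left M' lV' lV', hUV', hV', hVV', hM', sub_self]
  refine ⟨indepFun_prod_of_crossCov_eq_zero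
    (hasGaussianLaw_clm μ ((V.prod V').prod (U - ((actL M).comp V + (actL M').comp V')))) hRV hRV',
    ?_⟩
  refine map_clm_eq_multivariateGaussian h0 (U - ((actL M).comp V + (actL M').comp V')) ?_ hS
  change crossCov (fun w => U w - (act M (V w) + act M' (V' w)))
    (fun w => U w - (act M (V w) + act M' (V' w))) μ = _
  rw [crossCov_sub_right lU lP lR, crossCov_add_right lMV lMV' lR, crossCov_act_right M lV lR,
    crossCov_act_right M' lV' lR, hRV, hRV', Matrix.zero_mul, Matrix.zero_mul, add_zero, sub_zero,
    crossCov_sub_left lU lP lU, crossCov_add_left lMV lMV' lU, crossCov_act_left M lV lU,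
    crossCov_act_left M' lV' lU, hU, ← crossCov_transpose (fun w => U w) (fun w => V w),
    ← crossCov_transpose (fun w => U w) (fun w => V' w), hUV, hUV', sub_sub]

end GaussianRegression

/-! ### The joint law of a Gaussian source and a pair of Gaussian representations -/

section Model

variable {n m k₁ k₂ : ℕ}

/-- `ν` is the centered Gaussian law with covariance data `C`. -/
structure IsCenteredGaussian (ν : Measure (E n × E m)) (C : SourceCov n m) : Prop where
  isGaussian : IsGaussian ν
  integral_eq_zero : ∫ z, z ∂ν = 0
  crossCov_fst_fst : crossCov Prod.fst Prod.fst ν = C.SX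
  crossCov_snd_fst : crossCov Prod.snd Prod.fst ν = C.SYX
  crossCov_snd_snd : crossCov Prod.snd Prod.snd ν = C.SY

/-- `μ` is a centered Gaussian law of `((X, Y), (T₁, T₂))` with the covariances of the
representations with parameters `p`. -/
structure IsGaussianModel (C : SourceCov n m) (p : Params n k₁ k₂)
    (μ : Measure ((E n × E m) × (E k₁ × E k₂))) : Prop where
  isGaussian : IsGaussian μ
  integral_eq_zero : ∫ w, w ∂μ = 0
  XX : crossCov rvX rvX μ = C.SX
  YX : crossCov rvY rvX μ = C.SYX
  YY : crossCov rvY rvY μ = C.SY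
  T₁X : crossCov rvT₁ rvX μ = p.A * C.SX
  T₂X : crossCov rvT₂ rvX μ = p.B * C.SX
  YT₁ : crossCov rvY rvT₁ μ = C.SYX * p.Aᵀ
  YT₂ : crossCov rvY rvT₂ μ = C.SYX * p.Bᵀ
  T₁T₁ : crossCov rvT₁ rvT₁ μ = p.ST₁ C
  T₁T₂ : crossCov rvT₁ rvT₂ μ = p.A * C.SX * p.Bᵀ
  T₂T₂ : crossCov rvT₂ rvT₂ μ = p.ST₂ C

/-- Realizes the channels by independent additive noises, so that the joint law becomes a linear
image of a product of Gaussian measures. -/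
theorem jointLaw_eq_map (ν : Measure (E n × E m)) [IsProbabilityMeasure ν]
    (p : Params n k₁ k₂) :
    jointLaw ν p.channel₁ p.channel₂
      = (ν.prod ((multivariateGaussian 0 p.S₁).prod (multivariateGaussian 0 p.S₂))).map
        fun w => (w.1, (act p.A w.1.1 + w.2.1, act p.B w.1.1 + w.2.2)) := by
  refine Measure.ext_of_lintegral _ fun h hh => ?_
  rw [jointLaw, Measure.lintegral_compProd hh, lintegral_map hh (by fun_prop),
    lintegral_prod _ (by fun_prop)]
  refine lintegral_congr fun z => ?_
  rw [Kernel.comap_apply, Kernel.prod_apply, Params.channel₁, Params.channel₂,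
    gaussianChannel_apply, gaussianChannel_apply, lintegral_prod _ (by fun_prop),
    lintegral_prod _ (by fun_prop), ← map_const_add_multivariateGaussian (act p.A z.1),
    lintegral_map (by fun_prop) (by fun_prop)]
  refine lintegral_congr fun z₁ => ?_
  rw [← map_const_add_multivariateGaussian (act p.B z.1), lintegral_map (by fun_prop) (by fun_prop)]

theorem integral_prod_id_eq_zero {F G : Type*} [NormedAddCommGroup F] [NormedSpace ℝ F]
    [MeasurableSpace F] [BorelSpace F] [CompleteSpace F] [NormedAddCommGroup G] [NormedSpace ℝ G]
    [MeasurableSpace G] [BorelSpace G] [CompleteSpace G] [SecondCountableTopology F]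
    [SecondCountableTopology G] {μ : Measure F} {ν : Measure G} [IsGaussian μ] [IsGaussian ν]
    (hμ : ∫ x, x ∂μ = 0) (hν : ∫ x, x ∂ν = 0) : ∫ w, w ∂(μ.prod ν) = 0 := by
  have hi : Integrable (fun w : F × G => w) (μ.prod ν) := IsGaussian.integrable_fun_id
  refine Prod.ext ?_ ?_
  · rw [fst_integral hi, integral_fun_fst (fun x => x), hμ, smul_zero]; rfl
  · rw [snd_integral hi, integral_fun_snd (fun x => x), hν, smul_zero]; rfl

theorem isGaussianModel_jointLaw {ν : Measure (E n × E m)} [IsProbabilityMeasure ν]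
    {C : SourceCov n m} (hν : IsCenteredGaussian ν C) {p : Params n k₁ k₂}
    (hp : p.Nondegenerate) : IsGaussianModel C p (jointLaw ν p.channel₁ p.channel₂) := by
  have := hν.isGaussian
  set π := ν.prod ((multivariateGaussian 0 p.S₁).prod (multivariateGaussian 0 p.S₂)) with hπ
  have hid : ∀ {k : ℕ} (S : Matrix (Fin k) (Fin k) ℝ), ∫ x, x ∂(multivariateGaussian 0 S) = 0 :=
    fun S => integral_id_multivariateGaussian
  have hπ0 : ∫ w, w ∂π = 0 := integral_prod_id_eq_zero hν.integral_eq_zero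
    (integral_prod_id_eq_zero (hid _) (hid _))
  let cX : (E n × E m) × (E k₁ × E k₂) →L[ℝ] E n :=
    (ContinuousLinearMap.fst ℝ _ _).comp (ContinuousLinearMap.fst ℝ _ _)
  let cZ₁ : (E n × E m) × (E k₁ × E k₂) →L[ℝ] E k₁ :=
    (ContinuousLinearMap.fst ℝ _ _).comp (ContinuousLinearMap.snd ℝ _ _)
  let cZ₂ : (E n × E m) × (E k₁ × E k₂) →L[ℝ] E k₂ :=
    (ContinuousLinearMap.snd ℝ _ _).comp (ContinuousLinearMap.snd ℝ _ _)
  let Φ : (E n × E m) × (E k₁ × E k₂) →L[ℝ] (E n × E m) × (E k₁ × E k₂) :=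
    (ContinuousLinearMap.fst ℝ _ _).prod
      (((actL p.A).comp cX + cZ₁).prod ((actL p.B).comp cX + cZ₂))
  have hΦ : jointLaw ν p.channel₁ p.channel₂ = π.map Φ := jointLaw_eq_map ν p
  have hΦm : AEMeasurable Φ π := Φ.continuous.aemeasurable
  have lX : MemLp (fun w : (E n × E m) × (E k₁ × E k₂) => w.1.1) 2 π := memLp_two_clm π cX
  have lY : MemLp (fun w : (E n × E m) × (E k₁ × E k₂) => w.1.2) 2 π :=
    memLp_two_clm π ((ContinuousLinearMap.snd ℝ _ _).comp (ContinuousLinearMap.fst ℝ _ _))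
  have l₁ : MemLp (fun w : (E n × E m) × (E k₁ × E k₂) => w.2.1) 2 π := memLp_two_clm π cZ₁
  have l₂ : MemLp (fun w : (E n × E m) × (E k₁ × E k₂) => w.2.2) 2 π := memLp_two_clm π cZ₂
  have lA := memLp_act p.A lX
  have lB := memLp_act p.B lX
  have lT₁ : MemLp (fun w : (E n × E m) × (E k₁ × E k₂) => act p.A w.1.1 + w.2.1) 2 π := lA.add l₁
  have lT₂ : MemLp (fun w : (E n × E m) × (E k₁ × E k₂) => act p.B w.1.1 + w.2.2) 2 π := lB.add l₂
  have hfst : π.map Prod.fst = ν := by rw [hπ, Measure.map_fst_prod]; simp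
  have hsnd : π.map Prod.snd
      = (multivariateGaussian 0 p.S₁).prod (multivariateGaussian 0 p.S₂) := by
    rw [hπ, Measure.map_snd_prod]; simp
  have xx : crossCov (fun w : (E n × E m) × (E k₁ × E k₂) => w.1.1) (fun w => w.1.1) π = C.SX := by
    rw [← hν.crossCov_fst_fst, ← hfst,
      crossCov_map measurable_fst.aemeasurable measurable_fst measurable_fst]
  have yx : crossCov (fun w : (E n × E m) × (E k₁ × E k₂) => w.1.2) (fun w => w.1.1) π = C.SYX := by
    rw [← hν.crossCov_snd_fst, ← hfst,
      crossCov_map measurable_fst.aemeasurable measurable_snd measurable_fst]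
  have yy : crossCov (fun w : (E n × E m) × (E k₁ × E k₂) => w.1.2) (fun w => w.1.2) π = C.SY := by
    rw [← hν.crossCov_snd_snd, ← hfst,
      crossCov_map measurable_fst.aemeasurable measurable_snd measurable_snd]
  have z11 : crossCov (fun w : (E n × E m) × (E k₁ × E k₂) => w.2.1) (fun w => w.2.1) π
      = p.S₁ := by
    have h1 := crossCov_map (Q := π) measurable_snd.aemeasurable
      (measurable_fst (α := E k₁) (β := E k₂)) (measurable_fst (α := E k₁) (β := E k₂))
    have h2 := crossCov_map (Q := (multivariateGaussian 0 p.S₁).prod (multivariateGaussian 0 p.S₂))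
      measurable_fst.aemeasurable (measurable_id (α := E k₁)) (measurable_id (α := E k₁))
    rw [← h1, hsnd]
    refine h2.symm.trans ?_
    rw [Measure.map_fst_prod]
    simpa using! crossCov_multivariateGaussian 0 hp.1
  have z22 : crossCov (fun w : (E n × E m) × (E k₁ × E k₂) => w.2.2) (fun w => w.2.2) π
      = p.S₂ := by
    have h1 := crossCov_map (Q := π) measurable_snd.aemeasurable
      (measurable_snd (α := E k₁) (β := E k₂)) (measurable_snd (α := E k₁) (β := E k₂))
    have h2 := crossCov_map (Q := (multivariateGaussian 0 p.S₁).prod (multivariateGaussian 0 p.S₂))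
      measurable_snd.aemeasurable (measurable_id (α := E k₂)) (measurable_id (α := E k₂))
    rw [← h1, hsnd]
    refine h2.symm.trans ?_
    rw [Measure.map_snd_prod]
    simpa using! crossCov_multivariateGaussian 0 hp.2
  have hind : IndepFun (Prod.fst : (E n × E m) × (E k₁ × E k₂) → _) Prod.snd π :=
    indepFun_prod measurable_id measurable_id
  have z12 : crossCov (fun w : (E n × E m) × (E k₁ × E k₂) => w.2.1) (fun w => w.2.2) π = 0 := by
    have h1 := crossCov_map (Q := π) measurable_snd.aemeasurable
      (measurable_fst (α := E k₁) (β := E k₂)) (measurable_snd (α := E k₁) (β := E k₂))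
    rw [← h1, hsnd]
    have q₁ : MemLp (Prod.fst : E k₁ × E k₂ → E k₁) 2
        ((multivariateGaussian 0 p.S₁).prod (multivariateGaussian 0 p.S₂)) :=
      (hasGaussianLaw_clm ((multivariateGaussian 0 p.S₁).prod (multivariateGaussian 0 p.S₂))
        (ContinuousLinearMap.fst ℝ (E k₁) (E k₂))).memLp_two
    have q₂ : MemLp (Prod.snd : E k₁ × E k₂ → E k₂) 2
        ((multivariateGaussian 0 p.S₁).prod (multivariateGaussian 0 p.S₂)) :=
      (hasGaussianLaw_clm ((multivariateGaussian 0 p.S₁).prod (multivariateGaussian 0 p.S₂))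
        (ContinuousLinearMap.snd ℝ (E k₁) (E k₂))).memLp_two
    exact crossCov_eq_zero_of_indepFun q₁ q₂ (indepFun_prod measurable_id measurable_id)
  have x1 : crossCov (fun w : (E n × E m) × (E k₁ × E k₂) => w.1.1) (fun w => w.2.1) π = 0 :=
    crossCov_eq_zero_of_indepFun lX l₁ (hind.comp measurable_fst measurable_fst)
  have x2 : crossCov (fun w : (E n × E m) × (E k₁ × E k₂) => w.1.1) (fun w => w.2.2) π = 0 :=
    crossCov_eq_zero_of_indepFun lX l₂ (hind.comp measurable_fst measurable_snd)
  have y1 : crossCov (fun w : (E n × E m) × (E k₁ × E k₂) => w.1.2) (fun w => w.2.1) π = 0 :=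
    crossCov_eq_zero_of_indepFun lY l₁ (hind.comp measurable_snd measurable_fst)
  have y2 : crossCov (fun w : (E n × E m) × (E k₁ × E k₂) => w.1.2) (fun w => w.2.2) π = 0 :=
    crossCov_eq_zero_of_indepFun lY l₂ (hind.comp measurable_snd measurable_snd)
  have t1x : crossCov (fun w : (E n × E m) × (E k₁ × E k₂) => w.2.1) (fun w => w.1.1) π = 0 := by
    rw [← crossCov_transpose, x1, transpose_zero]
  have t2x : crossCov (fun w : (E n × E m) × (E k₁ × E k₂) => w.2.2) (fun w => w.1.1) π = 0 := by
    rw [← crossCov_transpose, x2, transpose_zero]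
  have mX : Measurable (rvX : (E n × E m) × (E k₁ × E k₂) → _) := by unfold rvX; fun_prop
  have mY : Measurable (rvY : (E n × E m) × (E k₁ × E k₂) → _) := by unfold rvY; fun_prop
  have mT₁ : Measurable (rvT₁ : (E n × E m) × (E k₁ × E k₂) → _) := by unfold rvT₁; fun_prop
  have mT₂ : Measurable (rvT₂ : (E n × E m) × (E k₁ × E k₂) → _) := by unfold rvT₂; fun_prop
  rw [hΦ]
  refine ⟨inferInstance, ?_, ?_, ?_, ?_, ?_, ?_, ?_, ?_, ?_, ?_, ?_⟩
  · rw [integral_map hΦm (by fun_prop), Φ.integral_comp_comm IsGaussian.integrable_fun_id, hπ0,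
      map_zero]
  · rw [crossCov_map hΦm mX mX]; exact xx
  · rw [crossCov_map hΦm mY mX]; exact yx
  · rw [crossCov_map hΦm mY mY]; exact yy
  · rw [crossCov_map hΦm mT₁ mX]
    change crossCov (fun w => act p.A w.1.1 + w.2.1) (fun w => w.1.1) π = _
    rw [crossCov_add_left lA l₁ lX, crossCov_act_left _ lX lX, xx, t1x, add_zero]
  · rw [crossCov_map hΦm mT₂ mX]
    change crossCov (fun w => act p.B w.1.1 + w.2.2) (fun w => w.1.1) π = _
    rw [crossCov_add_left lB l₂ lX, crossCov_act_left _ lX lX, xx, t2x, add_zero]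
  · rw [crossCov_map hΦm mY mT₁]
    change crossCov (fun w => w.1.2) (fun w => act p.A w.1.1 + w.2.1) π = _
    rw [crossCov_add_right lA l₁ lY, crossCov_act_right _ lX lY, yx, y1, add_zero]
  · rw [crossCov_map hΦm mY mT₂]
    change crossCov (fun w => w.1.2) (fun w => act p.B w.1.1 + w.2.2) π = _
    rw [crossCov_add_right lB l₂ lY, crossCov_act_right _ lX lY, yx, y2, add_zero]
  · rw [crossCov_map hΦm mT₁ mT₁]
    change crossCov (fun w => act p.A w.1.1 + w.2.1) (fun w => act p.A w.1.1 + w.2.1) π = _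
    rw [crossCov_add_left lA l₁ lT₁, crossCov_act_left _ lX lT₁, crossCov_add_right lA l₁ lX,
      crossCov_act_right _ lX lX, crossCov_add_right lA l₁ l₁, crossCov_act_right _ lX l₁, xx, x1,
      t1x, z11, Params.ST₁]
    simp [Matrix.mul_assoc]
  · rw [crossCov_map hΦm mT₁ mT₂]
    change crossCov (fun w => act p.A w.1.1 + w.2.1) (fun w => act p.B w.1.1 + w.2.2) π = _
    rw [crossCov_add_left lA l₁ lT₂, crossCov_act_left _ lX lT₂, crossCov_add_right lB l₂ lX,
      crossCov_act_right _ lX lX, crossCov_add_right lB l₂ l₁, crossCov_act_right _ lX l₁, xx, x2,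
      t1x, z12]
    simp [Matrix.mul_assoc]
  · rw [crossCov_map hΦm mT₂ mT₂]
    change crossCov (fun w => act p.B w.1.1 + w.2.2) (fun w => act p.B w.1.1 + w.2.2) π = _
    rw [crossCov_add_left lB l₂ lT₂, crossCov_act_left _ lX lT₂, crossCov_add_right lB l₂ lX,
      crossCov_act_right _ lX lX, crossCov_add_right lB l₂ l₂, crossCov_act_right _ lX l₂, xx, x2,
      t2x, z22, Params.ST₂]
    simp [Matrix.mul_assoc]

end Model

/-! ### Conditional laws and mutual informations of the Gaussian model -/

section Model

variable {n m k₁ k₂ : ℕ}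

@[fun_prop] theorem measurable_rvX :
    Measurable (rvX : (E n × E m) × (E k₁ × E k₂) → _) := by unfold rvX; fun_prop
@[fun_prop] theorem measurable_rvY :
    Measurable (rvY : (E n × E m) × (E k₁ × E k₂) → _) := by unfold rvY; fun_prop
@[fun_prop] theorem measurable_rvT₁ :
    Measurable (rvT₁ : (E n × E m) × (E k₁ × E k₂) → _) := by unfold rvT₁; fun_prop
@[fun_prop] theorem measurable_rvT₂ :
    Measurable (rvT₂ : (E n × E m) × (E k₁ × E k₂) → _) := by unfold rvT₂; fun_prop
@[fun_prop] theorem measurable_rvT :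
    Measurable (rvT : (E n × E m) × (E k₁ × E k₂) → _) := by unfold rvT; fun_prop

/-- `rvX` as a continuous linear map. -/
def clmX : (E n × E m) × (E k₁ × E k₂) →L[ℝ] E n :=
  (ContinuousLinearMap.fst ℝ _ _).comp (ContinuousLinearMap.fst ℝ _ _)
/-- `rvY` as a continuous linear map. -/
def clmY : (E n × E m) × (E k₁ × E k₂) →L[ℝ] E m :=
  (ContinuousLinearMap.snd ℝ _ _).comp (ContinuousLinearMap.fst ℝ _ _)
/-- `rvT₁` as a continuous linear map. -/
def clmT₁ : (E n × E m) × (E k₁ × E k₂) →L[ℝ] E k₁ :=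
  (ContinuousLinearMap.fst ℝ _ _).comp (ContinuousLinearMap.snd ℝ _ _)
/-- `rvT₂` as a continuous linear map. -/
def clmT₂ : (E n × E m) × (E k₁ × E k₂) →L[ℝ] E k₂ :=
  (ContinuousLinearMap.snd ℝ _ _).comp (ContinuousLinearMap.snd ℝ _ _)

namespace IsGaussianModel

variable {C : SourceCov n m} {p : Params n k₁ k₂}
  {μ : Measure ((E n × E m) × (E k₁ × E k₂))} (h : IsGaussianModel C p μ)

include h

theorem map_rvY (hSX : C.SX.PosDef) (hSYgX : C.SYgX.PosDef) :
    μ.map rvY = multivariateGaussian 0 C.SY :=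
  have := h.isGaussian
  map_clm_eq_multivariateGaussian h.integral_eq_zero clmY h.YY (SourceCov.SY_posDef hSX hSYgX)

theorem map_rvT₁ (hSX : C.SX.PosDef) (hp : p.Nondegenerate) :
    μ.map rvT₁ = multivariateGaussian 0 (p.ST₁ C) :=
  have := h.isGaussian
  map_clm_eq_multivariateGaussian h.integral_eq_zero clmT₁ h.T₁T₁ (Params.ST₁_posDef hSX hp)

theorem map_rvT₂ (hSX : C.SX.PosDef) (hp : p.Nondegenerate) :
    μ.map rvT₂ = multivariateGaussian 0 (p.ST₂ C) :=
  have := h.isGaussian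
  map_clm_eq_multivariateGaussian h.integral_eq_zero clmT₂ h.T₂T₂ (Params.ST₂_posDef hSX hp)

theorem regression_Y_X (hSX : C.SX.PosDef) (hSYgX : C.SYgX.PosDef) :
    IndepFun rvX (fun w => rvY w - act C.Θ (rvX w)) μ ∧
    μ.map (fun w => rvY w - act C.Θ (rvX w)) = multivariateGaussian 0 C.SYgX :=
  have := h.isGaussian
  regression_clm h.integral_eq_zero clmY clmX C.Θ h.YY h.YX h.XX
    (SourceCov.Θ_mul_SX hSX).symm hSYgX

theorem regression_T₁_X (hSX : C.SX.PosDef) (hp : p.Nondegenerate) :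
    IndepFun rvX (fun w => rvT₁ w - act p.A (rvX w)) μ ∧
    μ.map (fun w => rvT₁ w - act p.A (rvX w)) = multivariateGaussian 0 p.S₁ := by
  have := h.isGaussian
  have e : p.ST₁ C - p.A * (p.A * C.SX)ᵀ = p.S₁ := by
    rw [Params.ST₁, transpose_mul, hSX.transpose_eq, Matrix.mul_assoc, add_sub_cancel_left]
  have := regression_clm h.integral_eq_zero clmT₁ clmX p.A h.T₁T₁ h.T₁X h.XX rfl
    (by rw [e]; exact hp.1)
  rwa [e] at this

theorem regression_T₂_X (hSX : C.SX.PosDef) (hp : p.Nondegenerate) :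
    IndepFun rvX (fun w => rvT₂ w - act p.B (rvX w)) μ ∧
    μ.map (fun w => rvT₂ w - act p.B (rvX w)) = multivariateGaussian 0 p.S₂ := by
  have := h.isGaussian
  have e : p.ST₂ C - p.B * (p.B * C.SX)ᵀ = p.S₂ := by
    rw [Params.ST₂, transpose_mul, hSX.transpose_eq, Matrix.mul_assoc, add_sub_cancel_left]
  have := regression_clm h.integral_eq_zero clmT₂ clmX p.B h.T₂T₂ h.T₂X h.XX rfl
    (by rw [e]; exact hp.2)
  rwa [e] at this

theorem T₂T₁ (hSX : C.SX.PosDef) : crossCov rvT₂ rvT₁ μ = p.B * C.SX * p.Aᵀ := by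
  rw [← crossCov_transpose, h.T₁T₂, transpose_mul, transpose_mul, transpose_transpose,
    hSX.transpose_eq, Matrix.mul_assoc]

theorem regression_T₂_T₁ (hSX : C.SX.PosDef) (hp : p.Nondegenerate) :
    IndepFun rvT₁ (fun w => rvT₂ w - act (p.Ξ₁ C) (rvT₁ w)) μ ∧
    μ.map (fun w => rvT₂ w - act (p.Ξ₁ C) (rvT₁ w)) = multivariateGaussian 0 (p.ST₂gT₁ C) := by
  have := h.isGaussian
  have e : p.ST₂ C - p.Ξ₁ C * (p.B * C.SX * p.Aᵀ)ᵀ = p.ST₂gT₁ C := by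
    rw [Params.ST₂gT₁_eq, transpose_mul, transpose_mul, transpose_transpose, hSX.transpose_eq,
      Matrix.mul_assoc p.A]
  have := regression_clm h.integral_eq_zero clmT₂ clmT₁ (p.Ξ₁ C) h.T₂T₂ (h.T₂T₁ hSX) h.T₁T₁
    (Params.Ξ₁_mul_ST₁ hSX hp).symm (by rw [e]; exact Params.ST₂gT₁_posDef hSX hp)
  rwa [e] at this

theorem regression_T₁_T₂ (hSX : C.SX.PosDef) (hp : p.Nondegenerate) :
    IndepFun rvT₂ (fun w => rvT₁ w - act (p.Ξ₂ C) (rvT₂ w)) μ ∧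
    μ.map (fun w => rvT₁ w - act (p.Ξ₂ C) (rvT₂ w)) = multivariateGaussian 0 (p.ST₁gT₂ C) := by
  have := h.isGaussian
  have e : p.ST₁ C - p.Ξ₂ C * (p.A * C.SX * p.Bᵀ)ᵀ = p.ST₁gT₂ C := by
    rw [Params.ST₁gT₂_eq, transpose_mul, transpose_mul, transpose_transpose, hSX.transpose_eq,
      Matrix.mul_assoc p.B]
  have hΞ : p.A * C.SX * p.Bᵀ = p.Ξ₂ C * p.ST₂ C := (Params.Ξ₁_mul_ST₁ hSX hp.swap).symm
  have := regression_clm h.integral_eq_zero clmT₁ clmT₂ (p.Ξ₂ C) h.T₁T₁ h.T₁T₂ h.T₂T₂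
    hΞ (by rw [e]; exact Params.ST₁gT₂_posDef hSX hp)
  rwa [e] at this

theorem regression_Y_T (hSX : C.SX.PosDef) (hSYgX : C.SYgX.PosDef) (hp : p.Nondegenerate) :
    IndepFun rvT (fun w => rvY w - (act (p.Ψ₁ C) (rvT w).1 + act (p.Ψ₂ C) (rvT w).2)) μ ∧
    μ.map (fun w => rvY w - (act (p.Ψ₁ C) (rvT w).1 + act (p.Ψ₂ C) (rvT w).2))
      = multivariateGaussian 0 (p.SYgT C) := by
  have := h.isGaussian
  have e : C.SY - p.Ψ₁ C * (C.SYX * p.Aᵀ)ᵀ - p.Ψ₂ C * (C.SYX * p.Bᵀ)ᵀ = p.SYgT C := by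
    rw [Params.SYgT_eq, SourceCov.SY_eq hSX, ← SourceCov.Θ_mul_SX hSX]
    simp only [transpose_mul, transpose_transpose, hSX.transpose_eq, Matrix.mul_assoc]
    abel
  have e' : (p.A * C.SX * p.Bᵀ)ᵀ = p.B * C.SX * p.Aᵀ := by
    rw [transpose_mul, transpose_mul, transpose_transpose, hSX.transpose_eq, Matrix.mul_assoc]
  have := regression_prod_clm h.integral_eq_zero clmY clmT₁ clmT₂ (p.Ψ₁ C) (p.Ψ₂ C)
    h.YY h.YT₁ h.YT₂ h.T₁T₁ h.T₂T₂ h.T₁T₂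
    (by rw [e', Params.Ψ₁_normal hSX hp, SourceCov.Θ_mul_SX hSX])
    (by rw [Params.Ψ₂_normal hSX hp, SourceCov.Θ_mul_SX hSX])
    (by rw [e]; exact Params.SYgT_posDef hSX hSYgX hp)
  rwa [e] at this

theorem condDistrib_Y_X [IsProbabilityMeasure μ] (hSX : C.SX.PosDef) (hSYgX : C.SYgX.PosDef) :
    condDistrib rvY rvX μ =ᵐ[μ.map rvX] fun x => multivariateGaussian (act C.Θ x) C.SYgX :=
  have hr := h.regression_Y_X hSX hSYgX
  condDistrib_ae_eq_multivariateGaussian measurable_rvY measurable_rvX (measurable_act _)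
    hr.1 hr.2

theorem condDistrib_T₂_T₁ [IsProbabilityMeasure μ] (hSX : C.SX.PosDef) (hp : p.Nondegenerate) :
    condDistrib rvT₂ rvT₁ μ =ᵐ[μ.map rvT₁]
      fun t => multivariateGaussian (act (p.Ξ₁ C) t) (p.ST₂gT₁ C) :=
  have hr := h.regression_T₂_T₁ hSX hp
  condDistrib_ae_eq_multivariateGaussian measurable_rvT₂ measurable_rvT₁ (measurable_act _)
    hr.1 hr.2

theorem condDistrib_T₁_T₂ [IsProbabilityMeasure μ] (hSX : C.SX.PosDef) (hp : p.Nondegenerate) :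
    condDistrib rvT₁ rvT₂ μ =ᵐ[μ.map rvT₂]
      fun t => multivariateGaussian (act (p.Ξ₂ C) t) (p.ST₁gT₂ C) :=
  condDistrib_ae_eq_multivariateGaussian (U := rvT₁) (V := rvT₂) (f := act (p.Ξ₂ C))
    (S := p.ST₁gT₂ C) measurable_rvT₁ measurable_rvT₂ (measurable_act _)
    (h.regression_T₁_T₂ hSX hp).1 (h.regression_T₁_T₂ hSX hp).2

theorem condDistrib_Y_T [IsProbabilityMeasure μ] (hSX : C.SX.PosDef) (hSYgX : C.SYgX.PosDef)
    (hp : p.Nondegenerate) :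
    condDistrib rvY rvT μ =ᵐ[μ.map rvT] fun t =>
      multivariateGaussian (act (p.Ψ₁ C) t.1 + act (p.Ψ₂ C) t.2) (p.SYgT C) :=
  condDistrib_ae_eq_multivariateGaussian (U := rvY) (V := rvT)
    (f := fun t => act (p.Ψ₁ C) t.1 + act (p.Ψ₂ C) t.2) (S := p.SYgT C) measurable_rvY
    measurable_rvT (by fun_prop) (h.regression_Y_T hSX hSYgX hp).1 (h.regression_Y_T hSX hSYgX hp).2

theorem mutualInfo_Y_T (hSX : C.SX.PosDef) (hSYgX : C.SYgX.PosDef) (hp : p.Nondegenerate) :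
    mutualInfo rvY rvT μ ≠ ∞ ∧ (mutualInfo rvY rvT μ).toReal
      = 1 / 2 * (Real.log C.SY.det - Real.log (p.SYgT C).det) :=
  have := h.isGaussian
  mutualInfo_eq_log_det (U := rvY) (V := rvT) (f := fun t => act (p.Ψ₁ C) t.1 + act (p.Ψ₂ C) t.2)
    (S := p.SYgT C) (ST := C.SY) measurable_rvY measurable_rvT (by fun_prop)
    (h.regression_Y_T hSX hSYgX hp).1 (Params.SYgT_posDef hSX hSYgX hp)
    (h.regression_Y_T hSX hSYgX hp).2 (SourceCov.SY_posDef hSX hSYgX) (h.map_rvY hSX hSYgX)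

theorem mutualInfo_T₁_X (hSX : C.SX.PosDef) (hp : p.Nondegenerate) :
    mutualInfo rvT₁ rvX μ ≠ ∞ ∧ (mutualInfo rvT₁ rvX μ).toReal
      = 1 / 2 * (Real.log (p.ST₁ C).det - Real.log p.S₁.det) :=
  have := h.isGaussian
  have hr := h.regression_T₁_X hSX hp
  mutualInfo_eq_log_det measurable_rvT₁ measurable_rvX (measurable_act _) hr.1 hp.1 hr.2
    (Params.ST₁_posDef hSX hp) (h.map_rvT₁ hSX hp)

theorem mutualInfo_T₂_X (hSX : C.SX.PosDef) (hp : p.Nondegenerate) :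
    mutualInfo rvT₂ rvX μ ≠ ∞ ∧ (mutualInfo rvT₂ rvX μ).toReal
      = 1 / 2 * (Real.log (p.ST₂ C).det - Real.log p.S₂.det) :=
  have := h.isGaussian
  have hr := h.regression_T₂_X hSX hp
  mutualInfo_eq_log_det measurable_rvT₂ measurable_rvX (measurable_act _) hr.1 hp.2 hr.2
    (Params.ST₂_posDef hSX hp) (h.map_rvT₂ hSX hp)

theorem mutualInfo_T₁_T₂ (hSX : C.SX.PosDef) (hp : p.Nondegenerate) :
    mutualInfo rvT₁ rvT₂ μ ≠ ∞ ∧ (mutualInfo rvT₁ rvT₂ μ).toReal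
      = 1 / 2 * (Real.log (p.ST₁ C).det - Real.log (p.ST₁gT₂ C).det) :=
  have := h.isGaussian
  have hr := h.regression_T₁_T₂ hSX hp
  mutualInfo_eq_log_det measurable_rvT₁ measurable_rvT₂ (measurable_act _) hr.1
    (Params.ST₁gT₂_posDef hSX hp) hr.2 (Params.ST₁_posDef hSX hp) (h.map_rvT₁ hSX hp)

/-- A conditional law given `(T₁, T₂)` is determined only up to null sets of their joint law,
whereas the exponents average it over `p(T₂|x)` at fixed `t₁`, or over `p(T₁|x)` at fixed `t₂`.
Passing through Lebesgue measure makes the Gaussian formula available there. -/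
theorem volume_prod_ac (hSX : C.SX.PosDef) (hp : p.Nondegenerate) :
    (volume : Measure (E k₁)).prod (volume : Measure (E k₂)) ≪ μ.map rvT := by
  have := h.isGaussian
  have hr := h.regression_T₂_T₁ hSX hp
  have e : μ.map rvT = μ.map rvT₁ ⊗ₘ gaussianKernel (act (p.Ξ₁ C)) (p.ST₂gT₁ C) :=
    map_prod_eq_compProd measurable_rvT₂ measurable_rvT₁ (measurable_act _)
    hr.1 hr.2
  have := isMarkovKernel_gaussianKernel (measurable_act (p.Ξ₁ C)) (p.ST₂gT₁ C)
  rw [e, h.map_rvT₁ hSX hp, ← Measure.compProd_const]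
  refine Measure.AbsolutelyContinuous.compProd
    (volume_ac_multivariateGaussian 0 (Params.ST₁_posDef hSX hp)) (ae_of_all _ fun t => ?_)
  rw [Kernel.const_apply, gaussianKernel_apply (measurable_act _)]
  exact volume_ac_multivariateGaussian _ (Params.ST₂gT₁_posDef hSX hp)

end IsGaussianModel

end Model

/-! ### Quadratic exponents -/

section Quadratic

variable {a b c k : ℕ}

theorem inner_sub_act_eq {M : Matrix (Fin a) (Fin a) ℝ} (hM : Mᵀ = M)
    (D : Matrix (Fin a) (Fin b) ℝ) (u : E a) (t : E b) :
    inner ℝ (u - act D t) (act M (u - act D t))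
      = inner ℝ u (act M u) - 2 * inner ℝ t (act (Dᵀ * M) u) + inner ℝ t (act (Dᵀ * M * D) t) := by
  have h1 : inner ℝ u (act M (act D t)) = inner ℝ t (act (Dᵀ * M) u) := by
    rw [inner_act M, hM, inner_act D, act_mul, real_inner_comm]
  have h2 : inner ℝ (act D t) (act M u) = inner ℝ t (act (Dᵀ * M) u) := by
    rw [act_mul, inner_act Dᵀ, transpose_transpose]
  have h3 : inner ℝ (act D t) (act M (act D t)) = inner ℝ t (act (Dᵀ * M * D) t) := by
    rw [act_mul, act_mul, inner_act Dᵀ, transpose_transpose]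
  rw [act_sub_vec, inner_sub_left, inner_sub_right, inner_sub_right, h1, h2, h3]
  ring

theorem integral_inner_sub_act (u : E b) {S : Matrix (Fin b) (Fin b) ℝ} (hS : S.PosSemidef)
    {M : Matrix (Fin a) (Fin a) ℝ} (hM : Mᵀ = M) (D : Matrix (Fin a) (Fin b) ℝ) (v : E a) :
    Integrable (fun s => inner ℝ (v - act D s) (act M (v - act D s))) (multivariateGaussian u S) ∧
    ∫ s, inner ℝ (v - act D s) (act M (v - act D s)) ∂(multivariateGaussian u S)
      = (Dᵀ * M * D * S).trace + inner ℝ (v - act D u) (act M (v - act D u)) := by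
  have hq : Integrable (fun s => inner ℝ s (act (Dᵀ * M * D) s)) (multivariateGaussian u S) := by
    simpa using integrable_inner_act_multivariateGaussian u 0 (S := S) (Dᵀ * M * D)
  have hl : Integrable (fun s => inner ℝ s (act (Dᵀ * M) v)) (multivariateGaussian u S) :=
    (IsGaussian.integrable_fun_id (μ := multivariateGaussian u S)).inner_const _
  have hl' : ∫ s, inner ℝ s (act (Dᵀ * M) v) ∂(multivariateGaussian u S)
      = inner ℝ u (act (Dᵀ * M) v) := by
    simp_rw [fun s : E b => real_inner_comm (act (Dᵀ * M) v) s]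
    rw [integral_inner (IsGaussian.integrable_fun_id), integral_id_multivariateGaussian]
  have hq' := integral_inner_act_multivariateGaussian u 0 hS (Dᵀ * M * D)
  simp only [sub_zero] at hq'
  have hc : Integrable (fun s => inner ℝ v (act M v) - 2 * inner ℝ s (act (Dᵀ * M) v))
      (multivariateGaussian u S) := (integrable_const _).sub (hl.const_mul 2)
  simp only [inner_sub_act_eq hM]
  refine ⟨hc.add hq, ?_⟩
  rw [integral_add hc hq, integral_sub (integrable_const _) (hl.const_mul 2), integral_const_mul,
    hl', hq']
  simp
  ring

/-- The exponent of a self-consistent equation in the Gaussian case is a quadratic function. -/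
theorem gaussian_exponent_eq (g h : ℝ) (u : E b) (w : E c) {S K : Matrix (Fin b) (Fin b) ℝ}
    {R₀ R : Matrix (Fin c) (Fin c) ℝ} (hS : S.PosDef) (hK : K.PosDef) (hR₀ : R₀.PosDef)
    (hR : R.PosDef) (X : Matrix (Fin b) (Fin a) ℝ) (V : Matrix (Fin c) (Fin a) ℝ)
    (W : Matrix (Fin c) (Fin b) ℝ) :
    ∃ r : ℝ, ∀ t : E a,
      g * (klDiv (multivariateGaussian u S) (multivariateGaussian (act X t) K)).toReal
        - h * ∫ s, (klDiv (multivariateGaussian w R₀)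
            (multivariateGaussian (act V t + act W s) R)).toReal ∂(multivariateGaussian u S)
      = -(1 / 2) * inner ℝ t (act (-(g • (Xᵀ * K⁻¹ * X)) + h • (Vᵀ * R⁻¹ * V)) t)
        + inner ℝ t (-(g • act (Xᵀ * K⁻¹) u) + h • act (Vᵀ * R⁻¹) (w - act W u)) + r := by
  -- The witness collects all terms free of `t`, including the trace that averaging over `s`
  -- contributes.
  refine ⟨g * (1 / 2 * inner ℝ u (act K⁻¹ u)
      + 1 / 2 * ((K⁻¹ * S).trace - b + Real.log K.det - Real.log S.det))
    - h * (1 / 2 * ((Wᵀ * R⁻¹ * W * S).trace + inner ℝ (w - act W u) (act R⁻¹ (w - act W u)))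
      + 1 / 2 * ((R⁻¹ * R₀).trace - c + Real.log R.det - Real.log R₀.det)), fun t => ?_⟩
  have hK' := hK.inv_transpose
  have hR' := hR.inv_transpose
  obtain ⟨hi, hI⟩ := integral_inner_sub_act u hS.posSemidef hR' W (w - act V t)
  simp only [klDiv_multivariateGaussian _ _ hS hK, klDiv_multivariateGaussian _ _ hR₀ hR,
    ← sub_sub]
  rw [integral_add (hi.const_mul _) (integrable_const _), integral_const_mul, hI,
    inner_sub_act_eq hK', sub_right_comm w, inner_sub_act_eq hR']
  simp only [integral_const, probReal_univ, one_smul, act_add, act_neg, act_smul, inner_add_right,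
    inner_neg_right, real_inner_smul_right]
  ring

end Quadratic

/-! ### One step of the self-consistent iteration at a Gaussian representation -/

namespace Params

variable {n m k₁ k₂ : ℕ} {C : SourceCov n m} {p : Params n k₁ k₂} {β γ : ℝ}

/-- The exponent of the first self-consistent equation, when `p(T₂|X)` is the Gaussian channel with
parameters `B'`, `S'`. -/
def gaussianExponent (C : SourceCov n m) (p : Params n k₁ k₂) (β γ : ℝ)
    (B' : Matrix (Fin k₂) (Fin n) ℝ) (S' : Matrix (Fin k₂) (Fin k₂) ℝ) (x : E n) (t : E k₁) : ℝ :=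
  γ / β * (klDiv (multivariateGaussian (act B' x) S')
      (multivariateGaussian (act (p.Ξ₁ C) t) (p.ST₂gT₁ C))).toReal
    - 1 / β * ∫ s, (klDiv (multivariateGaussian (act C.Θ x) C.SYgX)
        (multivariateGaussian (act (p.Ψ₁ C) t + act (p.Ψ₂ C) s) (p.SYgT C))).toReal
      ∂(multivariateGaussian (act B' x) S')

/-- The precision of `T₁` plus the quadratic coefficient of the exponent is `newPrec₁`, and the
linear coefficient is `linCoef₁` applied to `x`. The channel parameters `B'`, `S'` are free because
the second update averages over the already updated channel; `S'` affects only the constant term,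
which normalization removes. -/
theorem tilted_gaussianExponent (hSX : C.SX.PosDef) (hSYgX : C.SYgX.PosDef) (hp : p.Nondegenerate)
    (B' : Matrix (Fin k₂) (Fin n) ℝ) {S' : Matrix (Fin k₂) (Fin k₂) ℝ} (hS' : S'.PosDef) (x : E n) :
    ((p.newPrec₁ C β γ).PosDef →
      (multivariateGaussian 0 (p.ST₁ C)).tilted (p.gaussianExponent C β γ B' S' x)
        = gaussianChannel ((p.newPrec₁ C β γ)⁻¹ * p.linCoef₁ C β γ B') (p.newPrec₁ C β γ)⁻¹ x) ∧
    (¬ (p.newPrec₁ C β γ).PosDef →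
      (multivariateGaussian 0 (p.ST₁ C)).tilted (p.gaussianExponent C β γ B' S' x) = 0) := by
  have ha := ST₁_posDef hSX hp
  have hK := ST₂gT₁_posDef hSX hp
  have hR := SYgT_posDef hSX hSYgX hp
  obtain ⟨r, hr⟩ := gaussian_exponent_eq (γ / β) (1 / β) (act B' x) (act C.Θ x) hS' hK hSYgX hR
    (p.Ξ₁ C) (p.Ψ₁ C) (p.Ψ₂ C)
  have he : p.gaussianExponent C β γ B' S' x = fun t => _ := funext hr
  have hb : -((γ / β) • act ((p.Ξ₁ C)ᵀ * (p.ST₂gT₁ C)⁻¹) (act B' x))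
      + (1 / β) • act ((p.Ψ₁ C)ᵀ * (p.SYgT C)⁻¹) (act C.Θ x - act (p.Ψ₂ C) (act B' x))
      = act (p.linCoef₁ C β γ B') x := by
    simp only [linCoef₁, act_add, act_neg, act_smul, act_mul, act_sub]
  rw [hb] at he
  have hP : (p.ST₁ C)⁻¹ + (-((γ / β) • ((p.Ξ₁ C)ᵀ * (p.ST₂gT₁ C)⁻¹ * p.Ξ₁ C))
      + (1 / β) • ((p.Ψ₁ C)ᵀ * (p.SYgT C)⁻¹ * p.Ψ₁ C)) = p.newPrec₁ C β γ := by
    rw [newPrec₁]; abel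
  rw [he]
  refine ⟨fun h => ?_, fun h => ?_⟩
  · rw [tilted_multivariateGaussian ha (by rw [hP]; exact h), hP, gaussianChannel_apply, act_mul]
  · refine tilted_multivariateGaussian_of_not_posDef ha ?_ (by rw [hP]; exact h) _ _
    simp only [transpose_add, transpose_neg, transpose_smul, transpose_mul, transpose_transpose,
      hK.inv_transpose, hR.inv_transpose, Matrix.mul_assoc]

end Params

section Successor

variable {n m k₁ k₂ : ℕ}

/-- Equality almost everywhere is all that the choice of conditional laws allows, and it suffices,
since tilting ignores null sets. -/
theorem exponent₁_ae_eq {C : SourceCov n m} {p : Params n k₁ k₂} {β γ : ℝ}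
    {μ : Measure ((E n × E m) × (E k₁ × E k₂))} [IsProbabilityMeasure μ]
    (h : IsGaussianModel C p μ) (hSX : C.SX.PosDef) (hSYgX : C.SYgX.PosDef) (hp : p.Nondegenerate)
    {κ₂ : Kernel (E n) (E k₂)} {B' : Matrix (Fin k₂) (Fin n) ℝ} {S' : Matrix (Fin k₂) (Fin k₂) ℝ}
    (hS' : S'.PosDef) {x : E n} (hκ₂ : κ₂ x = multivariateGaussian (act B' x) S')
    (hx : condDistrib rvY rvX μ x = multivariateGaussian (act C.Θ x) C.SYgX) :
    exponent₁ β γ μ κ₂ x =ᵐ[μ.map rvT₁] p.gaussianExponent C β γ B' S' x := by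
  rw [h.map_rvT₁ hSX hp]
  have hac := multivariateGaussian_ac_volume 0 (Params.ST₁_posDef hSX hp)
  have h1 := h.condDistrib_T₂_T₁ hSX hp
  rw [h.map_rvT₁ hSX hp] at h1
  have h2 := Measure.ae_ae_of_ae_prod
    ((h.volume_prod_ac hSX hp).ae_le (h.condDistrib_Y_T hSX hSYgX hp))
  filter_upwards [h1, hac.ae_le h2] with t ht1 ht2
  rw [exponent₁, Params.gaussianExponent, ht1, hκ₂, hx]
  congr 2
  refine integral_congr_ae ?_
  filter_upwards [(multivariateGaussian_ac_volume (act B' x) hS').ae_le ht2] with s hs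
  rw [hs]

theorem exponent₂_ae_eq {C : SourceCov n m} {p : Params n k₁ k₂} {lam γ : ℝ}
    {μ : Measure ((E n × E m) × (E k₁ × E k₂))} [IsProbabilityMeasure μ]
    (h : IsGaussianModel C p μ) (hSX : C.SX.PosDef) (hSYgX : C.SYgX.PosDef) (hp : p.Nondegenerate)
    {κ₁ : Kernel (E n) (E k₁)} {A' : Matrix (Fin k₁) (Fin n) ℝ} {S' : Matrix (Fin k₁) (Fin k₁) ℝ}
    (hS' : S'.PosDef) {x : E n} (hκ₁ : κ₁ x = multivariateGaussian (act A' x) S')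
    (hx : condDistrib rvY rvX μ x = multivariateGaussian (act C.Θ x) C.SYgX) :
    exponent₂ lam γ μ κ₁ x =ᵐ[μ.map rvT₂] p.swap.gaussianExponent C lam γ A' S' x := by
  rw [h.map_rvT₂ hSX hp]
  have hac := multivariateGaussian_ac_volume 0 (Params.ST₂_posDef hSX hp)
  have h1 := h.condDistrib_T₁_T₂ hSX hp
  rw [h.map_rvT₂ hSX hp] at h1
  have h2 := Measure.ae_ae_of_ae_prod ((Measure.measurePreserving_swap
    (μ := (volume : Measure (E k₂))) (ν := (volume : Measure (E k₁)))).quasiMeasurePreserving.ae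
    ((h.volume_prod_ac hSX hp).ae_le (h.condDistrib_Y_T hSX hSYgX hp)))
  filter_upwards [h1, hac.ae_le h2] with t ht1 ht2
  rw [exponent₂, Params.gaussianExponent, ht1, hκ₁, hx, Params.SYgT_swap]
  congr 2
  refine integral_congr_ae ?_
  filter_upwards [(multivariateGaussian_ac_volume (act A' x) hS').ae_le ht2] with s hs
  rw [Prod.swap_prod_mk] at hs
  rw [hs, add_comm]
  rfl

theorem map_rvX_jointLaw (ν : Measure (E n × E m)) [IsProbabilityMeasure ν]
    (κ₁ : Kernel (E n) (E k₁)) (κ₂ : Kernel (E n) (E k₂)) [IsMarkovKernel κ₁] [IsMarkovKernel κ₂] :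
    (jointLaw ν κ₁ κ₂).map rvX = ν.map Prod.fst := by
  have h : (jointLaw ν κ₁ κ₂).map Prod.fst = ν := Measure.fst_compProd _ _
  conv_rhs => rw [← h]
  rw [Measure.map_map measurable_fst measurable_fst]
  rfl

theorem jointLaw_congr {ν : Measure (E n × E m)} [IsProbabilityMeasure ν]
    {κ₁ κ₁' : Kernel (E n) (E k₁)} {κ₂ κ₂' : Kernel (E n) (E k₂)} [IsMarkovKernel κ₁]
    [IsMarkovKernel κ₁'] [IsMarkovKernel κ₂] [IsMarkovKernel κ₂']
    (h₁ : κ₁ =ᵐ[ν.map Prod.fst] κ₁') (h₂ : κ₂ =ᵐ[ν.map Prod.fst] κ₂') :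
    jointLaw ν κ₁ κ₂ = jointLaw ν κ₁' κ₂' := by
  refine Measure.compProd_congr ?_
  filter_upwards [ae_of_ae_map measurable_fst.aemeasurable h₁,
    ae_of_ae_map measurable_fst.aemeasurable h₂] with z hz₁ hz₂
  rw [Kernel.comap_apply, Kernel.comap_apply, Kernel.prod_apply, Kernel.prod_apply, hz₁, hz₂]

/-- From a Gaussian representation, one step of the self-consistent iteration is one step of the
matrix iteration. -/
theorem isSuccessor_iff {ν : Measure (E n × E m)} [IsProbabilityMeasure ν] {C : SourceCov n m}
    (hν : IsCenteredGaussian ν C) (hSX : C.SX.PosDef) (hSYgX : C.SYgX.PosDef) {β lam γ : ℝ}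
    {p : Params n k₁ k₂} (hp : p.Nondegenerate)
    {κ₁ κ₁' : Kernel (E n) (E k₁)} {κ₂ κ₂' : Kernel (E n) (E k₂)} [IsMarkovKernel κ₁]
    [IsMarkovKernel κ₁'] [IsMarkovKernel κ₂] [IsMarkovKernel κ₂']
    (h₁ : κ₁ =ᵐ[ν.map Prod.fst] p.channel₁) (h₂ : κ₂ =ᵐ[ν.map Prod.fst] p.channel₂) :
    IsSuccessor ν β lam γ κ₁ κ₂ κ₁' κ₂' ↔ p.Feasible C β lam γ ∧
      κ₁' =ᵐ[ν.map Prod.fst] (p.next C β lam γ).channel₁ ∧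
      κ₂' =ᵐ[ν.map Prod.fst] (p.next C β lam γ).channel₂ := by
  have hμ : IsGaussianModel C p (jointLaw ν κ₁ κ₂) := by
    rw [jointLaw_congr h₁ h₂]
    exact isGaussianModel_jointLaw hν hp
  have hYX := hμ.condDistrib_Y_X hSX hSYgX
  rw [map_rvX_jointLaw] at hYX
  have : IsProbabilityMeasure (ν.map Prod.fst) :=
    Measure.isProbabilityMeasure_map measurable_fst.aemeasurable
  have e₁ : ∀ᵐ x ∂(ν.map Prod.fst),
      ((jointLaw ν κ₁ κ₂).map rvT₁).tilted (exponent₁ β γ (jointLaw ν κ₁ κ₂) κ₂ x)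
      = (multivariateGaussian 0 (p.ST₁ C)).tilted (p.gaussianExponent C β γ p.B p.S₂ x) := by
    filter_upwards [hYX, h₂] with x hx hx₂
    rw [Params.channel₂, gaussianChannel_apply] at hx₂
    rw [tilted_congr (exponent₁_ae_eq hμ hSX hSYgX hp hp.2 hx₂ hx), hμ.map_rvT₁ hSX hp]
  have e₂ : (p.newPrec₁ C β γ).PosDef → κ₁' =ᵐ[ν.map Prod.fst] (p.next C β lam γ).channel₁ →
      ∀ᵐ x ∂(ν.map Prod.fst),
      ((jointLaw ν κ₁ κ₂).map rvT₂).tilted (exponent₂ lam γ (jointLaw ν κ₁ κ₂) κ₁' x)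
      = (multivariateGaussian 0 (p.swap.ST₁ C)).tilted
        (p.swap.gaussianExponent C lam γ (p.newA C β γ) (p.newPrec₁ C β γ)⁻¹ x) := by
    intro hP h
    filter_upwards [hYX, h] with x hx hx₁
    rw [Params.channel₁, gaussianChannel_apply] at hx₁
    rw [tilted_congr (exponent₂_ae_eq hμ hSX hSYgX hp hP.inv hx₁ hx), hμ.map_rvT₂ hSX hp,
      Params.ST₁_swap]
    rfl
  have key₁ : (∀ᵐ x ∂(ν.map Prod.fst), κ₁' x =
      ((jointLaw ν κ₁ κ₂).map rvT₁).tilted (exponent₁ β γ (jointLaw ν κ₁ κ₂) κ₂ x)) ↔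
      (p.newPrec₁ C β γ).PosDef ∧ κ₁' =ᵐ[ν.map Prod.fst] (p.next C β lam γ).channel₁ := by
    constructor
    · intro h
      -- Otherwise the tilted measure would be zero, which a Markov kernel never takes as a value.
      have hP : (p.newPrec₁ C β γ).PosDef := by
        by_contra hP
        obtain ⟨x, hx, hx'⟩ := (h.and e₁).exists
        rw [hx', (Params.tilted_gaussianExponent hSX hSYgX hp p.B hp.2 x).2 hP] at hx
        exact IsProbabilityMeasure.ne_zero (κ₁' x) hx
      refine ⟨hP, ?_⟩
      filter_upwards [h, e₁] with x hx hx'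
      rw [hx, hx', (Params.tilted_gaussianExponent hSX hSYgX hp p.B hp.2 x).1 hP]
      rfl
    · rintro ⟨hP, h⟩
      filter_upwards [h, e₁] with x hx hx'
      rw [hx, hx', (Params.tilted_gaussianExponent hSX hSYgX hp p.B hp.2 x).1 hP]
      rfl
  have hch : (p.next C β lam γ).channel₂ = gaussianChannel
      ((p.swap.newPrec₁ C lam γ)⁻¹ * p.swap.linCoef₁ C lam γ (p.newA C β γ))
      (p.swap.newPrec₁ C lam γ)⁻¹ := by
    rw [← Params.newPrec₂_eq_swap, ← Params.newB_eq]
    rfl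
  -- The second equation averages over `κ₁'`, so it can be evaluated only once the first has shown
  -- that `κ₁'` is Gaussian.
  have key₂ : (p.newPrec₁ C β γ).PosDef → κ₁' =ᵐ[ν.map Prod.fst] (p.next C β lam γ).channel₁ →
      ((∀ᵐ x ∂(ν.map Prod.fst), κ₂' x =
      ((jointLaw ν κ₁ κ₂).map rvT₂).tilted (exponent₂ lam γ (jointLaw ν κ₁ κ₂) κ₁' x)) ↔
      (p.newPrec₂ C lam γ).PosDef ∧ κ₂' =ᵐ[ν.map Prod.fst] (p.next C β lam γ).channel₂) := by
    intro hP₁ hκ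
    have e₂ := e₂ hP₁ hκ
    have ht := Params.tilted_gaussianExponent (β := lam) (γ := γ) hSX hSYgX hp.swap (p.newA C β γ)
      hP₁.inv
    rw [Params.newPrec₂_eq_swap, hch]
    constructor
    · intro h
      have hP : (p.swap.newPrec₁ C lam γ).PosDef := by
        by_contra hP
        obtain ⟨x, hx, hx'⟩ := (h.and e₂).exists
        rw [hx', (ht x).2 hP] at hx
        exact IsProbabilityMeasure.ne_zero (κ₂' x) hx
      refine ⟨hP, ?_⟩
      filter_upwards [h, e₂] with x hx hx'
      rw [hx, hx', (ht x).1 hP]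
    · rintro ⟨hP, h⟩
      filter_upwards [h, e₂] with x hx hx'
      rw [hx, hx', (ht x).1 hP]
  rw [IsSuccessor, key₁, Params.Feasible]
  constructor
  · rintro ⟨⟨hP₁, hκ₁⟩, h⟩
    obtain ⟨hP₂, hκ₂⟩ := (key₂ hP₁ hκ₁).1 h
    exact ⟨⟨hP₁, hP₂⟩, hκ₁, hκ₂⟩
  · rintro ⟨⟨hP₁, hP₂⟩, hκ₁, hκ₂⟩
    exact ⟨⟨hP₁, hκ₁⟩, (key₂ hP₁ hκ₁).2 ⟨hP₂, hκ₂⟩⟩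

end Successor

/-! ### Stationarity of the Lagrangian -/

-- With `R` the square root of `S⁻¹`, the trace equals that of the positive semidefinite matrix `R V
-- R`.
open scoped MatrixOrder in
theorem trace_inv_mul_nonneg {k : ℕ} {S V : Matrix (Fin k) (Fin k) ℝ} (hS : S.PosDef)
    (hV : V.PosSemidef) : 0 ≤ (S⁻¹ * V).trace := by
  have hS' := hS.inv.posSemidef
  set R := CFC.sqrt S⁻¹
  have hRR : R * R = S⁻¹ := CFC.sqrt_mul_sqrt_self _ hS'.nonneg
  have hRT : Rᵀ = R := transpose_eq_of_isHermitian (CFC.sqrt_nonneg S⁻¹).posSemidef.1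
  have h := (posSemidef_mul_mul_transpose hV R).trace_nonneg
  rwa [hRT, trace_mul_comm, ← Matrix.mul_assoc, hRR] at h

/-- Tangent bound with a discarded excess: `V'` will be the loss from using regression coefficients
that are optimal for other parameters. -/
theorem log_det_le_of_add_eq {k : ℕ} {K S V V' : Matrix (Fin k) (Fin k) ℝ} (hK : K.PosDef)
    (hS : S.PosDef) (hV' : V'.PosSemidef) (h : K + V' = S + V) :
    Real.log K.det ≤ Real.log S.det + (S⁻¹ * V).trace := by
  have h1 := log_det_le hS hK
  have h2 := trace_inv_mul_nonneg hS hV'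
  have h3 : K = S + V - V' := by rw [← h, add_sub_cancel_right]
  rw [h3, Matrix.mul_sub, Matrix.mul_add, hS.inv_mul, trace_sub, trace_add, trace_one,
    Fintype.card_fin, ← h3] at h1
  linarith

/-- A continuous first-order coefficient vanishes at a minimum. -/
theorem eq_zero_of_forall_mul_nonneg {φ : ℝ → ℝ} (hφ : Continuous φ)
    (h : ∀ ε, 0 ≤ ε * φ ε) : φ 0 = 0 := by
  have h0 : Tendsto φ (nhds 0) (nhds (φ 0)) := hφ.tendsto 0
  refine le_antisymm ?_ ?_
  · refine le_of_tendsto (h0.mono_left nhdsWithin_le_nhds :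
      Tendsto φ (nhdsWithin 0 (Set.Iio 0)) _) ?_
    filter_upwards [self_mem_nhdsWithin] with ε (hε : ε < 0)
    by_contra! hc
    linarith [h ε, mul_neg_of_neg_of_pos hε hc]
  · refine ge_of_tendsto (h0.mono_left nhdsWithin_le_nhds :
      Tendsto φ (nhdsWithin 0 (Set.Ioi 0)) _) ?_
    filter_upwards [self_mem_nhdsWithin] with ε (hε : 0 < ε)
    by_contra! hc
    linarith [h ε, mul_neg_of_pos_of_neg hε hc]

theorem continuous_matrix_inv {k : ℕ} {S : ℝ → Matrix (Fin k) (Fin k) ℝ} (hS : Continuous S)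
    (h : ∀ ε, (S ε).PosDef) : Continuous fun ε => (S ε)⁻¹ := by
  refine continuous_iff_continuousAt.2 fun ε => ?_
  refine ContinuousAt.comp (f := S) (g := fun M => M⁻¹) (continuousAt_matrix_inv _ ?_)
    hS.continuousAt
  rw [Ring.inverse_eq_inv']
  exact continuousAt_inv₀ (h ε).det_pos.ne'

theorem trace_mul_add_transpose {k : ℕ} {S V : Matrix (Fin k) (Fin k) ℝ} (hS : Sᵀ = S) :
    (S * (V + Vᵀ)).trace = 2 * (S * V).trace := by
  rw [Matrix.mul_add, trace_add, ← trace_transpose (S * Vᵀ), transpose_mul, transpose_transpose, hS,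
    trace_mul_comm V S]
  ring

namespace Params

variable {n m k₁ k₂ l : ℕ} {C : SourceCov n m} {p : Params n k₁ k₂} {β γ : ℝ}

/-- Replacement of the first coupling matrix by `A + ε D`. -/
def perturb (p : Params n k₁ k₂) (D : Matrix (Fin k₁) (Fin n) ℝ) (ε : ℝ) : Params n k₁ k₂ :=
  { p with A := p.A + ε • D }

/-- The part of the Lagrangian of Gaussian representations that depends on `A`. -/
def logDetObjective (C : SourceCov n m) (β γ : ℝ) (p : Params n k₁ k₂) : ℝ :=
  Real.log (p.SYgT C).det + β * Real.log (p.ST₁ C).det - γ * Real.log (p.ST₂gT₁ C).det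

theorem ST₁_perturb (D : Matrix (Fin k₁) (Fin n) ℝ) (ε : ℝ) (hX : C.SXᵀ = C.SX) :
    (p.perturb D ε).ST₁ C = p.ST₁ C
      + ε • (p.A * C.SX * Dᵀ + (p.A * C.SX * Dᵀ)ᵀ + ε • (D * C.SX * Dᵀ)) := by
  simp only [ST₁, perturb, transpose_add, transpose_smul, Matrix.add_mul, Matrix.mul_add,
    Matrix.smul_mul, Matrix.mul_smul, smul_add, transpose_mul, transpose_transpose, hX,
    Matrix.mul_assoc]
  abel

/-- Solved for the unperturbed matrix, unlike `errCov_perturb`: the term it serves enters the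
objective with a negative sign, so the roles of the two points are exchanged. -/
theorem errCov₁_perturb (N : Matrix (Fin l) (Fin n) ℝ) (M : Matrix (Fin l) (Fin k₁) ℝ)
    (D : Matrix (Fin k₁) (Fin n) ℝ) (ε : ℝ) (hX : C.SXᵀ = C.SX) :
    errCov₁ C p N M = errCov₁ C (p.perturb D ε) N M
      + ε • ((N - M * p.A) * C.SX * (M * D)ᵀ + ((N - M * p.A) * C.SX * (M * D)ᵀ)ᵀ
        - ε • (M * D * C.SX * (M * D)ᵀ)) := by
  have h : N - M * (p.perturb D ε).A = N - M * p.A - ε • (M * D) := by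
    simp only [perturb, Matrix.mul_add, Matrix.mul_smul]
    abel
  rw [errCov₁, errCov₁, h, show (p.perturb D ε).S₁ = p.S₁ from rfl]
  generalize N - M * p.A = W
  generalize M * D = D
  simp only [transpose_sub, transpose_smul, Matrix.sub_mul, Matrix.mul_sub,
    Matrix.smul_mul, Matrix.mul_smul, smul_add, smul_sub, transpose_mul, transpose_transpose, hX,
    Matrix.mul_assoc]
  abel

theorem errCov_perturb (N : Matrix (Fin l) (Fin n) ℝ) (M₁ : Matrix (Fin l) (Fin k₁) ℝ)
    (M₂ : Matrix (Fin l) (Fin k₂) ℝ) (D : Matrix (Fin k₁) (Fin n) ℝ) (ε : ℝ)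
    (hX : C.SXᵀ = C.SX) :
    errCov C (p.perturb D ε) N M₁ M₂ = errCov C p N M₁ M₂
      + ε • (-((N - M₁ * p.A - M₂ * p.B) * C.SX * (M₁ * D)ᵀ
          + ((N - M₁ * p.A - M₂ * p.B) * C.SX * (M₁ * D)ᵀ)ᵀ)
        + ε • (M₁ * D * C.SX * (M₁ * D)ᵀ)) := by
  have h : N - M₁ * (p.perturb D ε).A - M₂ * p.B = N - M₁ * p.A - M₂ * p.B - ε • (M₁ * D) := by
    simp only [perturb, Matrix.mul_add, Matrix.mul_smul]
    abel
  rw [errCov, errCov, show (p.perturb D ε).S₁ = p.S₁ from rfl,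
    show (p.perturb D ε).S₂ = p.S₂ from rfl, show (p.perturb D ε).B = p.B from rfl, h]
  generalize N - M₁ * p.A - M₂ * p.B = W
  generalize M₁ * D = D
  simp only [transpose_sub, transpose_smul, Matrix.sub_mul, Matrix.mul_sub,
    Matrix.smul_mul, Matrix.mul_smul, smul_add, smul_sub, smul_neg, transpose_mul,
    transpose_transpose, hX,
    Matrix.mul_assoc]
  abel

theorem Nondegenerate.perturb (hp : p.Nondegenerate) (D : Matrix (Fin k₁) (Fin n) ℝ) (ε : ℝ) :
    (p.perturb D ε).Nondegenerate := hp

theorem perturb_zero (D : Matrix (Fin k₁) (Fin n) ℝ) : p.perturb D 0 = p := by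
  simp [Params.perturb]

/-- The derivative of `logDetObjective` with respect to `A` vanishes at a minimum. -/
theorem newPrec₁_mul_A (hSX : C.SX.PosDef) (hSYgX : C.SYgX.PosDef) (hp : p.Nondegenerate)
    (hβ : 0 < β) (hγ : 0 ≤ γ)
    (hmin : ∀ D ε, logDetObjective C β γ p ≤ logDetObjective C β γ (p.perturb D ε)) :
    p.newPrec₁ C β γ * p.A = p.linCoef₁ C β γ p.B := by
  have hX := hSX.transpose_eq
  set W := C.Θ - p.Ψ₁ C * p.A - p.Ψ₂ C * p.B with hW
  -- Half the gradient of the objective in `A`, for the trace pairing.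
  set Z := β • ((p.ST₁ C)⁻¹ * p.A * C.SX)
    + γ • ((p.Ξ₁ C)ᵀ * (p.ST₂gT₁ C)⁻¹ * (p.B - p.Ξ₁ C * p.A) * C.SX)
    - (p.Ψ₁ C)ᵀ * (p.SYgT C)⁻¹ * W * C.SX with hZ
  have hST := ST₁_posDef hSX hp
  have hK := ST₂gT₁_posDef hSX hp
  have hR := SYgT_posDef hSX hSYgX hp
  have hD : ∀ D : Matrix (Fin k₁) (Fin n) ℝ, (Z * Dᵀ).trace = 0 := by
    intro D
    set q := fun ε => p.perturb D ε with hq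
    have hqn : ∀ ε, (q ε).Nondegenerate := fun ε => hp.perturb D ε
    have hqA : Continuous fun ε => (q ε).A := by
      simp only [hq, Params.perturb]
      fun_prop
    have hqST : Continuous fun ε => (q ε).ST₁ C := by
      simp only [ST₁]
      exact ((hqA.matrix_mul continuous_const).matrix_mul hqA.matrix_transpose).add
        continuous_const
    have hqSTi := continuous_matrix_inv hqST fun ε => ST₁_posDef hSX (hqn ε)
    have hqΞ : Continuous fun ε => (q ε).Ξ₁ C := by
      simp only [Ξ₁]
      exact ((continuous_const.matrix_mul continuous_const).matrix_mul
        hqA.matrix_transpose).matrix_mul hqSTi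
    have hqK : Continuous fun ε => (q ε).ST₂gT₁ C := by
      simp only [ST₂gT₁_eq, ST₂]
      exact (continuous_const (y := p.B * C.SX * p.Bᵀ + p.S₂)).sub (hqΞ.matrix_mul
        ((hqA.matrix_mul (continuous_const (y := C.SX))).matrix_mul
          (continuous_const (y := p.Bᵀ))))
    have hqKi := continuous_matrix_inv hqK fun ε => ST₂gT₁_posDef hSX (hqn ε)
    let VS : ℝ → Matrix (Fin k₁) (Fin k₁) ℝ := fun ε =>
      p.A * C.SX * Dᵀ + (p.A * C.SX * Dᵀ)ᵀ + ε • (D * C.SX * Dᵀ)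
    let VR : ℝ → Matrix (Fin m) (Fin m) ℝ := fun ε =>
      -(W * C.SX * (p.Ψ₁ C * D)ᵀ + (W * C.SX * (p.Ψ₁ C * D)ᵀ)ᵀ)
        + ε • (p.Ψ₁ C * D * C.SX * (p.Ψ₁ C * D)ᵀ)
    let VK : ℝ → Matrix (Fin k₂) (Fin k₂) ℝ := fun ε =>
      (p.B - (q ε).Ξ₁ C * p.A) * C.SX * ((q ε).Ξ₁ C * D)ᵀ
        + ((p.B - (q ε).Ξ₁ C * p.A) * C.SX * ((q ε).Ξ₁ C * D)ᵀ)ᵀ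
        - ε • ((q ε).Ξ₁ C * D * C.SX * ((q ε).Ξ₁ C * D)ᵀ)
    -- `ε * φ ε` bounds the increment of the objective from above.
    let φ : ℝ → ℝ := fun ε => ((p.SYgT C)⁻¹ * VR ε).trace + β * ((p.ST₁ C)⁻¹ * VS ε).trace
      + γ * (((q ε).ST₂gT₁ C)⁻¹ * VK ε).trace
    have hφ : Continuous φ := by
      have hW : Continuous fun ε => p.B - (q ε).Ξ₁ C * p.A :=
        continuous_const.sub (hqΞ.matrix_mul continuous_const)
      have hV : Continuous fun ε => (q ε).Ξ₁ C * D := hqΞ.matrix_mul continuous_const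
      have hWV := (hW.matrix_mul (continuous_const (y := C.SX))).matrix_mul hV.matrix_transpose
      have hVK : Continuous VK := (hWV.add hWV.matrix_transpose).sub (continuous_id.smul
        ((hV.matrix_mul continuous_const).matrix_mul hV.matrix_transpose))
      have hVS : Continuous VS := by fun_prop
      have hVR : Continuous VR := by fun_prop
      exact ((continuous_const.matrix_mul hVR).matrix_trace.add
        (continuous_const.mul (continuous_const.matrix_mul hVS).matrix_trace)).add
        (continuous_const.mul (hqKi.matrix_mul hVK).matrix_trace)
    have hineq : ∀ ε, 0 ≤ ε * φ ε := by
      intro ε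
      have h0 := hmin D ε
      have h1 : Real.log ((q ε).ST₁ C).det
          ≤ Real.log (p.ST₁ C).det + ((p.ST₁ C)⁻¹ * (ε • VS ε)).trace :=
        log_det_le_of_add_eq (ST₁_posDef hSX (hqn ε)) hST PosSemidef.zero
          (by rw [add_zero, ST₁_perturb D ε hX])
      -- The old coefficients `Ψ₁`, `Ψ₂` serve as a suboptimal estimator for the perturbed pair, so
      -- their variation never enters.
      have h2 : Real.log ((q ε).SYgT C).det
          ≤ Real.log (p.SYgT C).det + ((p.SYgT C)⁻¹ * (ε • VR ε)).trace := by
        refine log_det_le_of_add_eq (SYgT_posDef hSX hSYgX (hqn ε)) hR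
          (errCov_posSemidef hSX (hqn ε) 0 (p.Ψ₁ C - (q ε).Ψ₁ C) (p.Ψ₂ C - (q ε).Ψ₂ C)) ?_
        rw [← SYgT_add_errCov hSX (hqn ε), errCov_perturb _ _ _ _ _ hX, SYgT_eq_errCov hSX hp]
        abel
      -- Because of the factor `-γ`, the tangent is taken at the perturbed point and the perturbed
      -- `Ξ₁` is the suboptimal estimator for the original pair. This is why `VK` involves `q ε` and
      -- continuity in `ε` has to be established.
      have h3 : Real.log (p.ST₂gT₁ C).det ≤ Real.log ((q ε).ST₂gT₁ C).det
          + (((q ε).ST₂gT₁ C)⁻¹ * (ε • VK ε)).trace := by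
        refine log_det_le_of_add_eq hK (ST₂gT₁_posDef hSX (hqn ε))
          (errCov₁_posSemidef hSX hp 0 ((q ε).Ξ₁ C - p.Ξ₁ C)) ?_
        rw [← ST₂gT₁_add_errCov₁ hSX hp, ST₂gT₁_eq_errCov₁ hSX (hqn ε),
          errCov₁_perturb _ _ D ε hX]
        change _ = errCov₁ C (p.perturb D ε) p.B ((q ε).Ξ₁ C) + p.S₂ + _
        abel
      simp only [logDetObjective] at h0
      rw [Matrix.mul_smul, trace_smul, smul_eq_mul] at h1 h2 h3
      have h1' := mul_le_mul_of_nonneg_left h1 hβ.le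
      have h3' := mul_le_mul_of_nonneg_left h3 hγ
      change 0 ≤ ε * (_ + β * _ + γ * _)
      linarith
    have h0 : φ 0 = 0 := eq_zero_of_forall_mul_nonneg hφ hineq
    have e : φ 0 = 2 * (Z * Dᵀ).trace := by
      have hq0 : q 0 = p := perturb_zero D
      simp only [φ, VS, VR, VK, zero_smul, add_zero, sub_zero, hq0, Matrix.mul_neg, trace_neg]
      rw [trace_mul_add_transpose hST.inv_transpose, trace_mul_add_transpose hR.inv_transpose,
        trace_mul_add_transpose hK.inv_transpose, hZ]
      simp only [Matrix.add_mul, Matrix.sub_mul _ _ Dᵀ, trace_add, trace_sub, Matrix.smul_mul,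
        trace_smul, smul_eq_mul, transpose_mul]
      have c : ∀ {a : ℕ} (S : Matrix (Fin a) (Fin a) ℝ) (V : Matrix (Fin a) (Fin n) ℝ)
          (M : Matrix (Fin a) (Fin k₁) ℝ), (S * (V * C.SX * (Dᵀ * Mᵀ))).trace
          = (Mᵀ * S * V * C.SX * Dᵀ).trace := by
        intro a S V M
        rw [trace_mul_comm]
        rw [show V * C.SX * (Dᵀ * Mᵀ) * S = (V * C.SX * Dᵀ) * (Mᵀ * S) by
          simp only [Matrix.mul_assoc], trace_mul_comm]
        simp only [Matrix.mul_assoc]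
      rw [c, c, show (p.ST₁ C)⁻¹ * (p.A * C.SX * Dᵀ) = (p.ST₁ C)⁻¹ * p.A * C.SX * Dᵀ by
        simp only [Matrix.mul_assoc]]
      ring
    linarith
  have hZ0 : Z = 0 := by
    -- With `D = Z` the trace is the sum of the squares of the entries of `Z`.
    have := hD Z
    rwa [← conjTranspose_eq_transpose_of_trivial, trace_mul_conjTranspose_self_eq_zero_iff] at this
  have e : Z = β • ((p.newPrec₁ C β γ * p.A - p.linCoef₁ C β γ p.B) * C.SX) := by
    have hβ' : β * (γ / β) = γ := by field_simp
    have hβ'' : β * (1 / β) = 1 := by field_simp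
    simp only [hZ, hW, newPrec₁, linCoef₁, Matrix.add_mul, Matrix.sub_mul, Matrix.mul_sub,
      smul_add, smul_sub, Matrix.smul_mul, Matrix.neg_mul, smul_neg, smul_smul, hβ', hβ'', one_smul,
      Matrix.mul_assoc]
    abel
  rw [hZ0] at e
  have e' := congrArg (fun M => M * C.SX⁻¹) ((smul_eq_zero.1 e.symm).resolve_left hβ.ne')
  simp only [Matrix.mul_assoc, hSX.mul_inv, Matrix.mul_one, Matrix.zero_mul] at e'
  exact sub_eq_zero.1 e'

/-- Stationarity in `A` alone suffices: inserted into `newPrec₁_mul_ST₁`, it cancels the terms with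
`A Σ_X Aᵀ` and leaves `newPrec₁ * S₁ = 1`. -/
theorem newPrec₁_eq_inv (hSX : C.SX.PosDef) (hSYgX : C.SYgX.PosDef) (hp : p.Nondegenerate)
    (hβ : 0 < β) (hγ : 0 ≤ γ)
    (hmin : ∀ D ε, logDetObjective C β γ p ≤ logDetObjective C β γ (p.perturb D ε)) :
    p.newPrec₁ C β γ = p.S₁⁻¹ := by
  have h := newPrec₁_mul_ST₁ (β := β) (γ := γ) hSX hp
  rw [← newPrec₁_mul_A hSX hSYgX hp hβ hγ hmin, ST₁, Matrix.mul_add, add_comm] at h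
  simp only [Matrix.mul_assoc] at h
  exact (Matrix.inv_eq_left_inv (add_right_cancel h)).symm

theorem lagrangian_eq {ν : Measure (E n × E m)} [IsProbabilityMeasure ν]
    (hν : IsCenteredGaussian ν C) (hSX : C.SX.PosDef) (hSYgX : C.SYgX.PosDef) (lam : ℝ)
    (hp : p.Nondegenerate) :
    2 * lagrangian ν β lam γ p.channel₁ p.channel₂
      = Real.log (p.SYgT C).det - Real.log C.SY.det
        + β * (Real.log (p.ST₁ C).det - Real.log p.S₁.det)
        + lam * (Real.log (p.ST₂ C).det - Real.log p.S₂.det)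
        + γ * (Real.log (p.ST₁ C).det - Real.log (p.ST₁gT₂ C).det) := by
  have h := isGaussianModel_jointLaw hν hp
  rw [lagrangian, (h.mutualInfo_Y_T hSX hSYgX hp).2, (h.mutualInfo_T₁_X hSX hp).2,
    (h.mutualInfo_T₂_X hSX hp).2, (h.mutualInfo_T₁_T₂ hSX hp).2]
  ring

/-- Minimizing Gaussian representations are fixed points of the matrix iteration. -/
theorem feasible_and_next_eq_of_minimizer {ν : Measure (E n × E m)} [IsProbabilityMeasure ν]
    (hν : IsCenteredGaussian ν C) (hSX : C.SX.PosDef) (hSYgX : C.SYgX.PosDef) {lam : ℝ}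
    (hβ : 0 < β) (hlam : 0 < lam) (hγ : 0 ≤ γ) (hp : p.Nondegenerate)
    (hmin : ∀ q : Params n k₁ k₂, q.Nondegenerate →
      lagrangian ν β lam γ p.channel₁ p.channel₂ ≤ lagrangian ν β lam γ q.channel₁ q.channel₂) :
    p.Feasible C β lam γ ∧ p.next C β lam γ = p := by
  have h₁ : ∀ D ε, logDetObjective C β γ p ≤ logDetObjective C β γ (p.perturb D ε) := by
    intro D ε
    have hq := hp.perturb D ε
    have h := hmin _ hq
    have e := lagrangian_eq (β := β) (γ := γ) hν hSX hSYgX lam hp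
    have e' := lagrangian_eq (β := β) (γ := γ) hν hSX hSYgX lam hq
    -- Rewrites `I(T₁; T₂)` through `Σ_{T₂}` and `Σ_{T₂|T₁}`, of which only the latter depends on
    -- `A`.
    have i := congrArg (γ * ·) (log_det_ST_eq hSX hp)
    have i' := congrArg (γ * ·) (log_det_ST_eq hSX hq)
    have c₁ : (p.perturb D ε).S₁ = p.S₁ := rfl
    have c₂ : (p.perturb D ε).S₂ = p.S₂ := rfl
    have c₃ : (p.perturb D ε).ST₂ C = p.ST₂ C := rfl
    simp only [c₁, c₂, c₃] at e' i'
    simp only [logDetObjective]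
    linarith
  -- For variations of `B` the formula for `I(T₁; T₂)` in `lagrangian_eq` already has the right
  -- form, since `Σ_{T₁}` does not depend on `B`.
  have h₂ : ∀ D ε, logDetObjective C lam γ p.swap
      ≤ logDetObjective C lam γ (p.swap.perturb D ε) := by
    intro D ε
    have hq := hp.swap.perturb D ε
    have h := hmin _ hq.swap
    have e := lagrangian_eq (β := β) (γ := γ) hν hSX hSYgX lam hp
    have e' := lagrangian_eq (β := β) (γ := γ) hν hSX hSYgX lam hq.swap
    have c₁ : (p.swap.perturb D ε).swap.S₁ = p.S₁ := rfl
    have c₂ : (p.swap.perturb D ε).swap.S₂ = p.S₂ := rfl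
    have c₃ : (p.swap.perturb D ε).swap.ST₁ C = p.ST₁ C := rfl
    rw [SYgT_swap, c₁, c₂, c₃, ST₂_swap, ST₁gT₂_swap] at e'
    simp only [logDetObjective]
    rw [SYgT_swap, ST₁_swap, ST₂gT₁_swap]
    linarith
  have hP₁ := newPrec₁_eq_inv hSX hSYgX hp hβ hγ h₁
  have hP₂ := newPrec₁_eq_inv hSX hSYgX hp.swap hlam hγ h₂
  rw [← newPrec₂_eq_swap, show p.swap.S₁ = p.S₂ from rfl] at hP₂
  have hi : ∀ {k l : ℕ} {S : Matrix (Fin k) (Fin k) ℝ} {M M' : Matrix (Fin k) (Fin l) ℝ},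
      S.PosDef → S⁻¹ * M = M' → S⁻¹⁻¹ * M' = M := by
    rintro k l S M _ hS rfl
    rw [← Matrix.mul_assoc, hS.inv.inv_mul, Matrix.one_mul]
  have hA : p.newA C β γ = p.A := by
    rw [newA_eq, ← newPrec₁_mul_A hSX hSYgX hp hβ hγ h₁, hP₁]
    exact hi hp.1 rfl
  have hB : p.newB C β lam γ = p.B := by
    have h := newPrec₁_mul_A hSX hSYgX hp.swap hlam hγ h₂
    rw [← newPrec₂_eq_swap, hP₂] at h
    -- The update of `B` uses the new `A`; by `hA` this is the old one, so stationarity in `B`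
    -- applies.
    rw [newB_eq, hA, hP₂]
    exact hi hp.2 h
  refine ⟨⟨by rw [hP₁]; exact hp.1.inv, by rw [hP₂]; exact hp.2.inv⟩, ?_⟩
  rw [next, hA, hB, hP₁, hP₂, nonsing_inv_nonsing_inv _ hp.1.det_pos.ne'.isUnit,
    nonsing_inv_nonsing_inv _ hp.2.det_pos.ne'.isUnit]

end Params

/-! ### Law of the source, induction over the steps, and the main theorem -/

theorem isCenteredGaussian_map {Ω : Type*} [MeasurableSpace Ω] {P : Measure Ω}
    [IsProbabilityMeasure P] {n m : ℕ} {X : Ω → E n} {Y : Ω → E m}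
    (hXY : HasGaussianLaw (fun ω => (X ω, Y ω)) P)
    (hX0 : ∫ ω, X ω ∂P = 0) (hY0 : ∫ ω, Y ω ∂P = 0) :
    IsCenteredGaussian (P.map fun ω => (X ω, Y ω)) (sourceCov P X Y) where
  isGaussian := hXY.isGaussian_map
  integral_eq_zero := by
    have hi := hXY.integrable
    rw [integral_map (f := fun z => z) hXY.aemeasurable aestronglyMeasurable_id, integral_pair hi.fst hi.snd, hX0,
      hY0]
    rfl
  crossCov_fst_fst := crossCov_map hXY.aemeasurable measurable_fst measurable_fst
  crossCov_snd_fst := crossCov_map hXY.aemeasurable measurable_snd measurable_fst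
  crossCov_snd_snd := crossCov_map hXY.aemeasurable measurable_snd measurable_snd

namespace Params

variable {n m k₁ k₂ : ℕ} {C : SourceCov n m} {β lam γ : ℝ}

theorem iterate_succ (p : Params n k₁ k₂) (t : ℕ) :
    p.iterate C β lam γ (t + 1) = (p.iterate C β lam γ t).next C β lam γ :=
  Function.iterate_succ_apply' _ _ _

theorem Feasible.nondegenerate_next {p : Params n k₁ k₂} (h : p.Feasible C β lam γ) :
    (p.next C β lam γ).Nondegenerate := ⟨h.1.inv, h.2.inv⟩

end Params

/-- Started at a Gaussian representation, the self-consistent iteration is the matrix iteration. -/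
theorem forall_isSuccessor_iff {n m k₁ k₂ : ℕ} {ν : Measure (E n × E m)} [IsProbabilityMeasure ν]
    {C : SourceCov n m} (hν : IsCenteredGaussian ν C) (hSX : C.SX.PosDef) (hSYgX : C.SYgX.PosDef)
    {β lam γ : ℝ} {p : Params n k₁ k₂} (hp : p.Nondegenerate)
    {κ₁ : ℕ → Kernel (E n) (E k₁)} {κ₂ : ℕ → Kernel (E n) (E k₂)}
    [∀ t, IsMarkovKernel (κ₁ t)] [∀ t, IsMarkovKernel (κ₂ t)]
    (h₁ : κ₁ 0 =ᵐ[ν.map Prod.fst] p.channel₁) (h₂ : κ₂ 0 =ᵐ[ν.map Prod.fst] p.channel₂) (N : ℕ) :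
    (∀ t < N, IsSuccessor ν β lam γ (κ₁ t) (κ₂ t) (κ₁ (t + 1)) (κ₂ (t + 1))) ↔
    (∀ t < N, (p.iterate C β lam γ t).Feasible C β lam γ ∧
      κ₁ (t + 1) =ᵐ[ν.map Prod.fst] (p.iterate C β lam γ (t + 1)).channel₁ ∧
      κ₂ (t + 1) =ᵐ[ν.map Prod.fst] (p.iterate C β lam γ (t + 1)).channel₂) := by
  induction N with
  | zero => simp
  | succ N ih =>
    rw [Nat.forall_lt_succ_right, Nat.forall_lt_succ_right, ih]
    refine and_congr_right fun h => ?_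
    -- The state at time `N` is the initial one or is described by the equivalence at the preceding
    -- step, whose feasibility makes the new noises nondegenerate.
    have key : (p.iterate C β lam γ N).Nondegenerate ∧
        κ₁ N =ᵐ[ν.map Prod.fst] (p.iterate C β lam γ N).channel₁ ∧
        κ₂ N =ᵐ[ν.map Prod.fst] (p.iterate C β lam γ N).channel₂ := by
      rcases N with _ | t
      · exact ⟨hp, h₁, h₂⟩
      · have ht := h t t.lt_succ_self
        refine ⟨?_, ht.2⟩
        rw [Params.iterate_succ]
        exact ht.1.nondegenerate_next
    rw [Params.iterate_succ]
    exact isSuccessor_iff hν hSX hSYgX key.1 key.2.1 key.2.2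

end DPFL

end

theorem theorem2 {Ω : Type*} [MeasurableSpace Ω] (P : Measure Ω) [IsProbabilityMeasure P]
    {n m k₁ k₂ : ℕ} (X : Ω → E n) (Y : Ω → E m)
    (hXY : HasGaussianLaw (fun ω => (X ω, Y ω)) P)
    (hX0 : ∫ ω, X ω ∂P = 0) (hY0 : ∫ ω, Y ω ∂P = 0)
    (C : SourceCov n m) (hC : C = sourceCov P X Y)
    (hSX : C.SX.PosDef) (hSYgX : C.SYgX.PosDef)
    (ν : Measure (E n × E m)) [IsProbabilityMeasure ν] (hν : ν = P.map fun ω => (X ω, Y ω))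
    (β lam γ : ℝ) (hβ : 0 < β) (hlam : 0 < lam) (hγ : 0 ≤ γ) :
    -- the matrices in the iteration are the parameters of the (conditional) laws
    (∀ p : Params n k₁ k₂, p.Nondegenerate →
      let μ := jointLaw ν p.channel₁ p.channel₂
      μ.map rvT₁ = multivariateGaussian 0 (p.ST₁ C) ∧
      μ.map rvT₂ = multivariateGaussian 0 (p.ST₂ C) ∧
      condDistrib rvY rvX μ =ᵐ[μ.map rvX]
        (fun x => multivariateGaussian (act C.Θ x) C.SYgX) ∧
      condDistrib rvT₂ rvT₁ μ =ᵐ[μ.map rvT₁]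
        (fun t₁ => multivariateGaussian (act (p.Ξ₁ C) t₁) (p.ST₂gT₁ C)) ∧
      condDistrib rvT₁ rvT₂ μ =ᵐ[μ.map rvT₂]
        (fun t₂ => multivariateGaussian (act (p.Ξ₂ C) t₂) (p.ST₁gT₂ C)) ∧
      condDistrib rvY rvT μ =ᵐ[μ.map rvT]
        (fun t => multivariateGaussian (act (p.Ψ₁ C) t.1 + act (p.Ψ₂ C) t.2) (p.SYgT C)) ∧
      (p.ST₁ C).PosDef ∧ (p.ST₂ C).PosDef ∧ (p.ST₂gT₁ C).PosDef ∧ (p.ST₁gT₂ C).PosDef ∧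
      (p.SYgT C).PosDef ∧
      mutualInfo rvY rvT μ ≠ ∞ ∧ mutualInfo rvT₁ rvX μ ≠ ∞ ∧
      mutualInfo rvT₂ rvX μ ≠ ∞ ∧ mutualInfo rvT₁ rvT₂ μ ≠ ∞) ∧
    -- started at Gaussian representations, the alternating self-consistent iteration is
    -- exactly the matrix iteration
    (∀ p : Params n k₁ k₂, p.Nondegenerate →
      ∀ (κ₁ : ℕ → Kernel (E n) (E k₁)) (κ₂ : ℕ → Kernel (E n) (E k₂))
        [∀ t, IsMarkovKernel (κ₁ t)] [∀ t, IsMarkovKernel (κ₂ t)],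
      κ₁ 0 =ᵐ[P.map X] p.channel₁ → κ₂ 0 =ᵐ[P.map X] p.channel₂ →
      ∀ N : ℕ,
        (∀ t < N, IsSuccessor ν β lam γ (κ₁ t) (κ₂ t) (κ₁ (t + 1)) (κ₂ (t + 1))) ↔
        (∀ t < N, (p.iterate C β lam γ t).Feasible C β lam γ ∧
          κ₁ (t + 1) =ᵐ[P.map X] (p.iterate C β lam γ (t + 1)).channel₁ ∧
          κ₂ (t + 1) =ᵐ[P.map X] (p.iterate C β lam γ (t + 1)).channel₂)) ∧
    -- the optimal Gaussian representations solve the self-consistent equations and are a fixed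
    -- point of the matrix iteration
    (∀ p : Params n k₁ k₂, p.Nondegenerate →
      (∀ q : Params n k₁ k₂, q.Nondegenerate →
        lagrangian ν β lam γ p.channel₁ p.channel₂ ≤
          lagrangian ν β lam γ q.channel₁ q.channel₂) →
      SelfConsistent ν β lam γ p.channel₁ p.channel₂ ∧
        p.Feasible C β lam γ ∧ p.next C β lam γ = p) := by
  have hν' : IsCenteredGaussian ν C := by
    rw [hν, hC]
    exact isCenteredGaussian_map hXY hX0 hY0
  have hX : P.map X = ν.map Prod.fst := by
    rw [hν, AEMeasurable.map_map_of_aemeasurable measurable_fst.aemeasurable hXY.aemeasurable]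
    rfl
  refine ⟨fun p hp => ?_, fun p hp κ₁ κ₂ _ _ h₁ h₂ N => ?_, fun p hp hmin => ?_⟩
  · have h := isGaussianModel_jointLaw hν' hp
    exact ⟨h.map_rvT₁ hSX hp, h.map_rvT₂ hSX hp, h.condDistrib_Y_X hSX hSYgX,
      h.condDistrib_T₂_T₁ hSX hp, h.condDistrib_T₁_T₂ hSX hp, h.condDistrib_Y_T hSX hSYgX hp,
      Params.ST₁_posDef hSX hp, Params.ST₂_posDef hSX hp, Params.ST₂gT₁_posDef hSX hp,
      Params.ST₁gT₂_posDef hSX hp, Params.SYgT_posDef hSX hSYgX hp,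
      (h.mutualInfo_Y_T hSX hSYgX hp).1, (h.mutualInfo_T₁_X hSX hp).1,
      (h.mutualInfo_T₂_X hSX hp).1, (h.mutualInfo_T₁_T₂ hSX hp).1⟩
  · rw [hX] at h₁ h₂ ⊢
    exact forall_isSuccessor_iff hν' hSX hSYgX hp h₁ h₂ N
  · have h := Params.feasible_and_next_eq_of_minimizer hν' hSX hSYgX hβ hlam hγ hp hmin
    refine ⟨?_, h⟩
    -- Self-consistency is the one-step equivalence with the successor equal to the pair itself.
    rw [SelfConsistent, isSuccessor_iff hν' hSX hSYgX hp .rfl .rfl, h.2]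
    exact ⟨h.1, .rfl, .rfl⟩
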